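/- Let $1\le p<2$ and $\beta>0$. A *solution* of the system $$-\tfrac12 r_1''+r_1=r_1^{2p+1}+\beta r_1^{p}r_2^{p+1},\qquad -\tfrac12 r_2''+r_2=r_2^{2p+1}+\beta r_2^{p}r_1^{p+1}\qquad\text{in }\mathbb R \tag{1}$$ means a pair $(r_1,r_2)$ of nonnegative functions in $C^2(\mathbb R)\cap H^1(\mathbb R)$ satisfying (1) pointwise. A *ground state* is a solution $R=(r_1,r_2)\ne(0,0)$ of least energy, i.e. minimizing $$\mathcal I(V)=\tfrac12\|\partial_xV\|_2^2-\tfrac1{p+1}\int_{\mathbb R}\big(|v_1|^{2p+2}+|v_2|^{2p+2}+2\beta|v_1v_2|^{p+1}\big)\,dx+\|V\|_2^2$$ among all solutions different from $(0,0)$ (one component of $R$ may vanish identically). Let $H_F(R)=(H^{ij})$ be the symmetric $2\times2$ matrix function with $$H^{11}=(2p+1)r_1^{2p}+p\beta r_1^{p-1}r_2^{p+1},\quad H^{12}=H^{21}=(p+1)\beta r_1^pr_2^p,\quad H^{22}=(2p+1)r_2^{2p}+p\beta r_2^{p-1}r_1^{p+1}$$ (with $r^{p-1}=1$ if $p=1$),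 and let $L_+=-\tfrac12\partial_{xx}+1-H_F(R)$, acting on real-valued pairs, with the associated quadratic form $$(L_+U,U)=\tfrac12\|\partial_xU\|_2^2+\|U\|_2^2-\int_{\mathbb R}H_F(R)U\cdot U\,dx,\qquad U\in H^1(\mathbb R,\mathbb R)^2 .$$ A ground state $R$ is *non-degenerate* if the set of real solutions $\Phi\in C^2\cap H^1$ of the linearized system $L_+\Phi=0$ is a one-dimensional vector space and every such solution is $\theta\,\partial_xR$ for some $\theta\in\mathbb R$. Put $$\mathcal V_0=\{U\in H^1(\mathbb R,\mathbb R)^2:\ (U,R)=0,\ (U,H_F(R)\partial_xR)=0\},$$ where $(\cdot,\cdot)$ is the $L^2$ inner product of pairs, and $\|U\|_{\mathbb H}^2=\|\partial_xU\|_2^2+\|U\|_2^2$. Let $R$ be a non-degenerate ground state. Then $$\inf_{U\in\mathcal V_0,\ U\ne0}\frac{(L_+U,U)}{\|U\|_2^2}>0 ;$$ that is, there is $\alpha_0>0$ with $(L_+V,V)\ge\alpha_0\|V\|_2^2$ for all $V\in\mathcal V_0$. Moreover, there are $\alpha>0$ and $C$ with $$\alpha\|V\|_{\mathbb H}^2\le(L_+V,V)\le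 C\|V\|_{\mathbb H}^2\qquad\text{for all }V\in\mathcal V_0 ,$$ and $|||V|||=\sqrt{(L_+V,V)}$ is a norm on the linear space $\mathcal V_0$, for which $\mathcal V_0$ is complete. -/

import Mathlib

open MeasureTheory Filter Topology
open scoped ContDiff ENNReal

noncomputable section

namespace NLSSystem

/-! ## Real Sobolev space `H¹(ℝ)` -/

/-- The real Hilbert space `L²(ℝ, ℝ)`. -/
abbrev L2 : Type := Lp ℝ 2 (volume : Measure ℝ)

/-- `g` is the weak derivative of `u`: `∫ u φ' = - ∫ g φ` for all test functions `φ`. -/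
def IsWeakDeriv (u g : L2) : Prop :=
  ∀ φ : ℝ → ℝ, ContDiff ℝ ∞ φ → HasCompactSupport φ →
    ∫ x, u x * deriv φ x = - ∫ x, g x * φ x

lemma integrable_mul_test (u : L2) {φ : ℝ → ℝ} (hφ : Continuous φ)
    (hc : HasCompactSupport φ) : Integrable (fun x => u x * φ x) := by
  have h : LocallyIntegrable (fun x => u x) (volume : Measure ℝ) :=
    (Lp.memLp u).locallyIntegrable (by norm_num)
  have := h.integrable_smul_right_of_hasCompactSupport hφ hc
  simpa only [smul_eq_mul] using this

lemma integral_add_mul (u v : L2) {φ : ℝ → ℝ} (hφ : Continuous φ) (hc : HasCompactSupport φ) :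
    ∫ x, (u + v : L2) x * φ x = (∫ x, u x * φ x) + ∫ x, v x * φ x := by
  rw [← integral_add (integrable_mul_test u hφ hc) (integrable_mul_test v hφ hc)]
  refine integral_congr_ae ?_
  filter_upwards [Lp.coeFn_add u v] with x hx
  rw [hx, Pi.add_apply, add_mul]

lemma integral_smul_mul (c : ℝ) (u : L2) (φ : ℝ → ℝ) :
    ∫ x, (c • u : L2) x * φ x = c * ∫ x, u x * φ x := by
  rw [← integral_const_mul]
  refine integral_congr_ae ?_
  filter_upwards [Lp.coeFn_smul c u] with x hx
  rw [hx, Pi.smul_apply, smul_eq_mul, mul_assoc]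

lemma integral_zero_mul (φ : ℝ → ℝ) : ∫ x, (0 : L2) x * φ x = 0 := by
  simp

/-- The real Sobolev space `H¹(ℝ)`, realised as the graph of the weak derivative: an element is
a pair `(u, u')` where `u ∈ L²` has the weak derivative `u' ∈ L²` (which is unique). -/
def H1 : Submodule ℝ (L2 × L2) where
  carrier := {w | IsWeakDeriv w.1 w.2}
  zero_mem' := by
    intro φ _ _
    simp only [Prod.fst_zero, Prod.snd_zero]
    rw [integral_zero_mul, integral_zero_mul, neg_zero]
  add_mem' := by
    intro a b ha hb φ h1 h2
    have hd : Continuous (deriv φ) := h1.continuous_deriv (by simp)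
    have e1 := ha φ h1 h2
    have e2 := hb φ h1 h2
    simp only [Prod.fst_add, Prod.snd_add]
    rw [integral_add_mul _ _ hd h2.deriv, integral_add_mul _ _ h1.continuous h2, e1, e2, neg_add]
  smul_mem' := by
    intro c a ha φ h1 h2
    have e1 := ha φ h1 h2
    simp only [Prod.smul_fst, Prod.smul_snd]
    rw [integral_smul_mul, integral_smul_mul, e1, mul_neg]

/-- The underlying `L²` function of an element of `H¹`. -/
def fn (u : H1) : L2 := u.1.1

/-- The weak derivative of an element of `H¹`. -/
def der (u : H1) : L2 := u.1.2

/-- Real-valued pairs `U = (u₁, u₂) ∈ H¹(ℝ) × H¹(ℝ)`. -/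
abbrev HH : Type := H1 × H1

/-- `‖U‖₂² = ‖u₁‖₂² + ‖u₂‖₂²`. -/
def l2NormSq (U : HH) : ℝ := ‖fn U.1‖ ^ 2 + ‖fn U.2‖ ^ 2

/-- `‖U‖_ℍ² = ‖∂ₓU‖₂² + ‖U‖₂²`. -/
def hNormSq (U : HH) : ℝ := (‖der U.1‖ ^ 2 + ‖der U.2‖ ^ 2) + l2NormSq U

/-! ## The elliptic system and its ground states -/

/-- `(r₁, r₂)` is a classical solution with nonnegative components and finite energy of
`-½ r₁'' + r₁ = r₁^(2p+1) + β r₁^p r₂^(p+1)`, `-½ r₂'' + r₂ = r₂^(2p+1) + β r₂^p r₁^(p+1)`. -/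
structure IsSolution (p β : ℝ) (r₁ r₂ : ℝ → ℝ) : Prop where
  contDiff₁ : ContDiff ℝ 2 r₁
  contDiff₂ : ContDiff ℝ 2 r₂
  nonneg₁ : ∀ x, 0 ≤ r₁ x
  nonneg₂ : ∀ x, 0 ≤ r₂ x
  memLp₁ : MemLp r₁ 2 volume
  memLp₂ : MemLp r₂ 2 volume
  memLp_deriv₁ : MemLp (deriv r₁) 2 volume
  memLp_deriv₂ : MemLp (deriv r₂) 2 volume
  eq₁ : ∀ x, -(1 / 2) * deriv (deriv r₁) x + r₁ x
    = r₁ x ^ (2 * p + 1) + β * r₁ x ^ p * r₂ x ^ (p + 1)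
  eq₂ : ∀ x, -(1 / 2) * deriv (deriv r₂) x + r₂ x
    = r₂ x ^ (2 * p + 1) + β * r₂ x ^ p * r₁ x ^ (p + 1)

/-- `F(u₁, u₂) = (|u₁|^(2p+2) + |u₂|^(2p+2) + 2β |u₁u₂|^(p+1)) / (p+1)`. -/
def F (p β u₁ u₂ : ℝ) : ℝ :=
  1 / (p + 1) * (|u₁| ^ (2 * p + 2) + |u₂| ^ (2 * p + 2) + 2 * β * |u₁ * u₂| ^ (p + 1))

/-- The energy `ℰ(V) = ½ ‖∂ₓV‖₂² - ∫ F(V)`. -/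
def energy (p β : ℝ) (v₁ v₂ : ℝ → ℝ) : ℝ :=
  1 / 2 * (∫ x, (deriv v₁ x ^ 2 + deriv v₂ x ^ 2)) - ∫ x, F p β (v₁ x) (v₂ x)

/-- The action `ℐ(V) = ℰ(V) + ‖V‖₂²`; its critical points are the solutions of the system. -/
def action (p β : ℝ) (v₁ v₂ : ℝ → ℝ) : ℝ :=
  energy p β v₁ v₂ + ∫ x, (v₁ x ^ 2 + v₂ x ^ 2)

/-- A ground state is a least-action solution among all solutions different from `(0, 0)`.
One of its two components may vanish identically. -/
structure IsGroundState (p β : ℝ) (r₁ r₂ : ℝ → ℝ) : Prop where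
  isSolution : IsSolution p β r₁ r₂
  ne_zero : (r₁, r₂) ≠ (0, 0)
  least : ∀ s₁ s₂ : ℝ → ℝ, IsSolution p β s₁ s₂ → (s₁, s₂) ≠ (0, 0) →
    action p β r₁ r₂ ≤ action p β s₁ s₂

/-! ## The Hessian matrix `H_F(R)` and the linearized system -/

/-- `H¹¹ = (2p+1) u₁^(2p) + pβ u₁^(p-1) u₂^(p+1)`. For `p = 1` the factor `u₁^(p-1)` is `1`. -/
def hess11 (p β u₁ u₂ : ℝ) : ℝ :=
  (2 * p + 1) * u₁ ^ (2 * p) + p * β * u₁ ^ (p - 1) * u₂ ^ (p + 1)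

/-- `H¹² = H²¹ = (p+1)β u₁^p u₂^p`. -/
def hess12 (p β u₁ u₂ : ℝ) : ℝ := (p + 1) * β * u₁ ^ p * u₂ ^ p

/-- `H²² = (2p+1) u₂^(2p) + pβ u₂^(p-1) u₁^(p+1)`. -/
def hess22 (p β u₁ u₂ : ℝ) : ℝ :=
  (2 * p + 1) * u₂ ^ (2 * p) + p * β * u₂ ^ (p - 1) * u₁ ^ (p + 1)

/-- `(φ, ψ)` is a (classical, `H¹`) solution of the linearized system `L₊(φ, ψ) = 0` at
`(r₁, r₂)`, that is `-½ φ'' + φ = H¹¹ φ + H¹² ψ` and `-½ ψ'' + ψ = H²² ψ + H¹² φ`. -/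
structure IsLinearizedSolution (p β : ℝ) (r₁ r₂ φ ψ : ℝ → ℝ) : Prop where
  contDiff₁ : ContDiff ℝ 2 φ
  contDiff₂ : ContDiff ℝ 2 ψ
  memLp₁ : MemLp φ 2 volume
  memLp₂ : MemLp ψ 2 volume
  memLp_deriv₁ : MemLp (deriv φ) 2 volume
  memLp_deriv₂ : MemLp (deriv ψ) 2 volume
  eq₁ : ∀ x, -(1 / 2) * deriv (deriv φ) x + φ x
    = hess11 p β (r₁ x) (r₂ x) * φ x + hess12 p β (r₁ x) (r₂ x) * ψ x
  eq₂ : ∀ x, -(1 / 2) * deriv (deriv ψ) x + ψ x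
    = hess22 p β (r₁ x) (r₂ x) * ψ x + hess12 p β (r₁ x) (r₂ x) * φ x

lemma deriv_add_fun {f g : ℝ → ℝ} (hf : ContDiff ℝ 1 f) (hg : ContDiff ℝ 1 g) :
    deriv (f + g) = deriv f + deriv g := by
  funext x
  exact deriv_add (hf.differentiable (by norm_num) x) (hg.differentiable (by norm_num) x)

lemma deriv_smul_fun (c : ℝ) (f : ℝ → ℝ) : deriv (c • f) = c • deriv f := by
  funext x
  simp [deriv_const_smul_field]

lemma contDiff_deriv {f : ℝ → ℝ} (hf : ContDiff ℝ 2 f) : ContDiff ℝ 1 (deriv f) :=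
  ((contDiff_succ_iff_deriv (n := 1)).1 (by simpa [one_add_one_eq_two] using hf)).2.2

/-- The vector space of solutions of the linearized system. -/
def linearizedSolutions (p β : ℝ) (r₁ r₂ : ℝ → ℝ) : Submodule ℝ ((ℝ → ℝ) × (ℝ → ℝ)) where
  carrier := {Φ | IsLinearizedSolution p β r₁ r₂ Φ.1 Φ.2}
  zero_mem' := by
    have h0 : deriv (0 : ℝ → ℝ) = 0 := by funext x; simp
    have hm : MemLp (0 : ℝ → ℝ) 2 volume := MemLp.zero
    constructor <;> simp only [Prod.fst_zero, Prod.snd_zero, h0]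
    · exact contDiff_const
    · exact contDiff_const
    · exact hm
    · exact hm
    · exact hm
    · exact hm
    · intro x; simp
    · intro x; simp
  add_mem' := by
    intro a b ha hb
    have d1 := deriv_add_fun (ha.contDiff₁.of_le (by norm_num)) (hb.contDiff₁.of_le (by norm_num))
    have d2 := deriv_add_fun (ha.contDiff₂.of_le (by norm_num)) (hb.contDiff₂.of_le (by norm_num))
    have e1 := deriv_add_fun (contDiff_deriv ha.contDiff₁) (contDiff_deriv hb.contDiff₁)
    have e2 := deriv_add_fun (contDiff_deriv ha.contDiff₂) (contDiff_deriv hb.contDiff₂)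
    constructor <;> simp only [Prod.fst_add, Prod.snd_add, d1, d2, e1, e2]
    · exact ha.contDiff₁.add hb.contDiff₁
    · exact ha.contDiff₂.add hb.contDiff₂
    · exact ha.memLp₁.add hb.memLp₁
    · exact ha.memLp₂.add hb.memLp₂
    · exact ha.memLp_deriv₁.add hb.memLp_deriv₁
    · exact ha.memLp_deriv₂.add hb.memLp_deriv₂
    · intro x
      have h1 := ha.eq₁ x
      have h2 := hb.eq₁ x
      simp only [Pi.add_apply]
      linarith
    · intro x
      have h1 := ha.eq₂ x
      have h2 := hb.eq₂ x
      simp only [Pi.add_apply]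
      linarith
  smul_mem' := by
    intro c a ha
    constructor <;> simp only [Prod.smul_fst, Prod.smul_snd, deriv_smul_fun]
    · exact contDiff_const.smul ha.contDiff₁
    · exact contDiff_const.smul ha.contDiff₂
    · exact ha.memLp₁.const_smul c
    · exact ha.memLp₂.const_smul c
    · exact ha.memLp_deriv₁.const_smul c
    · exact ha.memLp_deriv₂.const_smul c
    · intro x
      have h1 := ha.eq₁ x
      simp only [Pi.smul_apply, smul_eq_mul]
      linear_combination c * h1
    · intro x
      have h1 := ha.eq₂ x
      simp only [Pi.smul_apply, smul_eq_mul]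
      linear_combination c * h1

/-- Non-degeneracy: the solutions of the linearized system form a one-dimensional vector space,
and each of them is `θ ∂ₓR` for some `θ ∈ ℝ`. -/
def IsNondegenerate (p β : ℝ) (r₁ r₂ : ℝ → ℝ) : Prop :=
  Module.finrank ℝ (linearizedSolutions p β r₁ r₂) = 1 ∧
    ∀ Φ ∈ linearizedSolutions p β r₁ r₂, ∃ θ : ℝ, Φ = θ • (deriv r₁, deriv r₂)

/-! ## The operator `L₊` and the subspace `𝒱₀` -/

/-- The symmetric bilinear form `(L₊U, V)` of `L₊ = -½ ∂ₓₓ + 1 - H_F(R)` on `H¹ × H¹`: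
`½ ∫ ∂ₓU·∂ₓV + ∫ U·V - ∫ H_F(R)U·V`. -/
def Lplus (p β : ℝ) (r₁ r₂ : ℝ → ℝ) (U V : HH) : ℝ :=
  1 / 2 * (∫ x, (der U.1 x * der V.1 x + der U.2 x * der V.2 x))
    + (∫ x, (fn U.1 x * fn V.1 x + fn U.2 x * fn V.2 x))
    - ∫ x, ((hess11 p β (r₁ x) (r₂ x) * fn U.1 x + hess12 p β (r₁ x) (r₂ x) * fn U.2 x)
          * fn V.1 x
        + (hess12 p β (r₁ x) (r₂ x) * fn U.1 x + hess22 p β (r₁ x) (r₂ x) * fn U.2 x)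
          * fn V.2 x)

/-- `𝒱₀ = {U ∈ H¹ × H¹ : (U, R) = 0, (U, H_F(R) ∂ₓR) = 0}`. -/
def V0 (p β : ℝ) (r₁ r₂ : ℝ → ℝ) : Set HH :=
  {U | (∫ x, (fn U.1 x * r₁ x + fn U.2 x * r₂ x)) = 0 ∧
    (∫ x, (fn U.1 x * (hess11 p β (r₁ x) (r₂ x) * deriv r₁ x
              + hess12 p β (r₁ x) (r₂ x) * deriv r₂ x)
          + fn U.2 x * (hess12 p β (r₁ x) (r₂ x) * deriv r₁ x
              + hess22 p β (r₁ x) (r₂ x) * deriv r₂ x))) = 0}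

/-- `|||U||| = √(L₊U, U)`. -/
def tripleNorm (p β : ℝ) (r₁ r₂ : ℝ → ℝ) (U : HH) : ℝ := √(Lplus p β r₁ r₂ U U)

end NLSSystem

end

/-!
The proof rests on one sharp inequality. Put `F` on the unit circle, let `M` be its maximum, attained
at a direction `e`, and let `W(s) = s² - M s^(2p+2)`. Since `F(V) ≤ M |V|^(2p+2)`, completing the
square shows that the action density of `V` dominates the derivative of a primitive of `√(2W)` in
`|V|`, so the action of every `V` whose modulus has the positive zero of `W` as its maximum is at
least twice the integral of `√(2W)` up to that zero (`two_mul_profile_le`). The scalar solitary wave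
in the direction `e` is an explicit solution which attains this value (`exists_solution_action_eq`).
A ground state has at most the action of that wave; hence, after scaling and dilating, it optimizes
a Gagliardo-Nirenberg inequality (`IsGroundState.sharp`). No existence theory for ground states is
needed.

Differentiating that inequality twice at `R`, along `R + ε U` with `U ⟂ R` combined with a dilation
of size depending on `ε`, and optimizing the dilation, gives `(L₊U, U) ≥ c (∂ₓR, ∂ₓU)²` on `R^⊥`
with `c > 0` because `p < 2` (`IsGroundState.second_variation`, and `IsHessian.dirichlet_sq_le` on all
of `H¹`). So if `U ⟂ R` and `(L₊U, U) = 0`, then `(∂ₓR, ∂ₓU) = 0`, which together with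
`L₊R = -2p (-½ ∂ₓₓ + 1) R` gives `(L₊U, R) = 0`, and minimality gives `(L₊U, V) = 0` for `V ⟂ R`.
Thus `L₊U = 0` weakly, hence classically, and by non-degeneracy `U = θ ∂ₓR`. The second
orthogonality condition in `𝒱₀` then reads `(H_F(R)U, U) = 0`, so `0 = (L₊U, U)` is
the square of a norm of `U`, and `U = 0` (`IsHessian.eq_zero_of_schrodForm_eq_zero`).

Since `H_F(R)` is integrable, its quadratic form is weakly sequentially continuous on `H¹`, and a
form which is nonnegative and definite on the closed subspace `𝒱₀` is coercive there
(`exists_coercive`). The remaining assertions are consequences of coercivity.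
-/

noncomputable section

namespace NLSSystem

/-! ### Weak derivatives on the line -/

/-- The du Bois-Reymond lemma: a locally integrable function with vanishing weak derivative is
almost everywhere constant. -/
lemma exists_ae_eq_const_of_integral_mul_deriv_eq_zero {f : ℝ → ℝ} (hf : LocallyIntegrable f volume)
    (h : ∀ φ : ℝ → ℝ, ContDiff ℝ ∞ φ → HasCompactSupport φ → ∫ x, f x * deriv φ x = 0) :
    ∃ c : ℝ, f =ᵐ[volume] fun _ => c := by
  let B : ContDiffBump (0 : ℝ) := default
  set ψ : ℝ → ℝ := B.normed volume with hψdef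
  have hψ : ContDiff ℝ ∞ ψ := B.contDiff_normed
  have hψc : HasCompactSupport ψ := B.hasCompactSupport_normed
  have hψ1 : ∫ x, ψ x = 1 := B.integral_normed
  have hint : ∀ g : ℝ → ℝ, Continuous g → HasCompactSupport g → Integrable (fun x => f x * g x) := by
    intro g hg hgc
    simpa only [smul_eq_mul] using hf.integrable_smul_right_of_hasCompactSupport hg hgc
  refine ⟨∫ x, f x * ψ x, ?_⟩
  set c := ∫ x, f x * ψ x with hc
  refine ae_eq_of_integral_contDiff_smul_eq hf (locallyIntegrable_const c) ?_
  intro g hg hgc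
  set m := ∫ x, g x with hm
  -- `η` has vanishing integral, hence a compactly supported primitive
  set η : ℝ → ℝ := fun x => g x - m * ψ x with hη
  have hηs : ContDiff ℝ ∞ η := hg.sub (contDiff_const.mul hψ)
  have hηc : HasCompactSupport η := hgc.sub hψc.mul_left
  have hη0 : ∫ x, η x = 0 := by
    rw [hη, integral_sub (hg.continuous.integrable_of_hasCompactSupport hgc)
      ((hψ.continuous.integrable_of_hasCompactSupport hψc).const_mul m), integral_const_mul, hψ1]
    simp [hm]
  obtain ⟨a, ha⟩ : ∃ a : ℝ, ∀ x, a < |x| → η x = 0 := by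
    obtain ⟨a, ha⟩ := hηc.isCompact.isBounded.subset_closedBall 0
    refine ⟨a, fun x hx => ?_⟩
    by_contra hne
    have := ha (subset_tsupport _ hne)
    simp at this
    linarith
  have hηi : Integrable η := hηs.continuous.integrable_of_hasCompactSupport hηc
  set φ : ℝ → ℝ := fun x => ∫ t in Set.Iic x, η t with hφ
  have hφ' : φ = fun x => (∫ t in Set.Iic 0, η t) + ∫ t in (0 : ℝ)..x, η t := by
    funext x
    rw [← intervalIntegral.integral_Iic_sub_Iic hηi.integrableOn hηi.integrableOn]
    ring
  have hder : ∀ x, HasDerivAt φ (η x) x := by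
    intro x
    rw [hφ']
    exact (intervalIntegral.integral_hasDerivAt_right (hηi.intervalIntegrable)
      (hηs.continuous.stronglyMeasurableAtFilter _ _) hηs.continuous.continuousAt).const_add _
  have hderiv : deriv φ = η := funext fun x => (hder x).deriv
  have hφs : ContDiff ℝ ∞ φ :=
    contDiff_infty_iff_deriv.2 ⟨fun x => (hder x).differentiableAt, by rwa [hderiv]⟩
  have hφc : HasCompactSupport φ := by
    refine HasCompactSupport.intro (isCompact_closedBall (0 : ℝ) a) ?_
    intro x hx
    simp only [Metric.mem_closedBall, dist_zero_right, Real.norm_eq_abs, not_le] at hx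
    rcases le_or_gt 0 x with h0 | h0
    · have : ∫ t in Set.Ioi x, η t = 0 := by
        refine setIntegral_eq_zero_of_forall_eq_zero fun t ht => ha t ?_
        have ht' : x < t := ht
        rw [abs_of_nonneg h0] at hx
        rw [abs_of_nonneg (by linarith)]; linarith
      have h2 := intervalIntegral.integral_Iic_add_Ioi (b := x) hηi.integrableOn hηi.integrableOn
      rw [this, hη0, add_zero] at h2
      exact h2
    · refine setIntegral_eq_zero_of_forall_eq_zero fun t ht => ha t ?_
      have ht' : t ≤ x := ht
      rw [abs_of_neg h0] at hx
      rw [abs_of_neg (by linarith)]; linarith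
  have key := h φ hφs hφc
  rw [hderiv] at key
  have e1 : ∫ x, f x * η x = (∫ x, f x * g x) - m * c := by
    rw [hc, ← integral_const_mul, ← integral_sub (hint g hg.continuous hgc)
      ((hint ψ hψ.continuous hψc).const_mul m)]
    refine integral_congr_ae (Eventually.of_forall fun x => ?_)
    simp only [hη]; ring
  simp only [smul_eq_mul]
  rw [integral_mul_const, ← hm]
  have : ∫ x, g x * f x = ∫ x, f x * g x := by simp only [mul_comm]
  rw [this]
  linarith

lemma L2.locallyIntegrable (u : L2) : LocallyIntegrable (fun x => u x) volume :=
  (Lp.memLp u).locallyIntegrable (by norm_num)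

lemma L2.intervalIntegrable (u : L2) (a b : ℝ) : IntervalIntegrable (fun x => u x) volume a b :=
  (intervalIntegrable_iff).2 (((L2.locallyIntegrable u).integrableOn_isCompact
    isCompact_uIcc).mono_set Set.uIoc_subset_uIcc)

lemma deriv_primitive_ae_eq (g : L2) :
    deriv (fun x => ∫ t in (0 : ℝ)..x, g t) =ᵐ[volume] fun x => g x := by
  filter_upwards [LocallyIntegrable.ae_hasDerivAt_integral (L2.locallyIntegrable g)] with x hx
  exact (hx 0).deriv

lemma absolutelyContinuous_primitive (g : L2) (c a : ℝ) :
    AbsolutelyContinuousOnInterval (fun x => c + ∫ t in (0 : ℝ)..x, g t) (-a) a := by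
  have h := (L2.intervalIntegrable g (-|a|) |a|).absolutelyContinuousOnInterval_intervalIntegral
    (c := 0) (by rw [Set.uIcc_of_le (by linarith [abs_nonneg a])]; simp)
  have h2 : AbsolutelyContinuousOnInterval (fun _ : ℝ => c) (-|a|) |a| :=
    ContDiffOn.absolutelyContinuousOnInterval contDiffOn_const
  refine (h2.add h).mono ?_
  rw [Set.uIcc_of_le (by linarith [abs_nonneg a] : -|a| ≤ |a|)]
  intro x hx
  rw [Set.mem_uIcc] at hx
  constructor <;> cases abs_cases a <;> rcases hx with hx | hx <;> linarith

/-- An element of `H¹(ℝ)` is almost everywhere a primitive of its weak derivative. -/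
lemma exists_ae_eq_primitive (u : H1) :
    ∃ c : ℝ, (fun x => fn u x) =ᵐ[volume] fun x => c + ∫ t in (0 : ℝ)..x, der u t := by
  set G : ℝ → ℝ := fun x => ∫ t in (0 : ℝ)..x, der u t with hG
  have hGc : Continuous G :=
    intervalIntegral.continuous_primitive (fun a b => L2.intervalIntegrable _ a b) 0
  have hli : LocallyIntegrable (fun x => fn u x - G x) volume :=
    (L2.locallyIntegrable _).sub hGc.locallyIntegrable
  obtain ⟨c, hc⟩ := exists_ae_eq_const_of_integral_mul_deriv_eq_zero hli (by
    intro φ hφ hφc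
    have hd : Continuous (deriv φ) := hφ.continuous_deriv (by simp)
    have e1 := u.2 φ hφ hφc
    -- integration by parts for the absolutely continuous function `G`
    have e2 : ∫ x, G x * deriv φ x = - ∫ x, der u x * φ x := by
      obtain ⟨a, ha⟩ : ∃ a : ℝ, ∀ x, a ≤ |x| → φ x = 0 := by
        obtain ⟨a, ha⟩ := hφc.isCompact.isBounded.subset_ball 0
        refine ⟨a, fun x hx => ?_⟩
        by_contra hne
        have := ha (subset_tsupport _ hne)
        simp at this
        linarith
      obtain ⟨b, hb⟩ : ∃ b : ℝ, ∀ x, b ≤ |x| → deriv φ x = 0 := by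
        obtain ⟨a, ha⟩ := hφc.deriv.isCompact.isBounded.subset_ball 0
        refine ⟨a, fun x hx => ?_⟩
        by_contra hne
        have := ha (subset_tsupport _ hne)
        simp at this
        linarith
      set r := |a| + |b| + 1
      have har : a ≤ r := by have := le_abs_self a; have := abs_nonneg b; simp only [r]; linarith
      have hbr : b ≤ r := by have := le_abs_self b; have := abs_nonneg a; simp only [r]; linarith
      have hr0 : 0 ≤ r := by positivity
      have hAC : AbsolutelyContinuousOnInterval G (-r) r := by
        simpa using absolutelyContinuous_primitive (der u) 0 r
      have hφAC : AbsolutelyContinuousOnInterval φ (-r) r :=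
        ContDiffOn.absolutelyContinuousOnInterval (hφ.of_le (by simp)).contDiffOn
      have h := hAC.integral_mul_deriv_eq_deriv_mul hφAC
      rw [ha r (by rw [abs_of_nonneg hr0]; exact har),
        ha (-r) (by rw [abs_neg, abs_of_nonneg hr0]; exact har)] at h
      have l1 : ∫ x in (-r)..r, G x * deriv φ x = ∫ x, G x * deriv φ x := by
        rw [intervalIntegral.integral_of_le (by linarith)]
        refine setIntegral_eq_integral_of_forall_compl_eq_zero fun x hx => ?_
        rw [hb x, mul_zero]
        simp only [Set.mem_Ioc, not_and_or, not_lt, not_le] at hx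
        rcases hx with hx | hx
        · have := neg_le_abs x; linarith
        · have := le_abs_self x; linarith
      have l2 : ∫ x in (-r)..r, deriv G x * φ x = ∫ x, der u x * φ x := by
        rw [intervalIntegral.integral_of_le (by linarith)]
        rw [setIntegral_eq_integral_of_forall_compl_eq_zero]
        · refine integral_congr_ae ?_
          filter_upwards [deriv_primitive_ae_eq (der u)] with x hx
          simp only [hG, hx]
        · intro x hx
          rw [ha x, mul_zero]
          simp only [Set.mem_Ioc, not_and_or, not_lt, not_le] at hx
          rcases hx with hx | hx
          · have := neg_le_abs x; linarith
          · have := le_abs_self x; linarith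
      rw [l1, l2] at h
      rw [h]; ring
    have i1 : Integrable (fun x => fn u x * deriv φ x) := integrable_mul_test _ hd hφc.deriv
    have i2 : Integrable (fun x => G x * deriv φ x) :=
      (hGc.mul hd).integrable_of_hasCompactSupport hφc.deriv.mul_left
    have e3 : ∫ x, (fn u x - G x) * deriv φ x
        = (∫ x, fn u x * deriv φ x) - ∫ x, G x * deriv φ x := by
      rw [← integral_sub i1 i2]
      simp only [sub_mul]
    rw [e3, e2]
    change (∫ x, fn u x * deriv φ x) = _ at e1
    rw [e1]
    exact sub_self _)
  refine ⟨c, ?_⟩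
  filter_upwards [hc] with x hx
  simp only [hG] at hx ⊢
  linarith

/-- The continuous representative of an element of `H¹(ℝ)`. -/
def rep (u : H1) (x : ℝ) : ℝ :=
  (exists_ae_eq_primitive u).choose + ∫ t in (0 : ℝ)..x, der u t

lemma fn_ae_eq_rep (u : H1) : (fun x => fn u x) =ᵐ[volume] rep u :=
  (exists_ae_eq_primitive u).choose_spec

lemma continuous_rep (u : H1) : Continuous (rep u) :=
  continuous_const.add
    (intervalIntegral.continuous_primitive (fun a b => L2.intervalIntegrable _ a b) 0)

lemma absolutelyContinuous_rep (u : H1) (a : ℝ) :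
    AbsolutelyContinuousOnInterval (rep u) (-a) a :=
  absolutelyContinuous_primitive _ _ a

lemma deriv_rep_ae_eq (u : H1) : deriv (rep u) =ᵐ[volume] fun x => der u x := by
  filter_upwards [deriv_primitive_ae_eq (der u)] with x hx
  rw [← hx]
  exact deriv_const_add _

/-- If the weak derivative has a continuous representative, it is a classical derivative. -/
lemma hasDerivAt_rep {u : H1} {g : ℝ → ℝ} (hg : Continuous g)
    (h : (fun x => der u x) =ᵐ[volume] g) (x : ℝ) : HasDerivAt (rep u) (g x) x := by
  have e : rep u = fun x => (exists_ae_eq_primitive u).choose + ∫ t in (0 : ℝ)..x, g t := by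
    funext y
    unfold rep
    congr 1
    refine intervalIntegral.integral_congr_ae ?_
    filter_upwards [h] with t ht _ using ht
  rw [e]
  exact (intervalIntegral.integral_hasDerivAt_right (hg.intervalIntegrable _ _)
      (hg.stronglyMeasurableAtFilter _ _) hg.continuousAt).const_add _

lemma L2.inner_eq (u v : L2) : inner ℝ u v = ∫ x, u x * v x := by
  rw [MeasureTheory.L2.inner_def]
  refine integral_congr_ae (Eventually.of_forall fun x => ?_)
  simp [mul_comm]

lemma L2.integrable_mul (u v : L2) : Integrable (fun x => u x * v x) :=
  (Lp.memLp u).integrable_mul (Lp.memLp v)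

lemma L2.inner_toLp_right (u : L2) {f : ℝ → ℝ} (hf : MemLp f 2 volume) :
    inner ℝ u (hf.toLp f) = ∫ x, u x * f x := by
  rw [L2.inner_eq]
  refine integral_congr_ae ?_
  filter_upwards [hf.coeFn_toLp] with x hx
  rw [hx]

lemma L2.norm_sq_eq (u : L2) : ‖u‖ ^ 2 = ∫ x, u x ^ 2 := by
  rw [← real_inner_self_eq_norm_sq, L2.inner_eq]
  simp only [pow_two]

lemma memLp_of_test {φ : ℝ → ℝ} (h : Continuous φ) (hc : HasCompactSupport φ) :
    MemLp φ 2 volume :=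
  h.memLp_of_hasCompactSupport hc

/-! ### Classical functions in `H¹(ℝ)` and their density -/

/-- A continuously differentiable function which is square integrable together with its
derivative. -/
structure IsC1H1 (v : ℝ → ℝ) : Prop where
  contDiff : ContDiff ℝ 1 v
  memLp : MemLp v 2 volume
  memLp_deriv : MemLp (deriv v) 2 volume

namespace IsC1H1

variable {u v : ℝ → ℝ}

lemma hasDerivAt (h : IsC1H1 v) (x : ℝ) : HasDerivAt v (deriv v x) x :=
  (h.contDiff.differentiable (by norm_num) x).hasDerivAt

lemma continuous (h : IsC1H1 v) : Continuous v := h.contDiff.continuous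

lemma continuous_deriv (h : IsC1H1 v) : Continuous (deriv v) :=
  h.contDiff.continuous_deriv (by norm_num)

lemma of_test (h : ContDiff ℝ ∞ v) (hc : HasCompactSupport v) : IsC1H1 v where
  contDiff := h.of_le (by simp)
  memLp := memLp_of_test h.continuous hc
  memLp_deriv := memLp_of_test (h.continuous_deriv (by simp)) hc.deriv

lemma add (hu : IsC1H1 u) (hv : IsC1H1 v) : IsC1H1 (u + v) where
  contDiff := hu.contDiff.add hv.contDiff
  memLp := hu.memLp.add hv.memLp
  memLp_deriv := by
    rw [deriv_add_fun hu.contDiff hv.contDiff]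
    exact hu.memLp_deriv.add hv.memLp_deriv

lemma const_smul (c : ℝ) (hv : IsC1H1 v) : IsC1H1 (c • v) where
  contDiff := contDiff_const.smul hv.contDiff
  memLp := hv.memLp.const_smul c
  memLp_deriv := by
    rw [deriv_smul_fun]
    exact hv.memLp_deriv.const_smul c

lemma zero : IsC1H1 (0 : ℝ → ℝ) where
  contDiff := contDiff_const
  memLp := MemLp.zero
  memLp_deriv := by
    have h0 : deriv (0 : ℝ → ℝ) = 0 := by funext x; simp
    rw [h0]
    exact MemLp.zero

lemma integral_mul_deriv (hu : IsC1H1 u) (hv : IsC1H1 v) :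
    ∫ x, u x * deriv v x = - ∫ x, deriv u x * v x :=
  integral_mul_deriv_eq_deriv_mul_of_integrable (fun x _ => hu.hasDerivAt x)
    (fun x _ => hv.hasDerivAt x) (hu.memLp.integrable_mul hv.memLp_deriv)
    (hu.memLp_deriv.integrable_mul hv.memLp) (hu.memLp.integrable_mul hv.memLp)

/-- A classical function as an element of `H¹(ℝ)`. -/
def toH1 (h : IsC1H1 v) : H1 :=
  ⟨(h.memLp.toLp v, h.memLp_deriv.toLp (deriv v)), by
    intro φ hφ hc
    have e1 : ∫ x, (h.memLp.toLp v) x * deriv φ x = ∫ x, v x * deriv φ x :=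
      integral_congr_ae (by filter_upwards [h.memLp.coeFn_toLp] with x hx; rw [hx])
    have e2 : ∫ x, (h.memLp_deriv.toLp (deriv v)) x * φ x = ∫ x, deriv v x * φ x :=
      integral_congr_ae (by filter_upwards [h.memLp_deriv.coeFn_toLp] with x hx; rw [hx])
    change ∫ x, (h.memLp.toLp v) x * deriv φ x = - ∫ x, (h.memLp_deriv.toLp (deriv v)) x * φ x
    rw [e1, e2, h.integral_mul_deriv (of_test hφ hc)]⟩

lemma fn_toH1 (h : IsC1H1 v) : fn h.toH1 = h.memLp.toLp v := rfl

lemma der_toH1 (h : IsC1H1 v) : der h.toH1 = h.memLp_deriv.toLp (deriv v) := rfl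

lemma fn_toH1_ae (h : IsC1H1 v) : (fun x => fn h.toH1 x) =ᵐ[volume] v := h.memLp.coeFn_toLp

lemma der_toH1_ae (h : IsC1H1 v) : (fun x => der h.toH1 x) =ᵐ[volume] deriv v :=
  h.memLp_deriv.coeFn_toLp

lemma toH1_add (hu : IsC1H1 u) (hv : IsC1H1 v) : (hu.add hv).toH1 = hu.toH1 + hv.toH1 := by
  refine Subtype.ext (Prod.ext (MemLp.toLp_add hu.memLp hv.memLp) ?_)
  refine Eq.trans ?_ (MemLp.toLp_add hu.memLp_deriv hv.memLp_deriv)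
  exact MemLp.toLp_congr (hu.add hv).memLp_deriv _ (Eventually.of_forall fun x =>
    congrFun (deriv_add_fun hu.contDiff hv.contDiff) x)

lemma toH1_const_smul (c : ℝ) (hv : IsC1H1 v) : (hv.const_smul c).toH1 = c • hv.toH1 := by
  refine Subtype.ext (Prod.ext (MemLp.toLp_const_smul c hv.memLp) ?_)
  refine Eq.trans ?_ (MemLp.toLp_const_smul c hv.memLp_deriv)
  exact MemLp.toLp_congr (hv.const_smul c).memLp_deriv _ (Eventually.of_forall fun x =>
    congrFun (deriv_smul_fun c v) x)

lemma toH1_zero : (zero).toH1 = 0 := by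
  refine Subtype.ext (Prod.ext (MemLp.toLp_zero zero.memLp) ?_)
  have h0 : deriv (0 : ℝ → ℝ) =ᵐ[volume] 0 := Eventually.of_forall fun x => by simp
  exact (MemLp.toLp_eq_toLp_iff zero.memLp_deriv MemLp.zero).2 h0

end IsC1H1

lemma isWeakDeriv_iff_inner {u g : L2} : IsWeakDeriv u g ↔ ∀ (φ : ℝ → ℝ) (h : ContDiff ℝ ∞ φ)
    (hc : HasCompactSupport φ),
    inner ℝ u ((IsC1H1.of_test h hc).memLp_deriv.toLp _)
      + inner ℝ g ((IsC1H1.of_test h hc).memLp.toLp _) = 0 := by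
  refine forall_congr' fun φ => forall_congr' fun h => forall_congr' fun hc => ?_
  rw [L2.inner_toLp_right, L2.inner_toLp_right]
  exact eq_neg_iff_add_eq_zero

/-- The equation `w' = σ w` has no nonzero square integrable weak solution. -/
lemma eq_zero_of_isWeakDeriv_smul {w : L2} {σ : ℝ} (hσ : σ ≠ 0) (h : IsWeakDeriv w (σ • w)) :
    w = 0 := by
  have hli : LocallyIntegrable (fun x => w x * Real.exp (-σ * x)) volume :=
    LocallyIntegrable.mul_continuous (by fun_prop) (L2.locallyIntegrable w)
  obtain ⟨c, hc⟩ := exists_ae_eq_const_of_integral_mul_deriv_eq_zero hli (by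
    intro φ hφ hφc
    have hexp : ContDiff ℝ ∞ (fun x : ℝ => Real.exp (-σ * x)) :=
      Real.contDiff_exp.comp (contDiff_const.mul contDiff_id)
    have hχ : ContDiff ℝ ∞ (fun x => Real.exp (-σ * x) * φ x) := hexp.mul hφ
    have hχc : HasCompactSupport (fun x => Real.exp (-σ * x) * φ x) := hφc.mul_left
    have hd : deriv (fun x => Real.exp (-σ * x) * φ x)
        = fun x => Real.exp (-σ * x) * deriv φ x - σ * (Real.exp (-σ * x) * φ x) := by
      funext x
      have h1 : HasDerivAt (fun x : ℝ => Real.exp (-σ * x)) (Real.exp (-σ * x) * (-σ)) x := by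
        simpa using ((hasDerivAt_id x).const_mul (-σ)).exp
      have h2 : HasDerivAt φ (deriv φ x) x :=
        ((hφ.differentiable (by simp)) x).hasDerivAt
      rw [(h1.fun_mul h2).deriv]
      ring
    have key := h _ hχ hχc
    rw [hd, integral_smul_mul] at key
    have i1 : Integrable (fun x => w x * (Real.exp (-σ * x) * deriv φ x)) :=
      integrable_mul_test w (hexp.continuous.mul (hφ.continuous_deriv (by simp)))
        hφc.deriv.mul_left
    have i2 : Integrable (fun x => w x * (Real.exp (-σ * x) * φ x)) :=
      integrable_mul_test w hχ.continuous hχc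
    have e : ∫ x, w x * (Real.exp (-σ * x) * deriv φ x - σ * (Real.exp (-σ * x) * φ x))
        = (∫ x, w x * (Real.exp (-σ * x) * deriv φ x))
          - σ * ∫ x, w x * (Real.exp (-σ * x) * φ x) := by
      rw [← integral_const_mul, ← integral_sub i1 (i2.const_mul σ)]
      refine integral_congr_ae (Eventually.of_forall fun x => ?_)
      simp only; ring
    rw [e] at key
    simp only [mul_assoc]
    linarith)
  have hw : (fun x => w x ^ 2) =ᵐ[volume] fun x => c ^ 2 * Real.exp (2 * σ * x) := by
    filter_upwards [hc] with x hx
    have : w x = c * Real.exp (σ * x) := by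
      rw [← hx, mul_assoc, ← Real.exp_add]; simp
    rw [this, mul_pow, ← Real.exp_nat_mul]
    congr 2
    push_cast; ring
  have hint : Integrable (fun x => c ^ 2 * Real.exp (2 * σ * x)) :=
    (Lp.memLp w).integrable_sq.congr hw
  have h0 := integral_eq_zero_of_hasDerivAt_of_integrable (f := fun x => c ^ 2 * Real.exp (2 * σ * x))
    (f' := fun x => (2 * σ) * (c ^ 2 * Real.exp (2 * σ * x))) (fun x => by
      have := (((hasDerivAt_id x).const_mul (2 * σ)).exp).const_mul (c ^ 2)
      simp only [id, mul_one] at this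
      exact this.congr_deriv (by ring)) (hint.const_mul _) hint
  rw [integral_const_mul, ← integral_congr_ae hw, ← L2.norm_sq_eq] at h0
  simpa [hσ] using h0

/-- Classical functions are dense in `H¹(ℝ)`. -/
lemma exists_isC1H1_approx (u : H1) {ε : ℝ} (hε : 0 < ε) : ∃ (v : ℝ → ℝ) (hv : IsC1H1 v),
    ‖fn u - fn hv.toH1‖ < ε ∧ ‖der u - der hv.toH1‖ < ε := by
  let K : Submodule ℝ (WithLp 2 (L2 × L2)) :=
    { carrier := {w | ∃ (v : ℝ → ℝ) (hv : IsC1H1 v), w = WithLp.toLp 2 (fn hv.toH1, der hv.toH1)}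
      zero_mem' := ⟨0, IsC1H1.zero, by rw [IsC1H1.toH1_zero]; rfl⟩
      add_mem' := by
        rintro a b ⟨v, hv, rfl⟩ ⟨w, hw, rfl⟩
        exact ⟨v + w, hv.add hw, by rw [IsC1H1.toH1_add hv hw]; rfl⟩
      smul_mem' := by
        rintro c a ⟨v, hv, rfl⟩
        exact ⟨c • v, hv.const_smul c, by rw [IsC1H1.toH1_const_smul c hv]; rfl⟩ }
  have hcl : ∀ w ∈ K.topologicalClosure, IsWeakDeriv w.fst w.snd := by
    intro w hw
    rw [isWeakDeriv_iff_inner]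
    intro φ h hc
    have hclosed : IsClosed {w : WithLp 2 (L2 × L2) |
        inner ℝ w.fst ((IsC1H1.of_test h hc).memLp_deriv.toLp _)
          + inner ℝ w.snd ((IsC1H1.of_test h hc).memLp.toLp _) = 0} := by
      refine isClosed_eq ?_ continuous_const
      fun_prop
    refine hclosed.closure_subset_iff.2 ?_ hw
    rintro _ ⟨v, hv, rfl⟩
    exact isWeakDeriv_iff_inner.1 hv.toH1.2 φ h hc
  obtain ⟨k, hk, z, hz, hkz⟩ :=
    K.topologicalClosure.exists_add_mem_mem_orthogonal (WithLp.toLp 2 (fn u, der u))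
  have hz1 : IsWeakDeriv z.fst z.snd := by
    have h1 := hcl k hk
    have e : ((z.fst, z.snd) : L2 × L2) = u.1 - (k.fst, k.snd) := by
      have e1 : z = WithLp.toLp 2 (fn u, der u) - k := by rw [hkz]; abel
      rw [e1]; rfl
    have : u.1 - (k.fst, k.snd) ∈ H1 := H1.sub_mem u.2 h1
    rw [← e] at this
    exact this
  have hz2 : IsWeakDeriv z.snd z.fst := by
    rw [isWeakDeriv_iff_inner]
    intro φ h hc
    have hmem : WithLp.toLp 2 (fn (IsC1H1.of_test h hc).toH1, der (IsC1H1.of_test h hc).toH1)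
        ∈ K.topologicalClosure := K.le_topologicalClosure ⟨φ, IsC1H1.of_test h hc, rfl⟩
    have := Submodule.inner_left_of_mem_orthogonal hmem hz
    rw [WithLp.prod_inner_apply] at this
    rw [add_comm]
    exact this
  have hp : z.fst + z.snd = 0 := by
    refine eq_zero_of_isWeakDeriv_smul one_ne_zero ?_
    have : ((z.fst, z.snd) : L2 × L2) + (z.snd, z.fst) ∈ H1 := H1.add_mem hz1 hz2
    rw [one_smul]
    change IsWeakDeriv (z.fst + z.snd) (z.snd + z.fst) at this
    rwa [add_comm z.snd] at this
  have hm : z.fst - z.snd = 0 := by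
    refine eq_zero_of_isWeakDeriv_smul (neg_ne_zero.2 one_ne_zero) ?_
    have : ((z.fst, z.snd) : L2 × L2) - (z.snd, z.fst) ∈ H1 := H1.sub_mem hz1 hz2
    rw [neg_smul, one_smul, neg_sub]
    exact this
  have hz0 : z = 0 := by
    have h1 : z.fst = 0 := by
      have : (2 : ℝ) • z.fst = (z.fst + z.snd) + (z.fst - z.snd) := by rw [two_smul]; abel
      rw [hp, hm, add_zero] at this
      simpa using this
    have h2 : z.snd = 0 := by rw [h1, zero_add] at hp; exact hp
    rw [WithLp.ext_iff]
    exact Prod.ext h1 h2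
  rw [hz0, add_zero] at hkz
  rw [← hkz] at hk
  obtain ⟨w, ⟨v, hv, rfl⟩, hd⟩ := Metric.mem_closure_iff.1 hk ε hε
  refine ⟨v, hv, ?_⟩
  rw [dist_eq_norm] at hd
  have hn := WithLp.prod_norm_sq_eq_of_L2
    (WithLp.toLp 2 (fn u, der u) - WithLp.toLp 2 (fn hv.toH1, der hv.toH1))
  change _ = ‖fn u - fn hv.toH1‖ ^ 2 + ‖der u - der hv.toH1‖ ^ 2 at hn
  constructor
  · refine lt_of_le_of_lt (abs_le_of_sq_le_sq' ?_ (norm_nonneg _)).2 hd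
    rw [hn]; nlinarith [sq_nonneg ‖der u - der hv.toH1‖]
  · refine lt_of_le_of_lt (abs_le_of_sq_le_sq' ?_ (norm_nonneg _)).2 hd
    rw [hn]; nlinarith [sq_nonneg ‖fn u - fn hv.toH1‖]

/-- Weak sequential compactness of bounded sets of `L²`. -/
lemma L2.exists_weak_subseq {u : ℕ → L2} {C : ℝ} (hu : ∀ n, ‖u n‖ ≤ C) :
    ∃ (w : L2) (k : ℕ → ℕ), StrictMono k ∧
      ∀ z : L2, Tendsto (fun n => inner ℝ (u (k n)) z) atTop (𝓝 (inner ℝ w z)) := by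
  have : Fact ((2 : ℝ≥0∞) ≠ ⊤) := ⟨by norm_num⟩
  have : SecondCountableTopology L2 := Lp.SecondCountableTopology
  let e := InnerProductSpace.toDual ℝ L2
  obtain ⟨a, _, k, hk, ha⟩ := WeakDual.isSeqCompact_closedBall ℝ L2 0 C
    (x := fun n => StrongDual.toWeakDual (e (u n))) (by
      intro n
      simp only [Set.mem_preimage, Metric.mem_closedBall, dist_zero_right]
      change ‖e (u n)‖ ≤ C
      rw [LinearIsometryEquiv.norm_map]
      exact hu n)
  refine ⟨e.symm (WeakDual.toStrongDual a), k, hk, fun z => ?_⟩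
  have h1 := ((WeakDual.eval_continuous z).tendsto a).comp ha
  have h2 : inner ℝ (e.symm (WeakDual.toStrongDual a)) z = a z := by
    rw [InnerProductSpace.toDual_symm_apply]; rfl
  rw [h2]
  exact h1

/-- Evaluation of the continuous representative at a point is a bounded functional on `H¹(ℝ)`,
uniformly in the point. -/
lemma exists_rep_eq_inner (x : ℝ) : ∃ a b : L2, ‖a‖ ≤ 1 ∧ ‖b‖ ≤ 1 ∧
    ∀ u : H1, rep u x = inner ℝ (fn u) a + inner ℝ (der u) b := by
  have hle : x ≤ x + 1 := by linarith
  have hfin : volume (Set.Ioc x (x + 1)) ≠ ⊤ := by simp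
  set a : L2 := indicatorConstLp 2 measurableSet_Ioc hfin (1 : ℝ) with ha
  have hna : ‖a‖ = 1 := by
    rw [ha, norm_indicatorConstLp (by norm_num) (by norm_num)]
    simp
  have haae : a =ᵐ[volume] (Set.Ioc x (x + 1)).indicator fun _ => (1 : ℝ) := indicatorConstLp_coeFn
  set f : ℝ → ℝ := (Set.Ioc x (x + 1)).indicator fun z => z - (x + 1) with hf
  have hfm : AEStronglyMeasurable f volume :=
    ((continuous_id.sub continuous_const).stronglyMeasurable.indicator
      measurableSet_Ioc).aestronglyMeasurable
  have hfle : ∀ᵐ z, ‖f z‖ ≤ 1 * ‖a z‖ := by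
    filter_upwards [haae] with z hz
    rw [hz, hf]
    by_cases hzm : z ∈ Set.Ioc x (x + 1)
    · rw [Set.indicator_of_mem hzm, Set.indicator_of_mem hzm, Real.norm_eq_abs, abs_le]
      constructor <;> simp <;> linarith [hzm.1, hzm.2]
    · rw [Set.indicator_of_notMem hzm, Set.indicator_of_notMem hzm]; simp
  have hfL : MemLp f 2 volume := (Lp.memLp a).of_le_mul hfm hfle
  refine ⟨a, hfL.toLp f, hna.le, ?_, fun u => ?_⟩
  · refine (Lp.norm_le_mul_norm_of_ae_le_mul (c := 1) (g := a) ?_).trans (by rw [hna, one_mul])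
    filter_upwards [hfle, hfL.coeFn_toLp] with z hz hz2
    rw [hz2]; exact hz
  · have hAC : AbsolutelyContinuousOnInterval (rep u) x (x + 1) := by
      refine (absolutelyContinuous_rep u (|x| + 1)).mono ?_
      rw [Set.uIcc_of_le hle, Set.uIcc_of_le (by linarith [abs_nonneg x])]
      exact Set.Icc_subset_Icc (by linarith [neg_abs_le x]) (by linarith [le_abs_self x])
    have hAC2 : AbsolutelyContinuousOnInterval (fun z => z - (x + 1)) x (x + 1) :=
      ContDiffOn.absolutelyContinuousOnInterval (contDiffOn_id.sub contDiffOn_const)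
    have h := hAC.integral_mul_deriv_eq_deriv_mul hAC2
    have hd : deriv (fun z : ℝ => z - (x + 1)) = fun _ => 1 := by
      funext z; simp
    rw [hd] at h
    have e1 : ∫ z in x..(x + 1), rep u z * 1 = inner ℝ (fn u) a := by
      rw [L2.inner_eq, intervalIntegral.integral_of_le hle, ← integral_indicator measurableSet_Ioc]
      refine integral_congr_ae ?_
      filter_upwards [haae, fn_ae_eq_rep u] with z hz hz2
      rw [hz, hz2]
      by_cases hzm : z ∈ Set.Ioc x (x + 1) <;> simp [hzm]
    have e2 : ∫ z in x..(x + 1), deriv (rep u) z * (z - (x + 1)) = inner ℝ (der u) (hfL.toLp f) := by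
      rw [L2.inner_toLp_right, intervalIntegral.integral_of_le hle,
        ← integral_indicator measurableSet_Ioc]
      refine integral_congr_ae ?_
      filter_upwards [deriv_rep_ae_eq u] with z hz
      by_cases hzm : z ∈ Set.Ioc x (x + 1) <;> simp [hf, hzm, hz]
    rw [e1, e2] at h
    linarith

/-! ### The nonlinearity and its derivatives -/

lemma hasDerivAt_abs_rpow_mul_self {q : ℝ} (hq : 0 ≤ q) (x : ℝ) :
    HasDerivAt (fun y : ℝ => |y| ^ q * y) ((q + 1) * |x| ^ q) x := by
  rcases hq.eq_or_lt with rfl | hq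
  · simpa using hasDerivAt_id' x
  rcases lt_trichotomy x 0 with hx | rfl | hx
  · have h : HasDerivAt (fun y : ℝ => -(-y) ^ (q + 1)) ((q + 1) * |x| ^ q) x := by
      have := ((hasDerivAt_id x).neg.rpow_const (p := q + 1) (Or.inl (by simpa using hx.ne))).neg
      refine this.congr_deriv ?_
      rw [abs_of_neg hx]; simp; ring
    refine h.congr_of_eventuallyEq ?_
    filter_upwards [Iio_mem_nhds hx] with y hy
    have hy : y < 0 := hy
    rw [abs_of_neg hy, Real.rpow_add_one (by linarith)]; ring
  · have h1 : Tendsto (fun t : ℝ => |t| ^ q) (𝓝[≠] 0) (𝓝 0) := by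
      have : ContinuousAt (fun t : ℝ => |t| ^ q) 0 :=
        (continuous_abs.rpow_const fun _ => Or.inr hq.le).continuousAt
      have h := this.tendsto
      simp only [abs_zero, Real.zero_rpow hq.ne'] at h
      exact h.mono_left nhdsWithin_le_nhds
    rw [hasDerivAt_iff_tendsto_slope, abs_zero, Real.zero_rpow hq.ne', mul_zero]
    refine h1.congr' ?_
    filter_upwards [self_mem_nhdsWithin] with t ht
    have ht : t ≠ 0 := ht
    rw [slope_def_field]
    simp [ht]
  · have h : HasDerivAt (fun y : ℝ => y ^ (q + 1)) ((q + 1) * |x| ^ q) x := by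
      have := ((hasDerivAt_id x).rpow_const (p := q + 1) (Or.inl (by simpa using hx.ne')))
      refine this.congr_deriv ?_
      rw [abs_of_pos hx]; simp
    refine h.congr_of_eventuallyEq ?_
    filter_upwards [Ioi_mem_nhds hx] with y hy
    have hy : 0 < y := hy
    rw [abs_of_pos hy, Real.rpow_add_one (by linarith)]

/-- The partial derivative of `F` in its first argument; by symmetry `gradF p β u₂ u₁` is the
partial derivative in the second one. -/
def gradF (p β u₁ u₂ : ℝ) : ℝ :=
  2 * (|u₁| ^ (2 * p) * u₁ + β * (|u₁| ^ (p - 1) * u₁) * |u₂| ^ (p + 1))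

/-- The second partial derivative of `F` in its first argument. -/
def hessFdiag (p β u₁ u₂ : ℝ) : ℝ :=
  2 * ((2 * p + 1) * |u₁| ^ (2 * p) + p * β * |u₁| ^ (p - 1) * |u₂| ^ (p + 1))

/-- The mixed second partial derivative of `F`. -/
def hessFmixed (p β u₁ u₂ : ℝ) : ℝ :=
  2 * ((p + 1) * β * (|u₁| ^ (p - 1) * u₁) * (|u₂| ^ (p - 1) * u₂))

section
variable {p β : ℝ}

lemma F_eq (p β u₁ u₂ : ℝ) : F p β u₁ u₂ = 1 / (p + 1) *
    (|u₁| ^ (2 * p + 2) + |u₂| ^ (2 * p + 2) + 2 * β * (|u₁| ^ (p + 1) * |u₂| ^ (p + 1))) := by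
  rw [F, abs_mul, Real.mul_rpow (abs_nonneg _) (abs_nonneg _)]

lemma F_nonneg (hp : 1 ≤ p) (hβ : 0 < β) (u₁ u₂ : ℝ) : 0 ≤ F p β u₁ u₂ := by
  unfold F; positivity

lemma F_zero (hp : 1 ≤ p) : F p β 0 0 = 0 := by
  rw [F_eq, abs_zero, Real.zero_rpow (by linarith), Real.zero_rpow (by linarith)]; ring

lemma continuous_F (hp : 1 ≤ p) : Continuous fun u : ℝ × ℝ => F p β u.1 u.2 := by
  unfold F
  have h1 : Continuous fun u : ℝ × ℝ => |u.1| ^ (2 * p + 2) :=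
    continuous_fst.abs.rpow_const fun _ => Or.inr (by linarith)
  have h2 : Continuous fun u : ℝ × ℝ => |u.2| ^ (2 * p + 2) :=
    continuous_snd.abs.rpow_const fun _ => Or.inr (by linarith)
  have h3 : Continuous fun u : ℝ × ℝ => |u.1 * u.2| ^ (p + 1) :=
    (continuous_fst.mul continuous_snd).abs.rpow_const fun _ => Or.inr (by linarith)
  exact continuous_const.mul ((h1.add h2).add (continuous_const.mul h3))

lemma F_smul (p β t u₁ u₂ : ℝ) :
    F p β (t * u₁) (t * u₂) = |t| ^ (2 * p + 2) * F p β u₁ u₂ := by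
  rw [F_eq, F_eq, abs_mul, abs_mul]
  simp only [Real.mul_rpow (abs_nonneg _) (abs_nonneg _)]
  have : |t| ^ (2 * p + 2) = |t| ^ (p + 1) * |t| ^ (p + 1) := by
    rw [← Real.mul_rpow (abs_nonneg _) (abs_nonneg _), ← sq, ← Real.rpow_natCast,
      ← Real.rpow_mul (abs_nonneg _)]
    congr 1; push_cast; ring
  rw [this]; ring

lemma continuous_gradF (hp : 1 ≤ p) : Continuous fun u : ℝ × ℝ => gradF p β u.1 u.2 := by
  unfold gradF
  have h1 : Continuous fun u : ℝ × ℝ => |u.1| ^ (2 * p) :=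
    continuous_fst.abs.rpow_const fun _ => Or.inr (by linarith)
  have h2 : Continuous fun u : ℝ × ℝ => |u.1| ^ (p - 1) :=
    continuous_fst.abs.rpow_const fun _ => Or.inr (by linarith)
  have h3 : Continuous fun u : ℝ × ℝ => |u.2| ^ (p + 1) :=
    continuous_snd.abs.rpow_const fun _ => Or.inr (by linarith)
  exact continuous_const.mul ((h1.mul continuous_fst).add
    ((continuous_const.mul (h2.mul continuous_fst)).mul h3))

lemma continuous_hessFdiag (hp : 1 ≤ p) : Continuous fun u : ℝ × ℝ => hessFdiag p β u.1 u.2 := by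
  unfold hessFdiag
  have h1 : Continuous fun u : ℝ × ℝ => |u.1| ^ (2 * p) :=
    continuous_fst.abs.rpow_const fun _ => Or.inr (by linarith)
  have h2 : Continuous fun u : ℝ × ℝ => |u.1| ^ (p - 1) :=
    continuous_fst.abs.rpow_const fun _ => Or.inr (by linarith)
  have h3 : Continuous fun u : ℝ × ℝ => |u.2| ^ (p + 1) :=
    continuous_snd.abs.rpow_const fun _ => Or.inr (by linarith)
  exact continuous_const.mul ((continuous_const.mul h1).add ((continuous_const.mul h2).mul h3))

lemma continuous_hessFmixed (hp : 1 ≤ p) :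
    Continuous fun u : ℝ × ℝ => hessFmixed p β u.1 u.2 := by
  unfold hessFmixed
  have h2 : Continuous fun u : ℝ × ℝ => |u.1| ^ (p - 1) :=
    continuous_fst.abs.rpow_const fun _ => Or.inr (by linarith)
  have h3 : Continuous fun u : ℝ × ℝ => |u.2| ^ (p - 1) :=
    continuous_snd.abs.rpow_const fun _ => Or.inr (by linarith)
  exact continuous_const.mul ((continuous_const.mul (h2.mul continuous_fst)).mul
    (h3.mul continuous_snd))

lemma hasDerivAt_abs_rpow_add_one (hp : 1 ≤ p) (x : ℝ) :
    HasDerivAt (fun y : ℝ => |y| ^ (p + 1)) ((p + 1) * (|x| ^ (p - 1) * x)) x := by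
  refine (hasDerivAt_abs_rpow x (by linarith : 1 < p + 1)).congr_deriv ?_
  rw [show p + 1 - 2 = p - 1 by ring]; ring

lemma hasDerivAt_F (hp : 1 ≤ p) {a b : ℝ → ℝ} {a' b' t : ℝ} (ha : HasDerivAt a a' t)
    (hb : HasDerivAt b b' t) : HasDerivAt (fun s => F p β (a s) (b s))
      (gradF p β (a t) (b t) * a' + gradF p β (b t) (a t) * b') t := by
  have hp0 : p + 1 ≠ 0 := by linarith
  have e : (fun s => F p β (a s) (b s)) = fun s => 1 / (p + 1) *
      (|a s| ^ (2 * p + 2) + |b s| ^ (2 * p + 2) + 2 * β * (|a s| ^ (p + 1) * |b s| ^ (p + 1))) := by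
    funext s; exact F_eq _ _ _ _
  rw [e]
  have h1 := (hasDerivAt_abs_rpow (a t) (by linarith : 1 < 2 * p + 2)).comp t ha
  have h2 := (hasDerivAt_abs_rpow (b t) (by linarith : 1 < 2 * p + 2)).comp t hb
  have h3 := (hasDerivAt_abs_rpow_add_one hp (a t)).comp t ha
  have h4 := (hasDerivAt_abs_rpow_add_one hp (b t)).comp t hb
  refine (((h1.add h2).add ((h3.mul h4).const_mul (2 * β))).const_mul (1 / (p + 1))).congr_deriv ?_
  simp only [gradF, Function.comp, show 2 * p + 2 - 2 = 2 * p by ring]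
  field_simp
  ring

lemma hasDerivAt_gradF (hp : 1 ≤ p) {a b : ℝ → ℝ} {a' b' t : ℝ} (ha : HasDerivAt a a' t)
    (hb : HasDerivAt b b' t) : HasDerivAt (fun s => gradF p β (a s) (b s))
      (hessFdiag p β (a t) (b t) * a' + hessFmixed p β (a t) (b t) * b') t := by
  have h1 := (hasDerivAt_abs_rpow_mul_self (by linarith : 0 ≤ 2 * p) (a t)).comp t ha
  have h2 := (hasDerivAt_abs_rpow_mul_self (by linarith : 0 ≤ p - 1) (a t)).comp t ha
  have h3 := (hasDerivAt_abs_rpow_add_one hp (b t)).comp t hb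
  refine ((h1.add ((h2.const_mul β).mul h3)).const_mul 2).congr_deriv ?_
  simp only [hessFdiag, hessFmixed, Function.comp]
  ring

lemma gradF_of_nonneg (hp : 1 ≤ p) {u₁ u₂ : ℝ} (h₁ : 0 ≤ u₁) (h₂ : 0 ≤ u₂) :
    gradF p β u₁ u₂ = 2 * (u₁ ^ (2 * p + 1) + β * u₁ ^ p * u₂ ^ (p + 1)) := by
  rw [gradF, abs_of_nonneg h₁, abs_of_nonneg h₂]
  have e1 : u₁ ^ (2 * p) * u₁ = u₁ ^ (2 * p + 1) := by
    rw [Real.rpow_add_one' h₁ (by linarith)]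
  have e2 : u₁ ^ (p - 1) * u₁ = u₁ ^ p := by
    have := Real.rpow_add_one' h₁ (y := p - 1) (by linarith)
    rw [← this]; congr 1; ring
  rw [e1, e2]

lemma hessFdiag_of_nonneg {u₁ u₂ : ℝ} (h₁ : 0 ≤ u₁) (h₂ : 0 ≤ u₂) :
    hessFdiag p β u₁ u₂ = 2 * hess11 p β u₁ u₂ := by
  rw [hessFdiag, hess11, abs_of_nonneg h₁, abs_of_nonneg h₂]

lemma hess22_eq (p β u₁ u₂ : ℝ) : hess22 p β u₁ u₂ = hess11 p β u₂ u₁ := rfl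

lemma hess12_comm (p β u₁ u₂ : ℝ) : hess12 p β u₁ u₂ = hess12 p β u₂ u₁ := by
  unfold hess12; ring

lemma hessFmixed_of_nonneg (hp : 1 ≤ p) {u₁ u₂ : ℝ} (h₁ : 0 ≤ u₁) (h₂ : 0 ≤ u₂) :
    hessFmixed p β u₁ u₂ = 2 * hess12 p β u₁ u₂ := by
  rw [hessFmixed, hess12, abs_of_nonneg h₁, abs_of_nonneg h₂]
  have e (u : ℝ) (h : 0 ≤ u) : u ^ (p - 1) * u = u ^ p := by
    have := Real.rpow_add_one' h (y := p - 1) (by linarith)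
    rw [← this]; congr 1; ring
  rw [e _ h₁, e _ h₂]

/-- Euler's identity for the homogeneous function `F`. -/
lemma gradF_mul_add (hp : 1 ≤ p) (u₁ u₂ : ℝ) :
    gradF p β u₁ u₂ * u₁ + gradF p β u₂ u₁ * u₂ = (2 * p + 2) * F p β u₁ u₂ := by
  have hp0 : p + 1 ≠ 0 := by linarith
  have e1 (u : ℝ) : |u| ^ (2 * p) * u * u = |u| ^ (2 * p + 2) := by
    rw [mul_assoc, ← sq, ← sq_abs, ← Real.rpow_natCast |u| 2,
      ← Real.rpow_add_of_nonneg (abs_nonneg _) (by linarith) (by norm_num)]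
    norm_num
  have e2 (u : ℝ) : |u| ^ (p - 1) * u * u = |u| ^ (p + 1) := by
    rw [mul_assoc, ← sq, ← sq_abs, ← Real.rpow_natCast |u| 2,
      ← Real.rpow_add_of_nonneg (abs_nonneg _) (by linarith) (by norm_num)]
    congr 1; push_cast; ring
  rw [F_eq, gradF, gradF]
  have : (2 * p + 2) * (1 / (p + 1) *
    (|u₁| ^ (2 * p + 2) + |u₂| ^ (2 * p + 2) + 2 * β * (|u₁| ^ (p + 1) * |u₂| ^ (p + 1))))
    = 2 * (|u₁| ^ (2 * p + 2) + |u₂| ^ (2 * p + 2) + 2 * β * (|u₁| ^ (p + 1) * |u₂| ^ (p + 1))) := by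
    field_simp
  rw [this, ← e1 u₁, ← e1 u₂, ]
  linear_combination 2 * β * |u₂| ^ (p + 1) * e2 u₁ + 2 * β * |u₁| ^ (p + 1) * e2 u₂

/-- The maximum of `F` on the unit circle, attained in the first quadrant. By homogeneity it is the
best constant in `F(u) ≤ M |u|^(2p+2)`, and at the maximum point `e` the gradient of `F` is radial. -/
lemma exists_max_direction (hp : 1 ≤ p) : ∃ M a b : ℝ, 0 < M ∧ 0 ≤ a ∧ 0 ≤ b ∧
    a ^ 2 + b ^ 2 = 1 ∧ F p β a b = M ∧ (∀ u₁ u₂, F p β u₁ u₂ ≤ M * (u₁ ^ 2 + u₂ ^ 2) ^ (p + 1)) ∧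
    gradF p β a b = (2 * p + 2) * M * a ∧ gradF p β b a = (2 * p + 2) * M * b := by
  set S : Set (ℝ × ℝ) := {u | u.1 ^ 2 + u.2 ^ 2 = 1} with hS
  have hSc : IsCompact S := by
    refine Metric.isCompact_of_isClosed_isBounded (isClosed_eq (by fun_prop) continuous_const) ?_
    refine (Metric.isBounded_closedBall (x := (0 : ℝ × ℝ)) (r := 1)).subset ?_
    intro u hu
    have hu : u.1 ^ 2 + u.2 ^ 2 = 1 := hu
    rw [mem_closedBall_zero_iff, Prod.norm_def, max_le_iff]
    constructor
    · rw [Real.norm_eq_abs, ← sq_le_one_iff_abs_le_one]; nlinarith [sq_nonneg u.2]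
    · rw [Real.norm_eq_abs, ← sq_le_one_iff_abs_le_one]; nlinarith [sq_nonneg u.1]
  obtain ⟨e, he, hmax⟩ := hSc.exists_isMaxOn ⟨(1, 0), by simp [hS]⟩
    (continuous_F (p := p) (β := β) hp).continuousOn
  have he : e.1 ^ 2 + e.2 ^ 2 = 1 := he
  set a := |e.1| with ha
  set b := |e.2| with hb
  have hab : a ^ 2 + b ^ 2 = 1 := by rw [ha, hb, sq_abs, sq_abs, he]
  have hFe : F p β e.1 e.2 = F p β a b := by
    rw [F_eq, F_eq, ha, hb, abs_abs, abs_abs]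
  set M := F p β a b with hM
  have hle1 : ∀ u₁ u₂ : ℝ, u₁ ^ 2 + u₂ ^ 2 = 1 → F p β u₁ u₂ ≤ M := by
    intro u₁ u₂ hu
    rw [← hFe]
    exact hmax (show ((u₁, u₂) : ℝ × ℝ) ∈ S from hu)
  have hMpos : 0 < M := by
    refine lt_of_lt_of_le ?_ (hle1 1 0 (by norm_num))
    rw [F_eq, abs_one, Real.one_rpow, abs_zero, Real.zero_rpow (by linarith),
      Real.zero_rpow (by linarith)]
    simp; linarith
  have hle : ∀ u₁ u₂, F p β u₁ u₂ ≤ M * (u₁ ^ 2 + u₂ ^ 2) ^ (p + 1) := by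
    intro u₁ u₂
    set ρ := √(u₁ ^ 2 + u₂ ^ 2) with hρ
    have hρ2 : ρ ^ 2 = u₁ ^ 2 + u₂ ^ 2 := Real.sq_sqrt (by positivity)
    have hρ0 : 0 ≤ ρ := Real.sqrt_nonneg _
    rcases hρ0.eq_or_lt with h0 | h0
    · rw [← h0] at hρ2
      have h1 : u₁ = 0 := by nlinarith [sq_nonneg u₁, sq_nonneg u₂]
      have h2 : u₂ = 0 := by nlinarith [sq_nonneg u₁, sq_nonneg u₂]
      rw [h1, h2, F_zero hp]; positivity
    · have h1 := hle1 (u₁ / ρ) (u₂ / ρ) (by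
        rw [div_pow, div_pow, ← add_div, ← hρ2, div_self (by positivity)])
      have h2 := F_smul p β ρ (u₁ / ρ) (u₂ / ρ)
      rw [mul_div_cancel₀ _ h0.ne', mul_div_cancel₀ _ h0.ne', abs_of_pos h0] at h2
      have h3 : (u₁ ^ 2 + u₂ ^ 2) ^ (p + 1) = ρ ^ (2 * p + 2) := by
        rw [← hρ2, ← Real.rpow_natCast, ← Real.rpow_mul hρ0]; congr 1; push_cast; ring
      rw [h2, h3, mul_comm]
      exact mul_le_mul_of_nonneg_right h1 (by positivity)
  -- the derivative of `M |e + t e^⊥|^(2p+2) - F(e + t e^⊥) ≥ 0` vanishes at its minimum `t = 0`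
  have htan : -b * gradF p β a b + a * gradF p β b a = 0 := by
    have hd1 : HasDerivAt (fun t : ℝ => a + t * -b) (-b) 0 := by
      simpa using ((hasDerivAt_id (0 : ℝ)).mul_const (-b)).const_add a
    have hd2 : HasDerivAt (fun t : ℝ => b + t * a) a 0 := by
      simpa using ((hasDerivAt_id (0 : ℝ)).mul_const a).const_add b
    have h1 := hasDerivAt_F (β := β) hp hd1 hd2
    have h2 : HasDerivAt (fun t : ℝ => M * (1 + t ^ 2) ^ (p + 1)) 0 0 := by
      have := ((((hasDerivAt_id (0 : ℝ)).pow 2).const_add 1).rpow_const (p := p + 1)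
        (Or.inl (by simp))).const_mul M
      simpa using this
    have hmin : IsLocalMin (fun t : ℝ => M * (1 + t ^ 2) ^ (p + 1)
        - F p β (a + t * -b) (b + t * a)) 0 := by
      refine Eventually.of_forall fun t => ?_
      have h3 := hle (a + t * -b) (b + t * a)
      have h4 : (a + t * -b) ^ 2 + (b + t * a) ^ 2 = 1 + t ^ 2 := by
        linear_combination (1 + t ^ 2) * hab
      rw [h4] at h3
      simp only [zero_mul, add_zero, ne_eq, OfNat.ofNat_ne_zero, not_false_eq_true, zero_pow,
        Real.one_rpow, mul_one, ← hM]
      linarith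
    have h5 := hmin.hasDerivAt_eq_zero (h2.sub h1)
    simp only [zero_mul, add_zero] at h5
    linarith
  have heul := gradF_mul_add (β := β) hp a b
  rw [← hM] at heul
  refine ⟨M, a, b, hMpos, abs_nonneg _, abs_nonneg _, hab, rfl, hle, ?_, ?_⟩
  · linear_combination (-gradF p β a b) * hab - b * htan + a * heul
  · linear_combination (-gradF p β b a) * hab + a * htan + b * heul

end

/-! ### The Bogomolny bound -/

lemma rep_toH1 {v : ℝ → ℝ} (h : IsC1H1 v) : rep h.toH1 = v :=
  (continuous_rep _).ae_eq_iff_eq volume h.continuous |>.1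
    ((fn_ae_eq_rep _).symm.trans h.fn_toH1_ae)

lemma abs_rep_le (u : H1) (x : ℝ) : |rep u x| ≤ ‖fn u‖ + ‖der u‖ := by
  obtain ⟨a, b, ha, hb, h⟩ := exists_rep_eq_inner x
  rw [h u]
  refine (abs_add_le _ _).trans (add_le_add ?_ ?_)
  · exact (abs_real_inner_le_norm _ _).trans (mul_le_of_le_one_right (norm_nonneg _) ha)
  · exact (abs_real_inner_le_norm _ _).trans (mul_le_of_le_one_right (norm_nonneg _) hb)

lemma IsC1H1.exists_bound {v : ℝ → ℝ} (h : IsC1H1 v) : ∃ C, ∀ x, |v x| ≤ C :=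
  ⟨_, fun x => by simpa only [rep_toH1 h] using abs_rep_le h.toH1 x⟩

/-- A continuous function of two bounded functions is bounded. -/
lemma exists_bound_comp {Φ : ℝ × ℝ → ℝ} (hΦ : Continuous Φ) (C : ℝ) :
    ∃ K, 0 ≤ K ∧ ∀ a b : ℝ, |a| ≤ C → |b| ≤ C → |Φ (a, b)| ≤ K := by
  obtain ⟨K, hK⟩ := (isCompact_Icc (a := ((-C, -C) : ℝ × ℝ)) (b := (C, C))).exists_bound_of_continuousOn
    hΦ.continuousOn
  refine ⟨|K|, abs_nonneg _, fun a b ha hb => (hK (a, b) ?_).trans (le_abs_self K)⟩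
  exact ⟨⟨(abs_le.1 ha).1, (abs_le.1 hb).1⟩, ⟨(abs_le.1 ha).2, (abs_le.1 hb).2⟩⟩

/-- `‖∂ₓV‖₂²`. -/
def kin (v₁ v₂ : ℝ → ℝ) : ℝ := ∫ x, (deriv v₁ x ^ 2 + deriv v₂ x ^ 2)

/-- `‖V‖₂²`. -/
def mass (v₁ v₂ : ℝ → ℝ) : ℝ := ∫ x, (v₁ x ^ 2 + v₂ x ^ 2)

/-- `∫ F(V)`. -/
def pot (p β : ℝ) (v₁ v₂ : ℝ → ℝ) : ℝ := ∫ x, F p β (v₁ x) (v₂ x)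

lemma action_eq (p β : ℝ) (v₁ v₂ : ℝ → ℝ) :
    action p β v₁ v₂ = 1 / 2 * kin v₁ v₂ - pot p β v₁ v₂ + mass v₁ v₂ := rfl

section
variable {p β : ℝ} {v₁ v₂ : ℝ → ℝ}

lemma integrable_kin (h₁ : IsC1H1 v₁) (h₂ : IsC1H1 v₂) :
    Integrable fun x => deriv v₁ x ^ 2 + deriv v₂ x ^ 2 :=
  h₁.memLp_deriv.integrable_sq.add h₂.memLp_deriv.integrable_sq

lemma integrable_mass (h₁ : IsC1H1 v₁) (h₂ : IsC1H1 v₂) :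
    Integrable fun x => v₁ x ^ 2 + v₂ x ^ 2 :=
  h₁.memLp.integrable_sq.add h₂.memLp.integrable_sq

lemma integrable_pot (hp : 1 ≤ p) (hβ : 0 < β) (h₁ : IsC1H1 v₁) (h₂ : IsC1H1 v₂) :
    Integrable fun x => F p β (v₁ x) (v₂ x) := by
  obtain ⟨M, a, b, hM, -, -, -, -, hle, -, -⟩ := exists_max_direction (β := β) hp
  obtain ⟨C₁, hC₁⟩ := h₁.exists_bound
  obtain ⟨C₂, hC₂⟩ := h₂.exists_bound
  have hC (x : ℝ) : v₁ x ^ 2 + v₂ x ^ 2 ≤ C₁ ^ 2 + C₂ ^ 2 :=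
    add_le_add (sq_le_sq' (abs_le.1 (hC₁ x)).1 (abs_le.1 (hC₁ x)).2)
      (sq_le_sq' (abs_le.1 (hC₂ x)).1 (abs_le.1 (hC₂ x)).2)
  refine ((integrable_mass h₁ h₂).const_mul (M * (C₁ ^ 2 + C₂ ^ 2) ^ p)).mono'
    ((continuous_F hp).comp (h₁.continuous.prodMk h₂.continuous)).aestronglyMeasurable
    (Eventually.of_forall fun x => ?_)
  rw [Real.norm_eq_abs, abs_of_nonneg (F_nonneg hp hβ _ _)]
  refine (hle _ _).trans ?_
  rw [Real.rpow_add_one' (by positivity) (by linarith), ← mul_assoc]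
  refine mul_le_mul_of_nonneg_right (mul_le_mul_of_nonneg_left ?_ hM.le) (by positivity)
  exact Real.rpow_le_rpow (by positivity) (hC x) (by linarith)

/-- `√(2 W(s)) / s` as a function of `t = s²`, where `W(s) = s² - M s^(2p+2)`; the square root is `0`
where `W` is negative, a range which is never used. -/
def weight (M p t : ℝ) : ℝ := √(2 * (1 - M * |t| ^ p))

/-- With `σ = s²` this is the primitive of `√(2 W(s))`, `W(s) = s² - M s^(2p+2)`, vanishing
at `0`. -/
def profile (M p σ : ℝ) : ℝ := ∫ t in (0 : ℝ)..σ, weight M p t / 2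

lemma continuous_weight (hp : 1 ≤ p) (M : ℝ) : Continuous (weight M p) := by
  have : Continuous fun t : ℝ => |t| ^ p := continuous_abs.rpow_const fun _ => Or.inr (by linarith)
  unfold weight
  fun_prop

lemma hasDerivAt_profile (hp : 1 ≤ p) (M σ : ℝ) :
    HasDerivAt (profile M p) (weight M p σ / 2) σ := by
  have h := (continuous_weight hp M).div_const 2
  exact intervalIntegral.integral_hasDerivAt_right (h.intervalIntegrable _ _)
    (h.stronglyMeasurableAtFilter _ _) h.continuousAt

lemma profile_zero (M p : ℝ) : profile M p 0 = 0 := by simp [profile]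

lemma tendsto_mass_density (h₁ : IsC1H1 v₁) (h₂ : IsC1H1 v₂) :
    Tendsto (fun x => v₁ x ^ 2 + v₂ x ^ 2) atTop (𝓝 0) ∧
      Tendsto (fun x => v₁ x ^ 2 + v₂ x ^ 2) atBot (𝓝 0) := by
  have hd (x : ℝ) : HasDerivAt (fun x => v₁ x ^ 2 + v₂ x ^ 2)
      (2 * (v₁ x * deriv v₁ x) + 2 * (v₂ x * deriv v₂ x)) x := by
    refine (((h₁.hasDerivAt x).pow 2).add ((h₂.hasDerivAt x).pow 2)).congr_deriv ?_
    push_cast; ring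
  have hi : Integrable fun x => 2 * (v₁ x * deriv v₁ x) + 2 * (v₂ x * deriv v₂ x) :=
    ((h₁.memLp.integrable_mul h₁.memLp_deriv).const_mul 2).add
      ((h₂.memLp.integrable_mul h₂.memLp_deriv).const_mul 2)
  have hi' := integrable_mass h₁ h₂
  exact ⟨tendsto_zero_of_hasDerivAt_of_integrableOn_Ioi (a := 0) (fun x _ => hd x)
    hi.integrableOn hi'.integrableOn, tendsto_zero_of_hasDerivAt_of_integrableOn_Iic (a := 0)
    (fun x _ => hd x) hi.integrableOn hi'.integrableOn⟩

/-- The fundamental theorem of calculus for `profile (|V|²)` on both sides of a point. -/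
lemma integral_weight_mul (hp : 1 ≤ p) {M : ℝ} (h₁ : IsC1H1 v₁) (h₂ : IsC1H1 v₂) (x₀ : ℝ) :
    let d := fun x => weight M p (v₁ x ^ 2 + v₂ x ^ 2) * (v₁ x * deriv v₁ x + v₂ x * deriv v₂ x)
    Integrable d ∧ ∫ x in Set.Iic x₀, d x = profile M p (v₁ x₀ ^ 2 + v₂ x₀ ^ 2) ∧
      ∫ x in Set.Ioi x₀, d x = - profile M p (v₁ x₀ ^ 2 + v₂ x₀ ^ 2) := by
  intro d
  set σ : ℝ → ℝ := fun x => v₁ x ^ 2 + v₂ x ^ 2 with hσ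
  have hσc : Continuous σ := (h₁.continuous.pow 2).add (h₂.continuous.pow 2)
  obtain ⟨t₁, t₂⟩ := tendsto_mass_density h₁ h₂
  have hd (x : ℝ) : HasDerivAt (fun x => profile M p (σ x)) (d x) x := by
    have h3 : HasDerivAt σ (2 * (v₁ x * deriv v₁ x) + 2 * (v₂ x * deriv v₂ x)) x := by
      refine (((h₁.hasDerivAt x).pow 2).add ((h₂.hasDerivAt x).pow 2)).congr_deriv ?_
      push_cast; ring
    refine ((hasDerivAt_profile hp M (σ x)).comp x h3).congr_deriv ?_
    simp only [d, hσ]; ring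
  have hi : Integrable fun x => v₁ x * deriv v₁ x + v₂ x * deriv v₂ x :=
    (h₁.memLp.integrable_mul h₁.memLp_deriv).add (h₂.memLp.integrable_mul h₂.memLp_deriv)
  have hwc : Continuous fun x => weight M p (σ x) := (continuous_weight hp M).comp hσc
  obtain ⟨C₁, hC₁⟩ := h₁.exists_bound
  obtain ⟨C₂, hC₂⟩ := h₂.exists_bound
  have hwb : ∀ᵐ x, ‖weight M p (σ x)‖ ≤ √(2 * (1 + |M| * (C₁ ^ 2 + C₂ ^ 2) ^ p)) := by
    refine Eventually.of_forall fun x => ?_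
    have hC : σ x ≤ C₁ ^ 2 + C₂ ^ 2 :=
      add_le_add (sq_le_sq' (abs_le.1 (hC₁ x)).1 (abs_le.1 (hC₁ x)).2)
        (sq_le_sq' (abs_le.1 (hC₂ x)).1 (abs_le.1 (hC₂ x)).2)
    have hσ0 : 0 ≤ σ x := by simp only [hσ]; positivity
    rw [Real.norm_eq_abs, weight, abs_of_nonneg (Real.sqrt_nonneg _)]
    refine Real.sqrt_le_sqrt ?_
    have h5 : |σ x| ^ p ≤ (C₁ ^ 2 + C₂ ^ 2) ^ p := by
      rw [abs_of_nonneg hσ0]; gcongr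
    have h6 : -(M * |σ x| ^ p) ≤ |M| * (C₁ ^ 2 + C₂ ^ 2) ^ p := by
      calc -(M * |σ x| ^ p) = (-M) * |σ x| ^ p := by ring
        _ ≤ |M| * |σ x| ^ p := by gcongr; exact neg_le_abs M
        _ ≤ _ := by gcongr
    linarith
  have hdi : Integrable d := hi.bdd_mul hwc.aestronglyMeasurable hwb
  have hprof : Continuous (profile M p) :=
    continuous_iff_continuousAt.2 fun s => (hasDerivAt_profile hp M s).continuousAt
  have hlim := hprof.tendsto 0
  rw [profile_zero] at hlim
  refine ⟨hdi, ?_, ?_⟩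
  · rw [integral_Iic_of_hasDerivAt_of_tendsto' (fun x _ => hd x) hdi.integrableOn
      (hlim.comp t₂), sub_zero]
  · rw [integral_Ioi_of_hasDerivAt_of_tendsto' (fun x _ => hd x) hdi.integrableOn
      (hlim.comp t₁), zero_sub]

/-- The Bogomolny-type lower bound: as long as `M |V|^(2p) ≤ 1`, the weighted action of `V` is at
least twice the value of the profile at the maximum of `|V|²`. -/
lemma two_mul_profile_le (hp : 1 ≤ p) (hβ : 0 < β) {M : ℝ}
    (hF : ∀ u₁ u₂, F p β u₁ u₂ ≤ M * (u₁ ^ 2 + u₂ ^ 2) ^ (p + 1)) (h₁ : IsC1H1 v₁)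
    (h₂ : IsC1H1 v₂) (hle : ∀ x, M * (v₁ x ^ 2 + v₂ x ^ 2) ^ p ≤ 1) {l : ℝ} (hl : 0 < l) (x₀ : ℝ) :
    2 * profile M p (v₁ x₀ ^ 2 + v₂ x₀ ^ 2)
      ≤ 1 / 2 * l * kin v₁ v₂ + (mass v₁ v₂ - pot p β v₁ v₂) / l := by
  obtain ⟨hdi, e1, e2⟩ := integral_weight_mul (M := M) hp h₁ h₂ x₀
  set d := fun x => weight M p (v₁ x ^ 2 + v₂ x ^ 2) * (v₁ x * deriv v₁ x + v₂ x * deriv v₂ x)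
    with hd
  set e : ℝ → ℝ := fun x => 1 / 2 * l * (deriv v₁ x ^ 2 + deriv v₂ x ^ 2)
    + ((v₁ x ^ 2 + v₂ x ^ 2) - F p β (v₁ x) (v₂ x)) / l with he
  have hi1 := (integrable_kin h₁ h₂).const_mul (1 / 2 * l)
  have hi2 := ((integrable_mass h₁ h₂).sub (integrable_pot hp hβ h₁ h₂)).div_const l
  have hei : Integrable e := hi1.add hi2
  have heq : ∫ x, e x = 1 / 2 * l * kin v₁ v₂ + (mass v₁ v₂ - pot p β v₁ v₂) / l := by
    have := integral_add hi1 hi2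
    rw [integral_const_mul, integral_div] at this
    rw [kin, mass, pot, ← integral_sub (integrable_mass h₁ h₂) (integrable_pot hp hβ h₁ h₂)]
    exact this
  have hde : ∀ x, |d x| ≤ e x := by
    intro x
    set σ := v₁ x ^ 2 + v₂ x ^ 2 with hσ
    set K := deriv v₁ x ^ 2 + deriv v₂ x ^ 2 with hK
    have hσ0 : 0 ≤ σ := by positivity
    have hK0 : 0 ≤ K := by positivity
    have h3 := hle x
    have h4 := hF (v₁ x) (v₂ x)
    rw [← hσ] at h3 h4
    rw [Real.rpow_add_one' hσ0 (by linarith)] at h4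
    have hcs : (v₁ x * deriv v₁ x + v₂ x * deriv v₂ x) ^ 2 ≤ σ * K := by
      rw [hσ, hK]; nlinarith [sq_nonneg (v₁ x * deriv v₂ x - v₂ x * deriv v₁ x)]
    have hw : weight M p σ ^ 2 = 2 * (1 - M * σ ^ p) := by
      rw [weight, abs_of_nonneg hσ0, Real.sq_sqrt (by linarith)]
    set y := (1 - M * σ ^ p) * σ / l with hy
    have hy0 : 0 ≤ y := div_nonneg (mul_nonneg (by linarith) hσ0) hl.le
    have hsq : d x ^ 2 ≤ (1 / 2 * l * K + y) ^ 2 := by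
      have h6 : d x ^ 2 = 2 * (1 - M * σ ^ p) * (v₁ x * deriv v₁ x + v₂ x * deriv v₂ x) ^ 2 := by
        simp only [hd]; rw [mul_pow, ← hσ, hw]
      have h7 : d x ^ 2 ≤ 2 * (1 - M * σ ^ p) * (σ * K) := by
        rw [h6]; exact mul_le_mul_of_nonneg_left hcs (by linarith)
      have h8 : 2 * (1 - M * σ ^ p) * (σ * K) = 4 * (1 / 2 * l * K) * y := by
        rw [hy]; field_simp; ring
      rw [h8] at h7
      nlinarith [sq_nonneg (1 / 2 * l * K - y)]
    have h9 : y ≤ (σ - F p β (v₁ x) (v₂ x)) / l := by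
      rw [hy]; gcongr; linarith
    calc |d x| ≤ 1 / 2 * l * K + y := abs_le_of_sq_le_sq hsq (by positivity)
      _ ≤ e x := by simp only [he]; linarith
  rw [← heq, ← setIntegral_univ, ← Set.Iic_union_Ioi (a := x₀),
    setIntegral_union (Set.Iic_disjoint_Ioi le_rfl) measurableSet_Ioi hei.integrableOn
      hei.integrableOn]
  have l1 : ∫ x in Set.Iic x₀, d x ≤ ∫ x in Set.Iic x₀, e x :=
    integral_mono hdi.integrableOn hei.integrableOn fun x => (le_abs_self _).trans (hde x)
  have l2 : ∫ x in Set.Ioi x₀, -d x ≤ ∫ x in Set.Ioi x₀, e x :=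
    integral_mono hdi.integrableOn.neg hei.integrableOn fun x => (neg_le_abs _).trans (hde x)
  rw [integral_neg] at l2
  linarith

end

/-! ### The solitary wave -/

section
variable {p β : ℝ}

lemma integrable_cosh_rpow {b c : ℝ} (hb : 0 < b) (hc : 0 < c) :
    Integrable fun x : ℝ => Real.cosh (b * x) ^ (-c) := by
  have h2 : Integrable fun x : ℝ => Real.exp (-(b * c) * |x|) := by
    rw [← integrableOn_univ, ← Set.Iic_union_Ioi (a := (0 : ℝ))]
    refine IntegrableOn.union ?_ ?_
    · refine (integrableOn_exp_mul_Iic (mul_pos hb hc) 0).congr_fun (fun x hx => ?_)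
        measurableSet_Iic
      simp only [abs_of_nonpos (show x ≤ 0 from hx), neg_mul_neg]
    · refine (exp_neg_integrableOn_Ioi 0 (mul_pos hb hc)).congr_fun (fun x hx => ?_)
        measurableSet_Ioi
      simp only [abs_of_pos (show 0 < x from hx)]
  refine (h2.const_mul (2 ^ c)).mono' ?_ (Eventually.of_forall fun x => ?_)
  · exact (Continuous.rpow_const (by fun_prop)
      fun x => Or.inl (Real.cosh_pos _).ne').aestronglyMeasurable
  · rw [Real.norm_eq_abs, abs_of_nonneg (by positivity)]
    have h3 : Real.exp (b * |x|) / 2 ≤ Real.cosh (b * x) := by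
      rw [← Real.cosh_abs, abs_mul, abs_of_pos hb, Real.cosh_eq]
      have := Real.exp_pos (-(b * |x|))
      linarith
    calc Real.cosh (b * x) ^ (-c) ≤ (Real.exp (b * |x|) / 2) ^ (-c) :=
          Real.rpow_le_rpow_of_nonpos (by positivity) h3 (by linarith)
      _ = 2 ^ c * Real.exp (-(b * c) * |x|) := by
          rw [Real.div_rpow (by positivity) (by norm_num), ← Real.exp_mul,
            Real.rpow_neg (by norm_num), div_inv_eq_mul, mul_comm]
          congr 2; ring

/-- The profile `Q = A cosh(√2 p x)^(-1/p)` of the solitary wave, together with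
`T = tanh(√2 p x)`; these relations say that `-½ Q'' + Q = (p+1) M Q^(2p+1)`. -/
lemma exists_soliton_profile (hp : 1 ≤ p) {M A : ℝ} (hA : 0 < A) (hMA : M * A ^ (2 * p) = 1) :
    ∃ Q T : ℝ → ℝ, ContDiff ℝ 2 Q ∧ MemLp Q 2 volume ∧ (∀ x, 0 < Q x) ∧ Q 0 = A ∧
      (∀ x, HasDerivAt Q (-√2 * T x * Q x) x) ∧
      (∀ x, HasDerivAt T (√2 * p * (1 - T x ^ 2)) x) ∧ (∀ x, M * Q x ^ (2 * p) = 1 - T x ^ 2) ∧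
      (∀ x, x ≤ 0 → T x ≤ 0) ∧ (∀ x, 0 ≤ x → 0 ≤ T x) := by
  have hp0 : 0 < p := by linarith
  set b := √2 * p with hb
  have hb0 : 0 < b := by positivity
  have hc (x : ℝ) : 0 < Real.cosh (b * x) := Real.cosh_pos _
  have hdc (x : ℝ) : HasDerivAt (fun x => Real.cosh (b * x)) (Real.sinh (b * x) * b) x := by
    simpa using ((hasDerivAt_id x).const_mul b).cosh
  have hds (x : ℝ) : HasDerivAt (fun x => Real.sinh (b * x)) (Real.cosh (b * x) * b) x := by
    simpa using ((hasDerivAt_id x).const_mul b).sinh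
  refine ⟨fun x => A * Real.cosh (b * x) ^ (-1 / p), fun x => Real.sinh (b * x) / Real.cosh (b * x),
    ?_, ?_, fun x => by have := hc x; positivity, by simp, fun x => ?_, fun x => ?_, fun x => ?_,
    fun x hx => ?_, fun x hx => ?_⟩
  · exact contDiff_const.mul (ContDiff.rpow_const_of_ne
      (Real.contDiff_cosh.comp (contDiff_const.mul contDiff_id)) fun x => (hc x).ne')
  · have hcont : Continuous fun x => A * Real.cosh (b * x) ^ (-1 / p) :=
      continuous_const.mul (Continuous.rpow_const (by fun_prop) fun x => Or.inl (hc x).ne')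
    rw [memLp_two_iff_integrable_sq hcont.aestronglyMeasurable]
    refine ((integrable_cosh_rpow hb0 (div_pos two_pos hp0)).const_mul (A ^ 2)).congr
      (Eventually.of_forall fun x => ?_)
    simp only
    rw [mul_pow, ← Real.rpow_natCast (Real.cosh (b * x) ^ (-1 / p)), ← Real.rpow_mul (hc x).le]
    congr 2; push_cast; ring
  · refine (((hdc x).rpow_const (p := -1 / p) (Or.inl (hc x).ne')).const_mul A).congr_deriv ?_
    rw [Real.rpow_sub_one (hc x).ne', hb]
    field_simp
  · refine ((hds x).div (hdc x) (hc x).ne').congr_deriv ?_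
    have := (hc x).ne'
    field_simp
  · have h1 : (A * Real.cosh (b * x) ^ (-1 / p)) ^ (2 * p)
        = A ^ (2 * p) * (Real.cosh (b * x) ^ 2)⁻¹ := by
      rw [Real.mul_rpow hA.le (by have := hc x; positivity), ← Real.rpow_mul (hc x).le,
        ← Real.rpow_natCast, ← Real.rpow_neg (hc x).le]
      congr 2
      push_cast; field_simp
    rw [h1, ← mul_assoc, hMA]
    have h2 := Real.cosh_sq (b * x)
    have := (hc x).ne'
    field_simp
    linarith
  · exact div_nonpos_of_nonpos_of_nonneg
      (Real.sinh_nonpos_iff.2 (mul_nonpos_of_nonneg_of_nonpos hb0.le hx)) (hc x).le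
  · exact div_nonneg (Real.sinh_nonneg_iff.2 (mul_nonneg hb0.le hx)) (hc x).le

lemma IsSolution.isC1H1₁ {r₁ r₂ : ℝ → ℝ} (h : IsSolution p β r₁ r₂) : IsC1H1 r₁ :=
  ⟨h.contDiff₁.of_le (by norm_num), h.memLp₁, h.memLp_deriv₁⟩

lemma IsSolution.isC1H1₂ {r₁ r₂ : ℝ → ℝ} (h : IsSolution p β r₁ r₂) : IsC1H1 r₂ :=
  ⟨h.contDiff₂.of_le (by norm_num), h.memLp₂, h.memLp_deriv₂⟩

lemma IsSolution.symm {r₁ r₂ : ℝ → ℝ} (h : IsSolution p β r₁ r₂) : IsSolution p β r₂ r₁ :=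
  ⟨h.2, h.1, h.4, h.3, h.6, h.5, h.8, h.7, h.10, h.9⟩

/-- A solution which attains the Bogomolny bound: the scalar solitary wave in a direction which
maximizes `F` on the unit circle. -/
lemma exists_solution_action_eq (hp : 1 ≤ p) (hβ : 0 < β) {M a b A : ℝ} (ha : 0 ≤ a) (hb : 0 ≤ b)
    (hab : a ^ 2 + b ^ 2 = 1) (hF : F p β a b = M)
    (hga : gradF p β a b = (2 * p + 2) * M * a) (hgb : gradF p β b a = (2 * p + 2) * M * b)
    (hA : 0 < A) (hMA : M * A ^ (2 * p) = 1) :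
    ∃ s₁ s₂ : ℝ → ℝ, IsSolution p β s₁ s₂ ∧ (s₁, s₂) ≠ (0, 0) ∧
      action p β s₁ s₂ = 2 * profile M p (A ^ 2) := by
  obtain ⟨Q, T, hQc, hQm, hQ0, hQA, hQd, hTd, hQT, hT1, hT2⟩ := exists_soliton_profile hp hA hMA
  have h2 : √2 * √2 = 2 := Real.mul_self_sqrt (by norm_num)
  have hM : 0 < M := by
    by_contra h
    have := mul_nonpos_of_nonpos_of_nonneg (not_lt.1 h) (Real.rpow_nonneg hA.le (2 * p))
    linarith
  have hT (x : ℝ) : T x ^ 2 ≤ 1 := by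
    have := hQT x
    have h3 : 0 ≤ M * Q x ^ (2 * p) := mul_nonneg hM.le (Real.rpow_nonneg (hQ0 x).le _)
    linarith
  have hTcont : Continuous T := continuous_iff_continuousAt.2 fun x => (hTd x).continuousAt
  have hQ'd (x : ℝ) : HasDerivAt (fun x => -√2 * T x * Q x)
      (2 * Q x - 2 * (p + 1) * (1 - T x ^ 2) * Q x) x := by
    refine (((hTd x).const_mul (-√2)).mul (hQd x)).congr_deriv ?_
    linear_combination (-p * (1 - T x ^ 2) * Q x + T x ^ 2 * Q x) * h2
  have hcm (c : ℝ) : deriv (fun x => c * Q x) = fun x => c * (-√2 * T x * Q x) :=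
    funext fun x => ((hQd x).const_mul c).deriv
  have hcm2 (c x : ℝ) : deriv (deriv (fun x => c * Q x)) x
      = c * (2 * Q x - 2 * (p + 1) * (1 - T x ^ 2) * Q x) := by
    rw [hcm]; exact ((hQ'd x).const_mul c).deriv
  have hQ'm : MemLp (fun x => -√2 * T x * Q x) 2 volume := by
    refine hQm.of_le_mul (c := √2) ((continuous_const.mul hTcont).mul
      hQc.continuous).aestronglyMeasurable (Eventually.of_forall fun x => ?_)
    rw [norm_mul, norm_mul, norm_neg, Real.norm_eq_abs √2, abs_of_nonneg (Real.sqrt_nonneg _)]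
    have : ‖T x‖ ≤ 1 := by rw [Real.norm_eq_abs, ← sq_le_one_iff_abs_le_one]; exact hT x
    have h3 := norm_nonneg (Q x)
    have h4 := Real.sqrt_nonneg 2
    calc √2 * ‖T x‖ * ‖Q x‖ ≤ √2 * 1 * ‖Q x‖ := by gcongr
      _ = _ := by ring
  have heq (c d : ℝ) (hc : 0 ≤ c) (hd : 0 ≤ d) (hg : gradF p β c d = (2 * p + 2) * M * c) (x : ℝ) :
      -(1 / 2) * deriv (deriv (fun x => c * Q x)) x + c * Q x
        = (c * Q x) ^ (2 * p + 1) + β * (c * Q x) ^ p * (d * Q x) ^ (p + 1) := by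
    have hq := (hQ0 x).le
    rw [hcm2, Real.mul_rpow hc hq, Real.mul_rpow hc hq, Real.mul_rpow hd hq]
    rw [gradF_of_nonneg hp hc hd] at hg
    have e1 : Q x ^ p * Q x ^ (p + 1) = Q x ^ (2 * p + 1) := by
      rw [← Real.rpow_add (hQ0 x)]; congr 1; ring
    have e2 : Q x ^ (2 * p + 1) = Q x ^ (2 * p) * Q x := Real.rpow_add_one (hQ0 x).ne' _
    have e3 := hQT x
    linear_combination (-(p + 1) * c * Q x) * e3 - β * c ^ p * d ^ (p + 1) * e1
      - (c ^ (2 * p + 1) + β * c ^ p * d ^ (p + 1)) * e2 - 1 / 2 * Q x ^ (2 * p) * Q x * hg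
  have hsol : IsSolution p β (fun x => a * Q x) (fun x => b * Q x) :=
    { contDiff₁ := contDiff_const.mul hQc
      contDiff₂ := contDiff_const.mul hQc
      nonneg₁ := fun x => mul_nonneg ha (hQ0 x).le
      nonneg₂ := fun x => mul_nonneg hb (hQ0 x).le
      memLp₁ := hQm.const_mul a
      memLp₂ := hQm.const_mul b
      memLp_deriv₁ := by rw [hcm]; exact hQ'm.const_mul a
      memLp_deriv₂ := by rw [hcm]; exact hQ'm.const_mul b
      eq₁ := heq a b ha hb hga
      eq₂ := heq b a hb ha hgb }
  refine ⟨_, _, hsol, ?_, ?_⟩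
  · intro h
    have h3 := congrFun (Prod.ext_iff.1 h).1 0
    have h4 := congrFun (Prod.ext_iff.1 h).2 0
    simp only [Pi.zero_apply, mul_eq_zero, (hQ0 0).ne', or_false] at h3 h4
    rw [h3, h4] at hab; norm_num at hab
  -- on each half-line the action density is, up to sign, the derivative of the profile
  obtain ⟨hdi, e1, e2⟩ := integral_weight_mul (M := M) hp hsol.isC1H1₁ hsol.isC1H1₂ 0
  have hσ (x : ℝ) : (a * Q x) ^ 2 + (b * Q x) ^ 2 = Q x ^ 2 := by
    linear_combination Q x ^ 2 * hab
  have hd (x : ℝ) : weight M p ((a * Q x) ^ 2 + (b * Q x) ^ 2) *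
      (a * Q x * deriv (fun x => a * Q x) x + b * Q x * deriv (fun x => b * Q x) x)
      = -2 * |T x| * T x * Q x ^ 2 := by
    have hw : weight M p (Q x ^ 2) = √2 * |T x| := by
      have : |Q x ^ 2| ^ p = Q x ^ (2 * p) := by
        rw [abs_of_nonneg (sq_nonneg _), ← Real.rpow_natCast, ← Real.rpow_mul (hQ0 x).le]
        norm_num
      rw [weight, this, hQT, sub_sub_cancel, Real.sqrt_mul (by norm_num), Real.sqrt_sq_eq_abs]
    rw [hσ, hw, hcm, hcm]
    linear_combination (-|T x| * T x * Q x ^ 2 * (a ^ 2 + b ^ 2)) * h2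
      - 2 * |T x| * T x * Q x ^ 2 * hab
  simp only [hd] at hdi e1 e2
  rw [hσ, hQA] at e1 e2
  have hi1 := integrable_kin hsol.isC1H1₁ hsol.isC1H1₂
  have hi2 := integrable_mass hsol.isC1H1₁ hsol.isC1H1₂
  have hi3 := integrable_pot hp hβ hsol.isC1H1₁ hsol.isC1H1₂
  have hact : action p β (fun x => a * Q x) (fun x => b * Q x) = ∫ x, 2 * T x ^ 2 * Q x ^ 2 := by
    have e4 := integral_add ((hi1.const_mul (1 / 2)).sub hi3) hi2
    have e5 := integral_sub (hi1.const_mul (1 / 2)) hi3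
    rw [action_eq, kin, mass, pot, ← integral_const_mul, ← e5]
    refine e4.symm.trans (integral_congr_ae (Eventually.of_forall fun x => ?_))
    simp only [Pi.sub_apply]
    simp only [hσ, hcm]
    have e3 : F p β (a * Q x) (b * Q x) = (1 - T x ^ 2) * Q x ^ 2 := by
      rw [mul_comm a, mul_comm b, F_smul, hF, abs_of_pos (hQ0 x), Real.rpow_add (hQ0 x), ← hQT]
      norm_cast; ring
    rw [e3]
    linear_combination (1 / 2 * T x ^ 2 * Q x ^ 2 * (a ^ 2 + b ^ 2)) * h2
      + T x ^ 2 * Q x ^ 2 * hab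
  have hint : Integrable fun x => 2 * T x ^ 2 * Q x ^ 2 := by
    refine hdi.norm.congr (Eventually.of_forall fun x => ?_)
    simp only [norm_mul, norm_neg, Real.norm_eq_abs, abs_abs, abs_pow, sq_abs, Nat.abs_ofNat]
    rw [← sq_abs (T x)]; ring
  rw [hact, ← setIntegral_univ, ← Set.Iic_union_Ioi (a := (0 : ℝ)),
    setIntegral_union (Set.Iic_disjoint_Ioi le_rfl) measurableSet_Ioi hint.integrableOn
      hint.integrableOn]
  have l1 : ∫ x in Set.Iic (0 : ℝ), 2 * T x ^ 2 * Q x ^ 2 = profile M p (A ^ 2) := by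
    rw [← e1]
    refine setIntegral_congr_fun measurableSet_Iic fun x hx => ?_
    simp only [abs_of_nonpos (hT1 x hx)]; ring
  have l2 : ∫ x in Set.Ioi (0 : ℝ), 2 * T x ^ 2 * Q x ^ 2 = profile M p (A ^ 2) := by
    rw [← neg_neg (profile M p (A ^ 2)), ← e2, ← integral_neg]
    refine setIntegral_congr_fun measurableSet_Ioi fun x hx => ?_
    have hx : 0 < x := hx
    simp only [abs_of_nonneg (hT2 x hx.le)]; ring
  rw [l1, l2]; ring

end

/-! ### The sharp Gagliardo-Nirenberg inequality -/

section
variable {p β : ℝ} {r₁ r₂ : ℝ → ℝ}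

lemma exists_gradF_bound (hp : 1 ≤ p) (C : ℝ) :
    ∃ K, 0 ≤ K ∧ ∀ a b : ℝ, |a| ≤ C → |b| ≤ C → |gradF p β a b| ≤ K * |a| := by
  have hΦ : Continuous fun u : ℝ × ℝ =>
      2 * (|u.1| ^ (2 * p) + β * |u.1| ^ (p - 1) * |u.2| ^ (p + 1)) := by
    have h1 : Continuous fun u : ℝ × ℝ => |u.1| ^ (2 * p) :=
      continuous_fst.abs.rpow_const fun _ => Or.inr (by linarith)
    have h2 : Continuous fun u : ℝ × ℝ => |u.1| ^ (p - 1) :=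
      continuous_fst.abs.rpow_const fun _ => Or.inr (by linarith)
    have h3 : Continuous fun u : ℝ × ℝ => |u.2| ^ (p + 1) :=
      continuous_snd.abs.rpow_const fun _ => Or.inr (by linarith)
    fun_prop
  obtain ⟨K, hK0, hK⟩ := exists_bound_comp hΦ C
  refine ⟨K, hK0, fun a b ha hb => ?_⟩
  have e : gradF p β a b = (2 * (|a| ^ (2 * p) + β * |a| ^ (p - 1) * |b| ^ (p + 1))) * a := by
    unfold gradF; ring
  rw [e, abs_mul]
  exact mul_le_mul_of_nonneg_right (hK a b ha hb) (abs_nonneg _)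

lemma IsSolution.deriv_deriv (h : IsSolution p β r₁ r₂) (hp : 1 ≤ p) (x : ℝ) :
    deriv (deriv r₁) x = 2 * r₁ x - gradF p β (r₁ x) (r₂ x) := by
  rw [gradF_of_nonneg hp (h.nonneg₁ x) (h.nonneg₂ x), ← h.eq₁ x]; ring

lemma IsSolution.isC1H1_deriv (h : IsSolution p β r₁ r₂) (hp : 1 ≤ p) : IsC1H1 (deriv r₁) := by
  refine ⟨contDiff_deriv h.contDiff₁, h.memLp_deriv₁, ?_⟩
  obtain ⟨C₁, hC₁⟩ := h.isC1H1₁.exists_bound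
  obtain ⟨C₂, hC₂⟩ := h.isC1H1₂.exists_bound
  obtain ⟨K, -, hK⟩ := exists_gradF_bound (β := β) hp (max C₁ C₂)
  refine h.memLp₁.of_le_mul (c := 2 + K)
    (contDiff_deriv h.contDiff₁).continuous_deriv_one.aestronglyMeasurable
    (Eventually.of_forall fun x => ?_)
  have h4 := hK (r₁ x) (r₂ x) ((hC₁ x).trans (le_max_left _ _)) ((hC₂ x).trans (le_max_right _ _))
  rw [h.deriv_deriv hp, Real.norm_eq_abs, Real.norm_eq_abs]
  refine (abs_sub _ _).trans ?_
  rw [abs_mul, abs_two]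
  linarith

/-- The Nehari identity, obtained by testing the system with the solution itself. -/
lemma IsSolution.nehari (h : IsSolution p β r₁ r₂) (hp : 1 ≤ p) (hβ : 0 < β) :
    1 / 2 * kin r₁ r₂ + mass r₁ r₂ = (p + 1) * pot p β r₁ r₂ := by
  have i1 := h.isC1H1₁.integral_mul_deriv (h.isC1H1_deriv hp)
  have i2 := h.isC1H1₂.integral_mul_deriv (h.symm.isC1H1_deriv hp)
  have j1 : Integrable fun x => r₁ x * deriv (deriv r₁) x :=
    h.memLp₁.integrable_mul (h.isC1H1_deriv hp).memLp_deriv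
  have j2 : Integrable fun x => r₂ x * deriv (deriv r₂) x :=
    h.memLp₂.integrable_mul (h.symm.isC1H1_deriv hp).memLp_deriv
  have e1 : ∫ x, (r₁ x * deriv (deriv r₁) x + r₂ x * deriv (deriv r₂) x) = - kin r₁ r₂ := by
    rw [integral_add j1 j2, i1, i2, kin,
      integral_add h.memLp_deriv₁.integrable_sq h.memLp_deriv₂.integrable_sq]
    simp only [pow_two]; ring
  have e2 : ∫ x, (r₁ x * deriv (deriv r₁) x + r₂ x * deriv (deriv r₂) x)
      = 2 * mass r₁ r₂ - (2 * p + 2) * pot p β r₁ r₂ := by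
    rw [mass, pot, ← integral_const_mul, ← integral_const_mul,
      ← integral_sub ((integrable_mass h.isC1H1₁ h.isC1H1₂).const_mul 2)
        ((integrable_pot hp hβ h.isC1H1₁ h.isC1H1₂).const_mul (2 * p + 2))]
    refine integral_congr_ae (Eventually.of_forall fun x => ?_)
    simp only [h.deriv_deriv hp, h.symm.deriv_deriv hp]
    linear_combination - gradF_mul_add (β := β) hp (r₁ x) (r₂ x)
  linarith

lemma kin_smul (t : ℝ) {v₁ v₂ : ℝ → ℝ} : kin (t • v₁) (t • v₂) = t ^ 2 * kin v₁ v₂ := by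
  rw [kin, kin, ← integral_const_mul]
  refine integral_congr_ae (Eventually.of_forall fun x => ?_)
  simp only [deriv_smul_fun, Pi.smul_apply, smul_eq_mul]; ring

lemma mass_smul (t : ℝ) {v₁ v₂ : ℝ → ℝ} : mass (t • v₁) (t • v₂) = t ^ 2 * mass v₁ v₂ := by
  rw [mass, mass, ← integral_const_mul]
  refine integral_congr_ae (Eventually.of_forall fun x => ?_)
  simp only [Pi.smul_apply, smul_eq_mul]; ring

lemma pot_smul (t : ℝ) {v₁ v₂ : ℝ → ℝ} :
    pot p β (t • v₁) (t • v₂) = |t| ^ (2 * p + 2) * pot p β v₁ v₂ := by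
  rw [pot, pot, ← integral_const_mul]
  refine integral_congr_ae (Eventually.of_forall fun x => ?_)
  simp only [Pi.smul_apply, smul_eq_mul, F_smul]

lemma kin_nonneg (v₁ v₂ : ℝ → ℝ) : 0 ≤ kin v₁ v₂ := integral_nonneg fun x => by positivity

lemma mass_nonneg (v₁ v₂ : ℝ → ℝ) : 0 ≤ mass v₁ v₂ := integral_nonneg fun x => by positivity

lemma mass_pos {v₁ v₂ : ℝ → ℝ} (h₁ : IsC1H1 v₁) (h₂ : IsC1H1 v₂) (h : (v₁, v₂) ≠ (0, 0)) :
    0 < mass v₁ v₂ := by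
  refine (mass_nonneg _ _).lt_of_ne fun h0 => h ?_
  have h1 := (integral_eq_zero_iff_of_nonneg (fun x => by positivity)
    (integrable_mass h₁ h₂)).1 h0.symm
  have h2 := (((h₁.continuous.pow 2).add (h₂.continuous.pow 2)).ae_eq_iff_eq volume
    continuous_const).1 h1
  have h3 (x : ℝ) : v₁ x ^ 2 + v₂ x ^ 2 = 0 := congrFun h2 x
  refine Prod.ext (funext fun x => ?_) (funext fun x => ?_)
  · have := h3 x; simp only [Pi.zero_apply]; nlinarith [sq_nonneg (v₁ x), sq_nonneg (v₂ x)]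
  · have := h3 x; simp only [Pi.zero_apply]; nlinarith [sq_nonneg (v₁ x), sq_nonneg (v₂ x)]

lemma exists_max_mass_density {v₁ v₂ : ℝ → ℝ} (h₁ : IsC1H1 v₁) (h₂ : IsC1H1 v₂)
    (h : (v₁, v₂) ≠ (0, 0)) : ∃ x₀, 0 < v₁ x₀ ^ 2 + v₂ x₀ ^ 2 ∧
      ∀ x, v₁ x ^ 2 + v₂ x ^ 2 ≤ v₁ x₀ ^ 2 + v₂ x₀ ^ 2 := by
  obtain ⟨y, hy⟩ : ∃ y, 0 < v₁ y ^ 2 + v₂ y ^ 2 := by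
    by_contra! hcon
    refine h (Prod.ext (funext fun x => ?_) (funext fun x => ?_))
    · have := hcon x; simp only [Pi.zero_apply]; nlinarith [sq_nonneg (v₁ x), sq_nonneg (v₂ x)]
    · have := hcon x; simp only [Pi.zero_apply]; nlinarith [sq_nonneg (v₁ x), sq_nonneg (v₂ x)]
  obtain ⟨t₁, t₂⟩ := tendsto_mass_density h₁ h₂
  have ht : Tendsto (fun x => v₁ x ^ 2 + v₂ x ^ 2) (cocompact ℝ) (𝓝 0) := by
    rw [cocompact_eq_atBot_atTop]; exact t₂.sup t₁
  obtain ⟨x₀, hx₀⟩ := ((h₁.continuous.pow 2).add (h₂.continuous.pow 2)).exists_forall_ge' y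
    ((ht.eventually (gt_mem_nhds hy)).mono fun x hx => hx.le)
  exact ⟨x₀, hy.trans_le (hx₀ y), hx₀⟩

/-- The sharp Gagliardo-Nirenberg inequality, written for all dilations at once (`l` is the
dilation parameter); equality holds at the ground state for `l = 1`. -/
theorem IsGroundState.sharp (hR : IsGroundState p β r₁ r₂) (hp : 1 ≤ p) (hβ : 0 < β)
    {v₁ v₂ : ℝ → ℝ} (h₁ : IsC1H1 v₁) (h₂ : IsC1H1 v₂) {l : ℝ} (hl : 0 < l) :
    (p + 1) * (1 / 2 * kin r₁ r₂ + mass r₁ r₂) ^ p * pot p β v₁ v₂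
      ≤ (1 / 2 * l * kin v₁ v₂ + mass v₁ v₂ / l) ^ (p + 1) * l := by
  have hp1 : p + 1 ≠ 0 := by linarith
  have hsol := hR.isSolution
  set D := 1 / 2 * kin r₁ r₂ + mass r₁ r₂ with hD
  have hDpos : 0 < D := by
    have := mass_pos hsol.isC1H1₁ hsol.isC1H1₂ hR.ne_zero
    have := kin_nonneg r₁ r₂
    linarith
  set k := 1 / 2 * l * kin v₁ v₂ + mass v₁ v₂ / l with hk
  have hk0 : 0 ≤ k := by
    have := mass_nonneg v₁ v₂
    have := kin_nonneg v₁ v₂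
    positivity
  by_cases hv : (v₁, v₂) = (0, 0)
  · have h1 : v₁ = 0 := (Prod.ext_iff.1 hv).1
    have h2 : v₂ = 0 := (Prod.ext_iff.1 hv).2
    have : pot p β v₁ v₂ = 0 := by rw [pot, h1, h2]; simp [F_zero hp]
    rw [this, mul_zero]; positivity
  obtain ⟨M, a, b, hM, ha, hb, hab, hF, hle, hga, hgb⟩ := exists_max_direction (β := β) hp
  set A := M ^ (-1 / (2 * p)) with hA
  have hA0 : 0 < A := Real.rpow_pos_of_pos hM _
  have hMA : M * A ^ (2 * p) = 1 := by
    rw [hA, ← Real.rpow_mul hM.le, div_mul_cancel₀ _ (by linarith), Real.rpow_neg_one,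
      mul_inv_cancel₀ hM.ne']
  obtain ⟨s₁, s₂, hs, hs0, hsact⟩ := exists_solution_action_eq hp hβ ha hb hab hF hga hgb hA0 hMA
  have hlow : D * (p / (p + 1)) ≤ 2 * profile M p (A ^ 2) := by
    have h3 := hR.least s₁ s₂ hs hs0
    rw [hsact, action_eq] at h3
    have h4 := hsol.nehari hp hβ
    rw [← hD] at h4
    have h5 : pot p β r₁ r₂ = D / (p + 1) := by rw [h4]; field_simp
    have h6 : D * (p / (p + 1)) = D - D / (p + 1) := by field_simp; ring
    rw [h6]; linarith
  -- scale `V` so that the maximum of `|V|²` is the positive zero `A²` of the potential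
  obtain ⟨x₀, hx₀, hmax⟩ := exists_max_mass_density h₁ h₂ hv
  set m := v₁ x₀ ^ 2 + v₂ x₀ ^ 2 with hm
  set t := A / √m with ht
  have ht0 : 0 < t := div_pos hA0 (Real.sqrt_pos.2 hx₀)
  have htm : t ^ 2 * m = A ^ 2 := by
    rw [ht, div_pow, Real.sq_sqrt hx₀.le]; field_simp
  have hsc (x : ℝ) : (t • v₁) x ^ 2 + (t • v₂) x ^ 2 = t ^ 2 * (v₁ x ^ 2 + v₂ x ^ 2) := by
    simp only [Pi.smul_apply, smul_eq_mul]; ring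
  have hbog := two_mul_profile_le hp hβ hle (h₁.const_smul t) (h₂.const_smul t) (fun x => by
    rw [hsc]
    calc M * (t ^ 2 * (v₁ x ^ 2 + v₂ x ^ 2)) ^ p ≤ M * (A ^ 2) ^ p := by
          refine mul_le_mul_of_nonneg_left (Real.rpow_le_rpow (by positivity) ?_ (by linarith)) hM.le
          rw [← htm]; exact mul_le_mul_of_nonneg_left (hmax x) (by positivity)
      _ = 1 := by rw [← hMA, ← Real.rpow_natCast A 2, ← Real.rpow_mul hA0.le]; norm_num) hl x₀
  rw [hsc, ← hm, htm, kin_smul, mass_smul, pot_smul, abs_of_pos ht0] at hbog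
  set G := pot p β v₁ v₂ with hG
  have ht2 : t ^ (2 * p + 2) = (t ^ 2) ^ (p + 1) := by
    rw [← Real.rpow_natCast t 2, ← Real.rpow_mul ht0.le]; congr 1; push_cast; ring
  rw [ht2] at hbog
  have h7 : D * (p / (p + 1)) ≤ t ^ 2 * k - (t ^ 2) ^ (p + 1) * G / l := by
    have : t ^ 2 * k - (t ^ 2) ^ (p + 1) * G / l = 1 / 2 * l * (t ^ 2 * kin v₁ v₂)
        + (t ^ 2 * mass v₁ v₂ - (t ^ 2) ^ (p + 1) * G) / l := by rw [hk]; ring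
    rw [this]; linarith
  -- Bernoulli's inequality for `z = t² k / D`
  have hbern := one_add_mul_self_le_rpow_one_add (s := t ^ 2 * k / D - 1)
    (by have : 0 ≤ t ^ 2 * k / D := by positivity
        linarith) (p := p + 1) (by linarith)
  rw [add_sub_cancel, Real.div_rpow (by positivity) hDpos.le,
    Real.mul_rpow (by positivity) hk0] at hbern
  set T := (t ^ 2) ^ (p + 1) with hT
  have hT0 : 0 < T := by positivity
  have hDp : D ^ (p + 1) = D ^ p * D := Real.rpow_add_one hDpos.ne' p
  have hDp0 : 0 < D ^ p := by positivity
  have h8 : T * G / l ≤ T * k ^ (p + 1) / ((p + 1) * D ^ p) := by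
    have h9 : t ^ 2 * k - D * (p / (p + 1)) = D / (p + 1) * (1 + (p + 1) * (t ^ 2 * k / D - 1)) := by
      field_simp; ring
    have h10 : D / (p + 1) * (T * k ^ (p + 1) / D ^ (p + 1))
        = T * k ^ (p + 1) / ((p + 1) * D ^ p) := by
      rw [hDp]; field_simp
    calc T * G / l ≤ t ^ 2 * k - D * (p / (p + 1)) := by linarith
      _ ≤ _ := by
        rw [h9, ← h10]
        exact mul_le_mul_of_nonneg_left hbern (by positivity)
  rw [div_le_div_iff₀ hl (by positivity)] at h8
  have h11 : T * ((p + 1) * D ^ p * G) ≤ T * (k ^ (p + 1) * l) := by linarith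
  exact le_of_mul_le_mul_left h11 hT0

end

/-! ### The second variation at the ground state -/

lemma nonneg_of_isLocalMin_of_hasDerivAt {f f' : ℝ → ℝ} {x c : ℝ} (hmin : IsLocalMin f x)
    (hf : ∀ᶠ y in 𝓝 x, HasDerivAt f (f' y) y) (hf' : HasDerivAt f' c x) : 0 ≤ c := by
  by_contra! hc
  have h1 : deriv f =ᶠ[𝓝 x] f' := hf.mono fun y hy => hy.deriv
  have h2 : deriv (deriv f) x = c := by rw [h1.deriv_eq, hf'.deriv]
  have hmax := isLocalMax_of_deriv_deriv_neg (by rw [h2]; exact hc) hmin.deriv_eq_zero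
    hf.self_of_nhds.continuousAt
  have h3 : f =ᶠ[𝓝 x] fun _ => f x := by
    filter_upwards [hmin, hmax] with y hy1 hy2 using le_antisymm hy2 hy1
  have h4 : deriv f =ᶠ[𝓝 x] fun _ => 0 := by
    filter_upwards [h3.eventuallyEq_nhds] with y hy
    rw [hy.deriv_eq, deriv_const]
  rw [h4.deriv_eq, deriv_const] at h2
  exact hc.ne h2.symm

/-- First- and second-order conditions for the dilated sharp inequality along a curve on which the
kinetic energy is `A₀ + 2 ε x + ε² A₁`, the mass is `B₀ + ε² B₁`, the dilation parameter is
`exp (a ε)` and the potential energy is `G`. -/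
lemma sharp_along_curve {p : ℝ} (hp : 1 ≤ p) {A₀ A₁ B₀ B₁ x a K g : ℝ} {G G' : ℝ → ℝ}
    (hD : 0 < 1 / 2 * A₀ + B₀) (hG : ∀ᶠ ε in 𝓝 0, HasDerivAt G (G' ε) ε) (hG' : HasDerivAt G' g 0)
    (h0 : K * G 0 = (1 / 2 * A₀ + B₀) ^ (p + 1))
    (hle : ∀ ε, K * G ε ≤ (1 / 2 * Real.exp (a * ε) * (A₀ + 2 * ε * x + ε ^ 2 * A₁)
      + (B₀ + ε ^ 2 * B₁) / Real.exp (a * ε)) ^ (p + 1) * Real.exp (a * ε)) :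
    K * G' 0 = (p + 1) * (1 / 2 * A₀ + B₀) ^ p * (x + a * (1 / 2 * A₀ - B₀))
        + a * (1 / 2 * A₀ + B₀) ^ (p + 1) ∧
    K * g ≤ (p + 1) * (p * (1 / 2 * A₀ + B₀) ^ (p - 1) * (x + a * (1 / 2 * A₀ - B₀)) ^ 2
          + (1 / 2 * A₀ + B₀) ^ p * (A₁ + 2 * B₁ + 2 * a * x + a ^ 2 * (1 / 2 * A₀ + B₀)))
        + 2 * a * (p + 1) * (1 / 2 * A₀ + B₀) ^ p * (x + a * (1 / 2 * A₀ - B₀))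
        + a ^ 2 * (1 / 2 * A₀ + B₀) ^ (p + 1) := by
  set E : ℝ → ℝ := fun ε => Real.exp (a * ε) with hE
  have hEd (ε : ℝ) : HasDerivAt E (a * E ε) ε := by
    have := ((hasDerivAt_id ε).const_mul a).exp
    simp only [id, mul_one] at this
    exact this.congr_deriv (mul_comm _ _)
  set N : ℝ → ℝ := fun ε => Real.exp (-a * ε) with hN
  have hNd (ε : ℝ) : HasDerivAt N (-a * N ε) ε := by
    have := ((hasDerivAt_id ε).const_mul (-a)).exp
    simp only [id, mul_one] at this
    exact this.congr_deriv (mul_comm _ _)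
  have hEN (ε y : ℝ) : y / E ε = N ε * y := by
    simp only [hE, hN, neg_mul, Real.exp_neg, div_eq_mul_inv]; ring
  set A : ℝ → ℝ := fun ε => A₀ + 2 * ε * x + ε ^ 2 * A₁ with hA
  have hAd (ε : ℝ) : HasDerivAt A (2 * x + 2 * ε * A₁) ε := by
    refine (((((hasDerivAt_id ε).const_mul 2).mul_const x).const_add A₀).add
      (((hasDerivAt_id ε).pow 2).mul_const A₁)).congr_deriv ?_
    simp
  set B : ℝ → ℝ := fun ε => B₀ + ε ^ 2 * B₁ with hB
  have hBd (ε : ℝ) : HasDerivAt B (2 * ε * B₁) ε := by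
    refine ((((hasDerivAt_id ε).pow 2).mul_const B₁).const_add B₀).congr_deriv ?_
    simp
  set D : ℝ → ℝ := fun ε => 1 / 2 * E ε * A ε + N ε * B ε with hDdef
  set D' : ℝ → ℝ := fun ε => 1 / 2 * (a * E ε) * A ε + 1 / 2 * E ε * (2 * x + 2 * ε * A₁)
    + (-a * N ε * B ε + N ε * (2 * ε * B₁)) with hD'def
  have hDd (ε : ℝ) : HasDerivAt D (D' ε) ε :=
    ((((hEd ε).const_mul (1 / 2)).mul (hAd ε)).add ((hNd ε).mul (hBd ε)))
  have hE0 : E 0 = 1 := by simp [hE]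
  have hN0 : N 0 = 1 := by simp [hN]
  have hA00 : A 0 = A₀ := by simp [hA]
  have hB00 : B 0 = B₀ := by simp [hB]
  have hD0 : D 0 = 1 / 2 * A₀ + B₀ := by simp only [hDdef, hE0, hN0, hA00, hB00]; ring
  have hD'0 : D' 0 = x + a * (1 / 2 * A₀ - B₀) := by
    simp only [hD'def, hE0, hN0, hA00, hB00]; ring
  have hlin (y : ℝ) : HasDerivAt (fun ε : ℝ => 2 * ε * y) (2 * y) 0 := by
    simpa using ((hasDerivAt_id (0 : ℝ)).const_mul 2).mul_const y
  have hD'd : HasDerivAt D' (A₁ + 2 * B₁ + 2 * a * x + a ^ 2 * (1 / 2 * A₀ + B₀)) 0 := by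
    refine ((((((hEd 0).const_mul a).const_mul (1 / 2)).mul (hAd 0)).add
      (((hEd 0).const_mul (1 / 2)).mul ((hlin A₁).const_add (2 * x)))).add
      ((((hNd 0).const_mul (-a)).mul (hBd 0)).add ((hNd 0).mul (hlin B₁)))).congr_deriv ?_
    simp only [hE0, hN0, hA00, hB00]; ring
  set P : ℝ → ℝ := fun ε => D ε ^ (p + 1) * E ε with hP
  set P' : ℝ → ℝ := fun ε => D' ε * (p + 1) * D ε ^ p * E ε + D ε ^ (p + 1) * (a * E ε) with hP'
  have hPd (ε : ℝ) : HasDerivAt P (P' ε) ε := by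
    refine (((hDd ε).rpow_const (p := p + 1) (Or.inr (by linarith))).mul (hEd ε)).congr_deriv ?_
    simp only [hP', add_sub_cancel_right]
  have hP'd : HasDerivAt P' ((p + 1) * (p * (1 / 2 * A₀ + B₀) ^ (p - 1)
        * (x + a * (1 / 2 * A₀ - B₀)) ^ 2
          + (1 / 2 * A₀ + B₀) ^ p * (A₁ + 2 * B₁ + 2 * a * x + a ^ 2 * (1 / 2 * A₀ + B₀)))
        + 2 * a * (p + 1) * (1 / 2 * A₀ + B₀) ^ p * (x + a * (1 / 2 * A₀ - B₀))
        + a ^ 2 * (1 / 2 * A₀ + B₀) ^ (p + 1)) 0 := by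
    have hne : D 0 ≠ 0 := by rw [hD0]; exact hD.ne'
    refine ((((hD'd.mul_const (p + 1)).mul ((hDd 0).rpow_const (p := p) (Or.inl hne))).mul
      (hEd 0)).add (((hDd 0).rpow_const (p := p + 1) (Or.inl hne)).mul
        ((hEd 0).const_mul a))).congr_deriv ?_
    simp only [hE0, hD0, hD'0, add_sub_cancel_right, Pi.mul_apply]; ring
  have hmin : IsLocalMin (fun ε => P ε - K * G ε) 0 := by
    refine Eventually.of_forall fun ε => ?_
    have h1 := hle ε
    have h2 : P 0 = K * G 0 := by rw [h0, hP]; simp only [hE0, hD0, mul_one]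
    change K * G ε ≤ (1 / 2 * E ε * A ε + B ε / E ε) ^ (p + 1) * E ε at h1
    rw [hEN] at h1
    change K * G ε ≤ P ε at h1
    simp only [h2, sub_self]
    linarith
  have hd : ∀ᶠ ε in 𝓝 (0 : ℝ), HasDerivAt (fun ε => P ε - K * G ε) (P' ε - K * G' ε) ε :=
    hG.mono fun ε hε => (hPd ε).sub (hε.const_mul K)
  constructor
  · have h1 := hmin.hasDerivAt_eq_zero hd.self_of_nhds
    have h2 : P' 0 = (p + 1) * (1 / 2 * A₀ + B₀) ^ p * (x + a * (1 / 2 * A₀ - B₀))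
        + a * (1 / 2 * A₀ + B₀) ^ (p + 1) := by
      simp only [hP', hE0, hD0, hD'0]; ring
    linarith
  · have := nonneg_of_isLocalMin_of_hasDerivAt hmin hd (hP'd.sub (hG'.const_mul K))
    linarith

section
variable {p β : ℝ} {r₁ r₂ u₁ u₂ : ℝ → ℝ}

/-- The integrand of the second variation of `∫ F` at `V` in the direction `(u₁, u₂)`. -/
def hessForm (p β v₁ v₂ u₁ u₂ : ℝ) : ℝ :=
  hessFdiag p β v₁ v₂ * u₁ ^ 2 + 2 * hessFmixed p β v₁ v₂ * (u₁ * u₂)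
    + hessFdiag p β v₂ v₁ * u₂ ^ 2

lemma hasDerivAt_integral_of_continuous {f f' : ℝ → ℝ → ℝ} {bound : ℝ → ℝ} {ε : ℝ}
    (hε : ε ∈ Metric.ball (0 : ℝ) 1) (hf : ∀ ε, Continuous (f ε)) (hf' : ∀ ε, Continuous (f' ε))
    (hi : Integrable (f ε)) (hb : ∀ ε ∈ Metric.ball (0 : ℝ) 1, ∀ x, ‖f' ε x‖ ≤ bound x)
    (hbi : Integrable bound) (hd : ∀ ε x, HasDerivAt (fun ε => f ε x) (f' ε x) ε) :
    HasDerivAt (fun ε => ∫ x, f ε x) (∫ x, f' ε x) ε :=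
  (hasDerivAt_integral_of_dominated_loc_of_deriv_le (Metric.isOpen_ball.mem_nhds hε)
    (Eventually.of_forall fun ε => (hf ε).aestronglyMeasurable) hi (hf' ε).aestronglyMeasurable
    (Eventually.of_forall fun x ε hε => hb ε hε x) hbi
    (Eventually.of_forall fun x ε _ => hd ε x)).2

lemma hasDerivAt_pot_line (hp : 1 ≤ p) (hβ : 0 < β) (hr₁ : IsC1H1 r₁) (hr₂ : IsC1H1 r₂)
    (hu₁ : IsC1H1 u₁) (hu₂ : IsC1H1 u₂) :
    (∀ᶠ ε in 𝓝 (0 : ℝ), HasDerivAt (fun ε : ℝ => pot p β (r₁ + ε • u₁) (r₂ + ε • u₂))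
      (∫ x, (gradF p β (r₁ x + ε * u₁ x) (r₂ x + ε * u₂ x) * u₁ x
        + gradF p β (r₂ x + ε * u₂ x) (r₁ x + ε * u₁ x) * u₂ x)) ε) ∧
    HasDerivAt (fun ε : ℝ => ∫ x, (gradF p β (r₁ x + ε * u₁ x) (r₂ x + ε * u₂ x) * u₁ x
        + gradF p β (r₂ x + ε * u₂ x) (r₁ x + ε * u₁ x) * u₂ x))
      (∫ x, hessForm p β (r₁ x) (r₂ x) (u₁ x) (u₂ x)) 0 := by
  obtain ⟨C₁, hC₁⟩ := hr₁.exists_bound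
  obtain ⟨C₂, hC₂⟩ := hr₂.exists_bound
  obtain ⟨C₃, hC₃⟩ := hu₁.exists_bound
  obtain ⟨C₄, hC₄⟩ := hu₂.exists_bound
  set C := max (C₁ + C₃) (C₂ + C₄) with hC
  set s : Set ℝ := Metric.ball 0 1 with hs
  have hs0 : s ∈ 𝓝 (0 : ℝ) := Metric.ball_mem_nhds _ one_pos
  have hsε : ∀ ε ∈ s, |ε| ≤ 1 := fun ε hε => by
    have : |ε| < 1 := by simpa [hs] using hε
    exact this.le
  have hmulb {ε : ℝ} (hε : |ε| ≤ 1) (y : ℝ) : |ε * y| ≤ |y| := by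
    rw [abs_mul]; exact mul_le_of_le_one_left (abs_nonneg _) hε
  have hb₁ {ε : ℝ} (hε : |ε| ≤ 1) (x : ℝ) : |r₁ x + ε * u₁ x| ≤ |r₁ x| + |u₁ x| :=
    (abs_add_le _ _).trans (add_le_add le_rfl (hmulb hε _))
  have hb₂ {ε : ℝ} (hε : |ε| ≤ 1) (x : ℝ) : |r₂ x + ε * u₂ x| ≤ |r₂ x| + |u₂ x| :=
    (abs_add_le _ _).trans (add_le_add le_rfl (hmulb hε _))
  have hc₁ {ε : ℝ} (hε : |ε| ≤ 1) (x : ℝ) : |r₁ x + ε * u₁ x| ≤ C :=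
    ((hb₁ hε x).trans (add_le_add (hC₁ x) (hC₃ x))).trans (le_max_left _ _)
  have hc₂ {ε : ℝ} (hε : |ε| ≤ 1) (x : ℝ) : |r₂ x + ε * u₂ x| ≤ C :=
    ((hb₂ hε x).trans (add_le_add (hC₂ x) (hC₄ x))).trans (le_max_right _ _)
  have hl₁ (ε x : ℝ) : HasDerivAt (fun ε : ℝ => r₁ x + ε * u₁ x) (u₁ x) ε := by
    simpa using ((hasDerivAt_id ε).mul_const (u₁ x)).const_add (r₁ x)
  have hl₂ (ε x : ℝ) : HasDerivAt (fun ε : ℝ => r₂ x + ε * u₂ x) (u₂ x) ε := by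
    simpa using ((hasDerivAt_id ε).mul_const (u₂ x)).const_add (r₂ x)
  have hv (ε : ℝ) : Continuous fun x => (r₁ x + ε * u₁ x, r₂ x + ε * u₂ x) :=
    (hr₁.continuous.add (continuous_const.mul hu₁.continuous)).prodMk
      (hr₂.continuous.add (continuous_const.mul hu₂.continuous))
  have hv' (ε : ℝ) : Continuous fun x => (r₂ x + ε * u₂ x, r₁ x + ε * u₁ x) :=
    (hr₂.continuous.add (continuous_const.mul hu₂.continuous)).prodMk
      (hr₁.continuous.add (continuous_const.mul hu₁.continuous))
  have hgc (ε : ℝ) : Continuous fun x => gradF p β (r₁ x + ε * u₁ x) (r₂ x + ε * u₂ x) * u₁ x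
        + gradF p β (r₂ x + ε * u₂ x) (r₁ x + ε * u₁ x) * u₂ x :=
    (((continuous_gradF hp).comp (hv ε)).mul hu₁.continuous).add
      (((continuous_gradF hp).comp (hv' ε)).mul hu₂.continuous)
  obtain ⟨K, hK0, hK⟩ := exists_gradF_bound (β := β) hp C
  set bound : ℝ → ℝ := fun x => K * ((|r₁ x| + |u₁ x|) * |u₁ x|) + K * ((|r₂ x| + |u₂ x|) * |u₂ x|)
    with hbound
  have hbi : Integrable bound :=
    (((hr₁.memLp.norm.add hu₁.memLp.norm).integrable_mul hu₁.memLp.norm).const_mul K).add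
      (((hr₂.memLp.norm.add hu₂.memLp.norm).integrable_mul hu₂.memLp.norm).const_mul K)
  have hgb {ε : ℝ} (hε : |ε| ≤ 1) (x : ℝ) : ‖gradF p β (r₁ x + ε * u₁ x) (r₂ x + ε * u₂ x) * u₁ x
        + gradF p β (r₂ x + ε * u₂ x) (r₁ x + ε * u₁ x) * u₂ x‖ ≤ bound x := by
    rw [Real.norm_eq_abs]
    refine (abs_add_le _ _).trans (add_le_add ?_ ?_)
    · rw [abs_mul, ← mul_assoc]
      refine mul_le_mul_of_nonneg_right ((hK _ _ (hc₁ hε x) (hc₂ hε x)).trans ?_) (abs_nonneg _)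
      exact mul_le_mul_of_nonneg_left (hb₁ hε x) hK0
    · rw [abs_mul, ← mul_assoc]
      refine mul_le_mul_of_nonneg_right ((hK _ _ (hc₂ hε x) (hc₁ hε x)).trans ?_) (abs_nonneg _)
      exact mul_le_mul_of_nonneg_left (hb₂ hε x) hK0
  constructor
  · filter_upwards [hs0] with ε hε
    have hi : Integrable fun x => F p β (r₁ x + ε * u₁ x) (r₂ x + ε * u₂ x) :=
      integrable_pot hp hβ (hr₁.add (hu₁.const_smul ε)) (hr₂.add (hu₂.const_smul ε))
    exact hasDerivAt_integral_of_continuous (f := fun ε x => F p β (r₁ x + ε * u₁ x) (r₂ x + ε * u₂ x))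
      hε (fun ε => (continuous_F hp).comp (hv ε)) hgc hi (fun ε hε => hgb (hsε ε hε)) hbi
      (fun ε x => hasDerivAt_F hp (hl₁ ε x) (hl₂ ε x))
  · obtain ⟨K₁, hK₁0, hK₁⟩ := exists_bound_comp (continuous_hessFdiag (β := β) hp) C
    obtain ⟨K₂, hK₂0, hK₂⟩ := exists_bound_comp (continuous_hessFmixed (β := β) hp) C
    have hi0 : Integrable fun x => gradF p β (r₁ x + 0 * u₁ x) (r₂ x + 0 * u₂ x) * u₁ x
        + gradF p β (r₂ x + 0 * u₂ x) (r₁ x + 0 * u₁ x) * u₂ x :=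
      hbi.mono' (hgc 0).aestronglyMeasurable (Eventually.of_forall fun x => hgb (by simp) x)
    have hmix (a b : ℝ) : hessFmixed p β b a = hessFmixed p β a b := by unfold hessFmixed; ring
    have hhc (ε : ℝ) : Continuous fun x => hessForm p β (r₁ x + ε * u₁ x) (r₂ x + ε * u₂ x) (u₁ x) (u₂ x) :=
      ((((continuous_hessFdiag hp).comp (hv ε)).mul (hu₁.continuous.pow 2)).add
        ((continuous_const.mul ((continuous_hessFmixed hp).comp (hv ε))).mul
          (hu₁.continuous.mul hu₂.continuous))).add
        (((continuous_hessFdiag hp).comp (hv' ε)).mul (hu₂.continuous.pow 2))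
    have key := hasDerivAt_integral_of_continuous (ε := 0)
      (f' := fun ε x => hessForm p β (r₁ x + ε * u₁ x) (r₂ x + ε * u₂ x) (u₁ x) (u₂ x))
      (bound := fun x => (K₁ + K₂) * (u₁ x ^ 2 + u₂ x ^ 2)) (Metric.mem_ball_self one_pos) hgc hhc hi0
      (fun ε hε x => ?_) ((integrable_mass hu₁ hu₂).const_mul _) (fun ε x => ?_)
    · simpa only [zero_mul, add_zero] using key
    · have h1 := hK₁ _ _ (hc₁ (hsε ε hε) x) (hc₂ (hsε ε hε) x)
      have h2 := hK₁ _ _ (hc₂ (hsε ε hε) x) (hc₁ (hsε ε hε) x)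
      have h3 := hK₂ _ _ (hc₁ (hsε ε hε) x) (hc₂ (hsε ε hε) x)
      rw [Real.norm_eq_abs, hessForm]
      refine (abs_add_three _ _ _).trans ?_
      rw [abs_mul, abs_mul, abs_mul, abs_mul, abs_mul, abs_two, abs_of_nonneg (sq_nonneg (u₁ x)),
        abs_of_nonneg (sq_nonneg (u₂ x))]
      have h4 : 2 * (|u₁ x| * |u₂ x|) ≤ u₁ x ^ 2 + u₂ x ^ 2 := by
        rw [← sq_abs (u₁ x), ← sq_abs (u₂ x)]; nlinarith [sq_nonneg (|u₁ x| - |u₂ x|)]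
      have h5 : 0 ≤ |u₁ x| * |u₂ x| := by positivity
      have e1 := mul_le_mul_of_nonneg_right h1 (sq_nonneg (u₁ x))
      have e2 := mul_le_mul_of_nonneg_right h2 (sq_nonneg (u₂ x))
      have e3 := mul_le_mul_of_nonneg_right h3 h5
      have e4 := mul_le_mul_of_nonneg_left h4 hK₂0
      simp only at e1 e2 e3
      nlinarith
    · refine (((hasDerivAt_gradF hp (hl₁ ε x) (hl₂ ε x)).mul_const (u₁ x)).add
        ((hasDerivAt_gradF hp (hl₂ ε x) (hl₁ ε x)).mul_const (u₂ x))).congr_deriv ?_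
      rw [hmix (r₁ x + ε * u₁ x), hessForm]; ring

lemma kin_add_smul (hr₁ : IsC1H1 r₁) (hr₂ : IsC1H1 r₂) (hu₁ : IsC1H1 u₁) (hu₂ : IsC1H1 u₂) (ε : ℝ) :
    kin (r₁ + ε • u₁) (r₂ + ε • u₂) = kin r₁ r₂
      + 2 * ε * (∫ x, (deriv r₁ x * deriv u₁ x + deriv r₂ x * deriv u₂ x)) + ε ^ 2 * kin u₁ u₂ := by
  have hi : Integrable fun x => deriv r₁ x * deriv u₁ x + deriv r₂ x * deriv u₂ x :=
    (hr₁.memLp_deriv.integrable_mul hu₁.memLp_deriv).add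
      (hr₂.memLp_deriv.integrable_mul hu₂.memLp_deriv)
  have hi' : Integrable fun x => deriv r₁ x ^ 2 + deriv r₂ x ^ 2
      + 2 * ε * (deriv r₁ x * deriv u₁ x + deriv r₂ x * deriv u₂ x) :=
    (integrable_kin hr₁ hr₂).add (hi.const_mul _)
  rw [kin, kin, kin, ← integral_const_mul, ← integral_const_mul,
    ← integral_add (integrable_kin hr₁ hr₂) (hi.const_mul _),
    ← integral_add hi' ((integrable_kin hu₁ hu₂).const_mul _)]
  refine integral_congr_ae (Eventually.of_forall fun x => ?_)
  simp only [deriv_add_fun hr₁.contDiff (hu₁.const_smul ε).contDiff,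
    deriv_add_fun hr₂.contDiff (hu₂.const_smul ε).contDiff, deriv_smul_fun, Pi.add_apply,
    Pi.smul_apply, smul_eq_mul]
  ring

lemma mass_add_smul (hr₁ : IsC1H1 r₁) (hr₂ : IsC1H1 r₂) (hu₁ : IsC1H1 u₁) (hu₂ : IsC1H1 u₂)
    (h : ∫ x, (r₁ x * u₁ x + r₂ x * u₂ x) = 0) (ε : ℝ) :
    mass (r₁ + ε • u₁) (r₂ + ε • u₂) = mass r₁ r₂ + ε ^ 2 * mass u₁ u₂ := by
  have hi : Integrable fun x => r₁ x * u₁ x + r₂ x * u₂ x :=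
    (hr₁.memLp.integrable_mul hu₁.memLp).add (hr₂.memLp.integrable_mul hu₂.memLp)
  have e : mass r₁ r₂ = mass r₁ r₂ + 2 * ε * (∫ x, (r₁ x * u₁ x + r₂ x * u₂ x)) := by
    rw [h]; ring
  have hi' : Integrable fun x => r₁ x ^ 2 + r₂ x ^ 2 + 2 * ε * (r₁ x * u₁ x + r₂ x * u₂ x) :=
    (integrable_mass hr₁ hr₂).add (hi.const_mul _)
  rw [e, mass, mass, mass, ← integral_const_mul, ← integral_const_mul,
    ← integral_add (integrable_mass hr₁ hr₂) (hi.const_mul _),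
    ← integral_add hi' ((integrable_mass hu₁ hu₂).const_mul _)]
  refine integral_congr_ae (Eventually.of_forall fun x => ?_)
  simp only [Pi.add_apply, Pi.smul_apply, smul_eq_mul]
  ring

/-- The improved second-order condition: on `R^⊥` the quadratic form of `L₊` is not merely
nonnegative, it controls `(∂ₓR, ∂ₓU)²`. This is where the subcriticality `p < 2` enters. -/
theorem IsGroundState.second_variation (hR : IsGroundState p β r₁ r₂) (hp : 1 ≤ p)
    (hβ : 0 < β) (hu₁ : IsC1H1 u₁) (hu₂ : IsC1H1 u₂)
    (horth : ∫ x, (r₁ x * u₁ x + r₂ x * u₂ x) = 0) :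
    (2 - p) * (p + 1) / (2 * p * (1 / 2 * kin r₁ r₂ + mass r₁ r₂))
        * (∫ x, (deriv r₁ x * deriv u₁ x + deriv r₂ x * deriv u₂ x)) ^ 2
      ≤ 1 / 2 * kin u₁ u₂ + mass u₁ u₂
        - 1 / 2 * ∫ x, hessForm p β (r₁ x) (r₂ x) (u₁ x) (u₂ x) := by
  have hp0 : 0 < p := by linarith
  have hsol := hR.isSolution
  have hr₁ := hsol.isC1H1₁
  have hr₂ := hsol.isC1H1₂
  have hneh := hsol.nehari hp hβ
  have hDpos : 0 < 1 / 2 * kin r₁ r₂ + mass r₁ r₂ := by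
    have := mass_pos hr₁ hr₂ hR.ne_zero
    have := kin_nonneg r₁ r₂
    linarith
  have hK : (p + 1) * (1 / 2 * kin r₁ r₂ + mass r₁ r₂) ^ p * pot p β r₁ r₂
      = (1 / 2 * kin r₁ r₂ + mass r₁ r₂) ^ (p + 1) := by
    rw [Real.rpow_add_one hDpos.ne', hneh]; ring
  -- the Pohozaev identity is the first-order condition for dilations of `R`
  have hpoh : (p + 1) * (1 / 2 * kin r₁ r₂ - mass r₁ r₂) + (1 / 2 * kin r₁ r₂ + mass r₁ r₂) = 0 := by
    have h := (sharp_along_curve hp (x := 0) (A₁ := 0) (B₁ := 0) (a := 1)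
      (G := fun _ => pot p β r₁ r₂) (G' := fun _ => 0) hDpos
      (Eventually.of_forall fun ε => hasDerivAt_const ε _) (hasDerivAt_const 0 _) hK
      (fun ε => by
        have := hR.sharp hp hβ hr₁ hr₂ (Real.exp_pos (1 * ε))
        simpa using this)).1
    rw [Real.rpow_add_one hDpos.ne'] at h
    have h2 : (1 / 2 * kin r₁ r₂ + mass r₁ r₂) ^ p *
        ((p + 1) * (1 / 2 * kin r₁ r₂ - mass r₁ r₂) + (1 / 2 * kin r₁ r₂ + mass r₁ r₂)) = 0 := by
      linear_combination -h
    exact (mul_eq_zero.1 h2).resolve_left (Real.rpow_pos_of_pos hDpos p).ne'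
  obtain ⟨hG, hG'⟩ := hasDerivAt_pot_line hp hβ hr₁ hr₂ hu₁ hu₂
  set x := ∫ x, (deriv r₁ x * deriv u₁ x + deriv r₂ x * deriv u₂ x) with hx
  set I := ∫ x, hessForm p β (r₁ x) (r₂ x) (u₁ x) (u₂ x) with hI
  set D := 1 / 2 * kin r₁ r₂ + mass r₁ r₂ with hD
  -- the dilation parameter `a` is the optimal one
  set a := -x * (p + 1) / (p * D) with ha
  have h := (sharp_along_curve hp (x := x) (A₁ := kin u₁ u₂) (B₁ := mass u₁ u₂) (a := a)
    (K := (p + 1) * D ^ p) hDpos hG hG' (by simpa only [zero_smul, add_zero] using hK)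
    (fun ε => by
      have := hR.sharp hp hβ (hr₁.add (hu₁.const_smul ε)) (hr₂.add (hu₂.const_smul ε))
        (Real.exp_pos (a * ε))
      rwa [kin_add_smul hr₁ hr₂ hu₁ hu₂, mass_add_smul hr₁ hr₂ hu₁ hu₂ horth] at this)).2
  rw [← hD] at h
  have hd : 1 / 2 * kin r₁ r₂ - mass r₁ r₂ = - D / (p + 1) := by
    field_simp; linarith
  have e1 : D ^ p = D ^ (p - 1) * D := by
    rw [← Real.rpow_add_one hDpos.ne']; congr 1; ring
  have e2 : D ^ (p + 1) = D ^ (p - 1) * D * D := by rw [Real.rpow_add_one hDpos.ne', e1]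
  rw [hd, e1, e2] at h
  have h2 : D ^ (p - 1) * ((p + 1) * D * I) ≤ D ^ (p - 1) * ((p + 1) * (p * (x + a * (-D / (p + 1))) ^ 2
      + D * (kin u₁ u₂ + 2 * mass u₁ u₂ + 2 * a * x + a ^ 2 * D))
      + 2 * a * (p + 1) * D * (x + a * (-D / (p + 1))) + a ^ 2 * D * D) := by
    refine le_trans (le_of_eq ?_) (h.trans (le_of_eq ?_)) <;> ring
  have h3 := le_of_mul_le_mul_left h2 (Real.rpow_pos_of_pos hDpos _)
  have h4 : (p + 1) * (p * (x + a * (-D / (p + 1))) ^ 2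
      + D * (kin u₁ u₂ + 2 * mass u₁ u₂ + 2 * a * x + a ^ 2 * D))
      + 2 * a * (p + 1) * D * (x + a * (-D / (p + 1))) + a ^ 2 * D * D
      = 2 * (p + 1) * D * (1 / 2 * kin u₁ u₂ + mass u₁ u₂
        - (2 - p) * (p + 1) / (2 * p * D) * x ^ 2) := by
    rw [ha]; field_simp; ring
  rw [h4] at h3
  have h5 : 0 < 2 * (p + 1) * D := by positivity
  have h6 : 2 * (p + 1) * D * (1 / 2 * I) ≤ 2 * (p + 1) * D * (1 / 2 * kin u₁ u₂ + mass u₁ u₂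
        - (2 - p) * (p + 1) / (2 * p * D) * x ^ 2) := by linarith
  have := le_of_mul_le_mul_left h6 h5
  linarith

end

/-! ### The space `H¹ × H¹` and its weak topology -/

section basic

@[simp] lemma fn_add (u v : H1) : fn (u + v) = fn u + fn v := rfl
@[simp] lemma fn_smul (c : ℝ) (u : H1) : fn (c • u) = c • fn u := rfl
@[simp] lemma fn_zero : fn 0 = 0 := rfl
@[simp] lemma der_add (u v : H1) : der (u + v) = der u + der v := rfl
@[simp] lemma der_smul (c : ℝ) (u : H1) : der (c • u) = c • der u := rfl
@[simp] lemma der_zero : der 0 = 0 := rfl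

@[fun_prop] lemma continuous_fn : Continuous fn := continuous_fst.comp continuous_subtype_val
@[fun_prop] lemma continuous_der : Continuous der := continuous_snd.comp continuous_subtype_val

lemma H1.norm_eq (u : H1) : ‖u‖ = max ‖fn u‖ ‖der u‖ := rfl

lemma H1.ext {u v : H1} (h : fn u = fn v) (h' : der u = der v) : u = v :=
  Subtype.ext (Prod.ext h h')

lemma dense_isC1H1 : Dense {u : H1 | ∃ (v : ℝ → ℝ) (hv : IsC1H1 v), u = hv.toH1} := by
  intro u
  refine Metric.mem_closure_iff.2 fun ε hε => ?_
  obtain ⟨v, hv, h1, h2⟩ := exists_isC1H1_approx u hε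
  refine ⟨hv.toH1, ⟨v, hv, rfl⟩, ?_⟩
  rw [dist_eq_norm, H1.norm_eq]
  exact max_lt h1 h2

lemma isClosed_H1 : IsClosed (H1 : Set (L2 × L2)) := by
  have : (H1 : Set (L2 × L2)) = ⋂ (φ : ℝ → ℝ) (h : ContDiff ℝ ∞ φ) (hc : HasCompactSupport φ),
      {w : L2 × L2 | inner ℝ w.1 ((IsC1H1.of_test h hc).memLp_deriv.toLp _)
      + inner ℝ w.2 ((IsC1H1.of_test h hc).memLp.toLp _) = 0} := by
    ext w
    simp only [Set.mem_iInter]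
    exact isWeakDeriv_iff_inner
  rw [this]
  refine isClosed_iInter fun φ => isClosed_iInter fun h => isClosed_iInter fun hc => ?_
  exact isClosed_eq (by fun_prop) continuous_const

instance : CompleteSpace H1 := isClosed_H1.completeSpace_coe

/-- Integration by parts in `H¹(ℝ)`. -/
lemma inner_der_fn (u v : H1) : inner ℝ (der u) (fn v) = - inner ℝ (fn u) (der v) := by
  have hd : Dense ({u : H1 | ∃ (v : ℝ → ℝ) (hv : IsC1H1 v), u = hv.toH1} ×ˢ
      {u : H1 | ∃ (v : ℝ → ℝ) (hv : IsC1H1 v), u = hv.toH1}) := dense_isC1H1.prod dense_isC1H1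
  have hcl : IsClosed {w : H1 × H1 |
      inner ℝ (der w.1) (fn w.2) = - inner ℝ (fn w.1) (der w.2)} :=
    isClosed_eq (by fun_prop) (by fun_prop)
  refine hcl.closure_subset_iff.2 ?_ (hd (u, v))
  rintro ⟨-, -⟩ ⟨⟨f, hf, rfl⟩, ⟨g, hg, rfl⟩⟩
  change inner ℝ (der hf.toH1) (fn hg.toH1) = - inner ℝ (fn hf.toH1) (der hg.toH1)
  have e1 : ∫ x, der hf.toH1 x * fn hg.toH1 x = ∫ x, deriv f x * g x := by
    refine integral_congr_ae ?_
    filter_upwards [hf.der_toH1_ae, hg.fn_toH1_ae] with x h1 h2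
    rw [h1, h2]
  have e2 : ∫ x, fn hf.toH1 x * der hg.toH1 x = ∫ x, f x * deriv g x := by
    refine integral_congr_ae ?_
    filter_upwards [hf.fn_toH1_ae, hg.der_toH1_ae] with x h1 h2
    rw [h1, h2]
  rw [L2.inner_eq, L2.inner_eq, e1, e2, hf.integral_mul_deriv hg, neg_neg]

/-- The weak derivative is determined by the function. -/
lemma eq_zero_of_fn_eq_zero {u : H1} (h : fn u = 0) : u = 0 := by
  refine H1.ext h ?_
  have h1 : ∀ᵐ x, der u x = 0 := by
    refine ae_eq_zero_of_integral_contDiff_smul_eq_zero (L2.locallyIntegrable _) fun φ hφ hc => ?_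
    have h2 := isWeakDeriv_iff_inner.1 u.2 φ hφ hc
    change inner ℝ (fn u) _ + inner ℝ (der u) _ = 0 at h2
    rw [h, inner_zero_left, zero_add, L2.inner_toLp_right] at h2
    rw [← h2]
    simp only [smul_eq_mul, mul_comm]
  refine Lp.ext ?_
  filter_upwards [h1, Lp.coeFn_zero ℝ 2 (volume : Measure ℝ)] with x hx h0
  rw [hx, der_zero, h0, Pi.zero_apply]

lemma tendsto_rep {u : ℕ → H1} {w : H1}
    (h₁ : ∀ z, Tendsto (fun n => inner ℝ (fn (u n)) z) atTop (𝓝 (inner ℝ (fn w) z)))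
    (h₂ : ∀ z, Tendsto (fun n => inner ℝ (der (u n)) z) atTop (𝓝 (inner ℝ (der w) z))) (x : ℝ) :
    Tendsto (fun n => rep (u n) x) atTop (𝓝 (rep w x)) := by
  obtain ⟨a, b, -, -, h⟩ := exists_rep_eq_inner x
  simp only [h]
  exact (h₁ a).add (h₂ b)

/-- A bounded sequence in `H¹(ℝ)` has a subsequence which converges weakly together with its
derivatives. -/
lemma H1.exists_weak_subseq {u : ℕ → H1} {C : ℝ} (h₁ : ∀ n, ‖fn (u n)‖ ≤ C)
    (h₂ : ∀ n, ‖der (u n)‖ ≤ C) : ∃ (w : H1) (k : ℕ → ℕ), StrictMono k ∧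
      (∀ z, Tendsto (fun n => inner ℝ (fn (u (k n))) z) atTop (𝓝 (inner ℝ (fn w) z))) ∧
      ∀ z, Tendsto (fun n => inner ℝ (der (u (k n))) z) atTop (𝓝 (inner ℝ (der w) z)) := by
  obtain ⟨a, k, hk, ha⟩ := L2.exists_weak_subseq h₁
  obtain ⟨b, l, hl, hb⟩ := L2.exists_weak_subseq fun n => h₂ (k n)
  have ha' (z : L2) : Tendsto (fun n => inner ℝ (fn (u (k (l n)))) z) atTop (𝓝 (inner ℝ a z)) :=
    (ha z).comp hl.tendsto_atTop
  have hw : IsWeakDeriv a b := by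
    rw [isWeakDeriv_iff_inner]
    intro φ h hc
    have hlim := (ha' ((IsC1H1.of_test h hc).memLp_deriv.toLp _)).add
      (hb ((IsC1H1.of_test h hc).memLp.toLp _))
    refine tendsto_nhds_unique hlim (tendsto_const_nhds.congr fun n => ?_)
    exact (isWeakDeriv_iff_inner.1 (u (k (l n))).2 φ h hc).symm
  exact ⟨⟨(a, b), hw⟩, k ∘ l, hk.comp hl, ha', hb⟩

end basic

/-! ### Multiplication operators and the bilinear form of `L₊` -/

open scoped BoundedContinuousFunction

lemma norm_mul_le_of_bounded (h : ℝ →ᵇ ℝ) (x a : ℝ) : ‖h x * a‖ ≤ ‖h‖ * ‖a‖ := by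
  rw [norm_mul]
  exact mul_le_mul_of_nonneg_right (h.norm_coe_le_norm x) (norm_nonneg _)

lemma memLp_bounded_mul (h : ℝ →ᵇ ℝ) (u : L2) : MemLp (fun x => h x * u x) 2 volume :=
  (Lp.memLp u).of_le_mul (h.continuous.aestronglyMeasurable.mul (Lp.aestronglyMeasurable u))
    (Eventually.of_forall fun x => norm_mul_le_of_bounded h x (u x))

/-- Multiplication by a bounded continuous function on `L²`. -/
def mulOp (h : ℝ →ᵇ ℝ) : L2 →L[ℝ] L2 :=
  LinearMap.mkContinuous
    { toFun := fun u => (memLp_bounded_mul h u).toLp _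
      map_add' := fun u v => by
        rw [← MemLp.toLp_add]
        refine MemLp.toLp_congr _ _ ?_
        filter_upwards [Lp.coeFn_add u v] with x hx
        simp only [hx, Pi.add_apply, mul_add]
      map_smul' := fun c u => by
        rw [RingHom.id_apply, ← MemLp.toLp_const_smul]
        refine MemLp.toLp_congr _ _ ?_
        filter_upwards [Lp.coeFn_smul c u] with x hx
        simp only [hx, Pi.smul_apply, smul_eq_mul]; ring }
    ‖h‖ fun u => by
      refine Lp.norm_le_mul_norm_of_ae_le_mul ?_
      filter_upwards [MemLp.coeFn_toLp (memLp_bounded_mul h u)] with x hx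
      change ‖((memLp_bounded_mul h u).toLp _ : L2) x‖ ≤ _
      rw [hx]
      exact norm_mul_le_of_bounded h x (u x)

lemma mulOp_ae (h : ℝ →ᵇ ℝ) (u : L2) : (fun x => mulOp h u x) =ᵐ[volume] fun x => h x * u x :=
  MemLp.coeFn_toLp (memLp_bounded_mul h u)

lemma inner_mulOp (h : ℝ →ᵇ ℝ) (u v : L2) : inner ℝ (mulOp h u) v = ∫ x, h x * u x * v x := by
  rw [L2.inner_eq]
  refine integral_congr_ae ?_
  filter_upwards [mulOp_ae h u] with x hx
  rw [hx]

lemma integrable_mulOp (h : ℝ →ᵇ ℝ) (u v : L2) : Integrable fun x => h x * u x * v x := by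
  refine (L2.integrable_mul (mulOp h u) v).congr ?_
  filter_upwards [mulOp_ae h u] with x hx
  rw [hx]

lemma inner_mulOp_comm (h : ℝ →ᵇ ℝ) (u v : L2) :
    inner ℝ (mulOp h u) v = inner ℝ (mulOp h v) u := by
  rw [inner_mulOp, inner_mulOp]
  simp only [mul_right_comm]

/-- Multiplication by an integrable bounded function is compact from `H¹` to its dual: the
associated form is sequentially continuous for weak convergence. -/
lemma tendsto_inner_mulOp {h : ℝ →ᵇ ℝ} (hi : Integrable h) {u v : ℕ → H1} {w z : H1} {C : ℝ}
    (hu₁ : ∀ n, ‖fn (u n)‖ ≤ C) (hu₂ : ∀ n, ‖der (u n)‖ ≤ C)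
    (hv₁ : ∀ n, ‖fn (v n)‖ ≤ C) (hv₂ : ∀ n, ‖der (v n)‖ ≤ C)
    (hw : ∀ x, Tendsto (fun n => rep (u n) x) atTop (𝓝 (rep w x)))
    (hz : ∀ x, Tendsto (fun n => rep (v n) x) atTop (𝓝 (rep z x))) :
    Tendsto (fun n => inner ℝ (mulOp h (fn (u n))) (fn (v n))) atTop
      (𝓝 (inner ℝ (mulOp h (fn w)) (fn z))) := by
  have e (a b : H1) : inner ℝ (mulOp h (fn a)) (fn b) = ∫ x, h x * (rep a x * rep b x) := by
    rw [inner_mulOp]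
    refine integral_congr_ae ?_
    filter_upwards [fn_ae_eq_rep a, fn_ae_eq_rep b] with x h1 h2
    rw [h1, h2, mul_assoc]
  have hC : 0 ≤ C := (norm_nonneg _).trans (hu₁ 0)
  simp only [e]
  refine tendsto_integral_of_dominated_convergence (fun x => ‖h x‖ * ((C + C) * (C + C)))
    (fun n => (h.continuous.mul ((continuous_rep _).mul (continuous_rep _))).aestronglyMeasurable)
    (hi.norm.mul_const _) (fun n => Eventually.of_forall fun x => ?_)
    (Eventually.of_forall fun x => ((hw x).mul (hz x)).const_mul _)
  rw [norm_mul, norm_mul]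
  refine mul_le_mul_of_nonneg_left (mul_le_mul ?_ ?_ (norm_nonneg _) (by positivity))
    (norm_nonneg _)
  · exact (abs_rep_le _ _).trans (add_le_add (hu₁ n) (hu₂ n))
  · exact (abs_rep_le _ _).trans (add_le_add (hv₁ n) (hv₂ n))

/-- The form `½ (∂ₓU, ∂ₓV) + (U, V) - (H U, V)` on `H¹ × H¹` with a symmetric matrix `H` of bounded
continuous coefficients. -/
def schrodForm (h₁ h₁₂ h₂ : ℝ →ᵇ ℝ) (U V : HH) : ℝ :=
  1 / 2 * (inner ℝ (der U.1) (der V.1) + inner ℝ (der U.2) (der V.2))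
    + (inner ℝ (fn U.1) (fn V.1) + inner ℝ (fn U.2) (fn V.2))
    - (inner ℝ (mulOp h₁ (fn U.1)) (fn V.1) + inner ℝ (mulOp h₁₂ (fn U.2)) (fn V.1)
      + inner ℝ (mulOp h₁₂ (fn U.1)) (fn V.2) + inner ℝ (mulOp h₂ (fn U.2)) (fn V.2))

section schrodForm
variable (h₁ h₁₂ h₂ : ℝ →ᵇ ℝ)

lemma schrodForm_add_left (U U' V : HH) :
    schrodForm h₁ h₁₂ h₂ (U + U') V = schrodForm h₁ h₁₂ h₂ U V + schrodForm h₁ h₁₂ h₂ U' V := by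
  simp only [schrodForm, Prod.fst_add, Prod.snd_add, fn_add, der_add, map_add, inner_add_left]
  ring

lemma schrodForm_smul_left (c : ℝ) (U V : HH) :
    schrodForm h₁ h₁₂ h₂ (c • U) V = c * schrodForm h₁ h₁₂ h₂ U V := by
  simp only [schrodForm, Prod.smul_fst, Prod.smul_snd, fn_smul, der_smul, map_smul,
    real_inner_smul_left]
  ring

lemma schrodForm_comm (U V : HH) : schrodForm h₁ h₁₂ h₂ U V = schrodForm h₁ h₁₂ h₂ V U := by
  simp only [schrodForm]
  rw [real_inner_comm (der V.1), real_inner_comm (der V.2), real_inner_comm (fn V.1),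
    real_inner_comm (fn V.2), inner_mulOp_comm h₁, inner_mulOp_comm h₂,
    inner_mulOp_comm h₁₂ (fn U.1), inner_mulOp_comm h₁₂ (fn U.2)]
  ring

lemma schrodForm_add_right (U V V' : HH) :
    schrodForm h₁ h₁₂ h₂ U (V + V') = schrodForm h₁ h₁₂ h₂ U V + schrodForm h₁ h₁₂ h₂ U V' := by
  rw [schrodForm_comm, schrodForm_add_left, schrodForm_comm _ _ _ V, schrodForm_comm _ _ _ V']

lemma schrodForm_smul_right (c : ℝ) (U V : HH) :
    schrodForm h₁ h₁₂ h₂ U (c • V) = c * schrodForm h₁ h₁₂ h₂ U V := by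
  rw [schrodForm_comm, schrodForm_smul_left, schrodForm_comm]

lemma schrodForm_add_smul_self (U V : HH) (t : ℝ) : schrodForm h₁ h₁₂ h₂ (U + t • V) (U + t • V)
    = schrodForm h₁ h₁₂ h₂ U U + 2 * t * schrodForm h₁ h₁₂ h₂ U V
      + t ^ 2 * schrodForm h₁ h₁₂ h₂ V V := by
  simp only [schrodForm_add_left, schrodForm_add_right, schrodForm_smul_left, schrodForm_smul_right]
  rw [schrodForm_comm _ _ _ V U]
  ring

@[fun_prop]
lemma continuous_schrodForm_self : Continuous fun U : HH => schrodForm h₁ h₁₂ h₂ U U := by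
  unfold schrodForm
  fun_prop

lemma schrodForm_self (U : HH) : schrodForm h₁ h₁₂ h₂ U U
    = 1 / 2 * (‖der U.1‖ ^ 2 + ‖der U.2‖ ^ 2) + l2NormSq U
      - (inner ℝ (mulOp h₁ (fn U.1)) (fn U.1) + inner ℝ (mulOp h₁₂ (fn U.2)) (fn U.1)
      + inner ℝ (mulOp h₁₂ (fn U.1)) (fn U.2) + inner ℝ (mulOp h₂ (fn U.2)) (fn U.2)) := by
  simp only [schrodForm, l2NormSq, real_inner_self_eq_norm_sq]

lemma schrodForm_self_le : ∃ C, ∀ U : HH, schrodForm h₁ h₁₂ h₂ U U ≤ C * hNormSq U := by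
  refine ⟨1 + (‖mulOp h₁‖ + ‖mulOp h₁₂‖ + ‖mulOp h₂‖), fun U => ?_⟩
  rw [schrodForm_self, hNormSq, l2NormSq]
  have hb (h : ℝ →ᵇ ℝ) (u v : L2) :
      -inner ℝ (mulOp h u) v ≤ ‖mulOp h‖ * (1 / 2 * (‖u‖ ^ 2 + ‖v‖ ^ 2)) := by
    refine (neg_le_abs _).trans ((abs_real_inner_le_norm _ _).trans ?_)
    calc ‖mulOp h u‖ * ‖v‖ ≤ ‖mulOp h‖ * ‖u‖ * ‖v‖ := by
          gcongr; exact (mulOp h).le_opNorm u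
      _ = ‖mulOp h‖ * (‖u‖ * ‖v‖) := by ring
      _ ≤ _ := mul_le_mul_of_nonneg_left (by nlinarith [sq_nonneg (‖u‖ - ‖v‖)]) (norm_nonneg _)
  have e1 := hb h₁ (fn U.1) (fn U.1)
  have e2 := hb h₁₂ (fn U.2) (fn U.1)
  have e3 := hb h₁₂ (fn U.1) (fn U.2)
  have e4 := hb h₂ (fn U.2) (fn U.2)
  have n1 := norm_nonneg (mulOp h₁)
  have n2 := norm_nonneg (mulOp h₁₂)
  have n3 := norm_nonneg (mulOp h₂)
  have s1 := sq_nonneg ‖fn U.1‖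
  have s2 := sq_nonneg ‖fn U.2‖
  have s3 := sq_nonneg ‖der U.1‖
  have s4 := sq_nonneg ‖der U.2‖
  nlinarith [mul_nonneg n1 s2, mul_nonneg n3 s1,
    mul_nonneg (add_nonneg (add_nonneg n1 n2) n3) (add_nonneg s3 s4)]

lemma hNormSq_nonneg (U : HH) : 0 ≤ hNormSq U := by unfold hNormSq l2NormSq; positivity

lemma hNormSq_smul (c : ℝ) (U : HH) : hNormSq (c • U) = c ^ 2 * hNormSq U := by
  simp only [hNormSq, l2NormSq, Prod.smul_fst, Prod.smul_snd, fn_smul, der_smul, norm_smul,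
    Real.norm_eq_abs, mul_pow, sq_abs]
  ring

lemma norm_sq_le_hNormSq (U : HH) : ‖U‖ ^ 2 ≤ hNormSq U := by
  have h1 := sq_nonneg ‖fn U.1‖
  have h2 := sq_nonneg ‖fn U.2‖
  have h3 := sq_nonneg ‖der U.1‖
  have h4 := sq_nonneg ‖der U.2‖
  have e : ‖U‖ = max (max ‖fn U.1‖ ‖der U.1‖) (max ‖fn U.2‖ ‖der U.2‖) := rfl
  rw [e, hNormSq, l2NormSq]
  rcases max_choice (max ‖fn U.1‖ ‖der U.1‖) (max ‖fn U.2‖ ‖der U.2‖) with h | h <;> rw [h]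
  · rcases max_choice ‖fn U.1‖ ‖der U.1‖ with h | h <;> rw [h] <;> linarith
  · rcases max_choice ‖fn U.2‖ ‖der U.2‖ with h | h <;> rw [h] <;> linarith

lemma eq_zero_of_hNormSq {U : HH} (h : hNormSq U = 0) : U = 0 := by
  have := norm_sq_le_hNormSq U
  rw [h] at this
  exact norm_eq_zero.1 (pow_eq_zero_iff two_ne_zero |>.1 (le_antisymm this (sq_nonneg _)))

lemma l2NormSq_pos {U : HH} (h : U ≠ 0) : 0 < l2NormSq U := by
  have h0 : 0 ≤ l2NormSq U := by unfold l2NormSq; positivity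
  refine h0.lt_of_ne fun h1 => h ?_
  unfold l2NormSq at h1
  have h2 : fn U.1 = 0 := by
    rw [← norm_eq_zero, ← sq_eq_zero_iff]
    nlinarith [sq_nonneg ‖fn U.1‖, sq_nonneg ‖fn U.2‖]
  have h3 : fn U.2 = 0 := by
    rw [← norm_eq_zero, ← sq_eq_zero_iff]
    nlinarith [sq_nonneg ‖fn U.1‖, sq_nonneg ‖fn U.2‖]
  exact Prod.ext (eq_zero_of_fn_eq_zero h2) (eq_zero_of_fn_eq_zero h3)

/-- The functional `U ↦ (U, (a, b))` on `H¹ × H¹`. -/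
def pairing (a b : L2) : HH →ₗ[ℝ] ℝ where
  toFun U := inner ℝ (fn U.1) a + inner ℝ (fn U.2) b
  map_add' U V := by
    simp only [Prod.fst_add, Prod.snd_add, fn_add, inner_add_left]; ring
  map_smul' c U := by
    simp only [Prod.smul_fst, Prod.smul_snd, fn_smul, real_inner_smul_left, RingHom.id_apply,
      smul_eq_mul]
    ring

lemma pairing_apply (a b : L2) (U : HH) :
    pairing a b U = inner ℝ (fn U.1) a + inner ℝ (fn U.2) b := rfl

@[fun_prop]
lemma continuous_pairing (a b : L2) : Continuous (pairing a b) := by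
  change Continuous fun U : HH => inner ℝ (fn U.1) a + inner ℝ (fn U.2) b
  fun_prop

/-- Coercivity by weak compactness: if the coefficients are integrable and the form is nonnegative
and definite on the common kernel of two functionals, it is coercive there. -/
theorem exists_coercive {h₁ h₁₂ h₂ : ℝ →ᵇ ℝ} (i₁ : Integrable h₁) (i₁₂ : Integrable h₁₂)
    (i₂ : Integrable h₂) (a b c d : L2)
    (hnn : ∀ U : HH, pairing a b U = 0 → pairing c d U = 0 → 0 ≤ schrodForm h₁ h₁₂ h₂ U U)
    (hdef : ∀ U : HH, pairing a b U = 0 → pairing c d U = 0 → schrodForm h₁ h₁₂ h₂ U U = 0 → U = 0) :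
    ∃ α : ℝ, 0 < α ∧ ∀ U : HH, pairing a b U = 0 → pairing c d U = 0 →
      α * hNormSq U ≤ schrodForm h₁ h₁₂ h₂ U U := by
  by_contra! hcon
  have hseq (n : ℕ) : ∃ U : HH, pairing a b U = 0 ∧ pairing c d U = 0 ∧ hNormSq U = 1 ∧
      schrodForm h₁ h₁₂ h₂ U U < 1 / ((n : ℝ) + 1) := by
    obtain ⟨U, h1, h2, h3⟩ := hcon (1 / ((n : ℝ) + 1)) (by positivity)
    have h4 : 0 < hNormSq U := by
      refine (hNormSq_nonneg U).lt_of_ne fun h0 => ?_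
      rw [← h0, mul_zero] at h3
      exact absurd (hnn U h1 h2) (not_le.2 h3)
    set s := (√(hNormSq U))⁻¹ with hs
    have hs2 : s ^ 2 * hNormSq U = 1 := by
      rw [hs, inv_pow, Real.sq_sqrt h4.le, inv_mul_cancel₀ h4.ne']
    refine ⟨s • U, by rw [map_smul, h1, smul_zero], by rw [map_smul, h2, smul_zero],
      by rw [hNormSq_smul, hs2], ?_⟩
    rw [schrodForm_smul_left, schrodForm_smul_right, ← mul_assoc, ← sq]
    have hs0 : 0 < s ^ 2 := by positivity
    calc s ^ 2 * schrodForm h₁ h₁₂ h₂ U U < s ^ 2 * (1 / ((n : ℝ) + 1) * hNormSq U) := by gcongr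
      _ = 1 / ((n : ℝ) + 1) * (s ^ 2 * hNormSq U) := by ring
      _ = _ := by rw [hs2, mul_one]
  choose U hU1 hU2 hU3 hU4 using hseq
  have hb (n : ℕ) : ‖fn (U n).1‖ ≤ 1 ∧ ‖der (U n).1‖ ≤ 1 ∧ ‖fn (U n).2‖ ≤ 1 ∧ ‖der (U n).2‖ ≤ 1 := by
    have h := hU3 n
    rw [hNormSq, l2NormSq] at h
    have h1 := sq_nonneg ‖fn (U n).1‖
    have h2 := sq_nonneg ‖fn (U n).2‖
    have h3 := sq_nonneg ‖der (U n).1‖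
    have h4 := sq_nonneg ‖der (U n).2‖
    refine ⟨?_, ?_, ?_, ?_⟩ <;> refine (sq_le_one_iff₀ (norm_nonneg _)).1 ?_ <;> linarith
  obtain ⟨w₁, k, hk, f₁, d₁⟩ := H1.exists_weak_subseq (fun n => (hb n).1) fun n => (hb n).2.1
  obtain ⟨w₂, l, hl, f₂, d₂⟩ := H1.exists_weak_subseq (fun n => (hb (k n)).2.2.1)
    fun n => (hb (k n)).2.2.2
  set m := k ∘ l with hm
  have hmt : Tendsto m atTop atTop := (hk.comp hl).tendsto_atTop
  replace f₁ (z) := (f₁ z).comp hl.tendsto_atTop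
  replace d₁ (z) := (d₁ z).comp hl.tendsto_atTop
  set W : HH := (w₁, w₂) with hW
  have hker (a b : L2) (h : ∀ n, pairing a b (U n) = 0) : pairing a b W = 0 := by
    refine tendsto_nhds_unique ((f₁ a).add (f₂ b)) (tendsto_const_nhds.congr fun n => ?_)
    exact (h (m n)).symm
  have hr₁ (x : ℝ) := tendsto_rep (u := fun n => (U (m n)).1) f₁ d₁ x
  have hr₂ (x : ℝ) := tendsto_rep (u := fun n => (U (m n)).2) f₂ d₂ x
  have b₁ (n : ℕ) := (hb (m n)).1
  have b₂ (n : ℕ) := (hb (m n)).2.1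
  have b₃ (n : ℕ) := (hb (m n)).2.2.1
  have b₄ (n : ℕ) := (hb (m n)).2.2.2
  set q : HH → ℝ := fun V => inner ℝ (mulOp h₁ (fn V.1)) (fn V.1)
    + inner ℝ (mulOp h₁₂ (fn V.2)) (fn V.1) + inner ℝ (mulOp h₁₂ (fn V.1)) (fn V.2)
    + inner ℝ (mulOp h₂ (fn V.2)) (fn V.2) with hq
  have hqlim : Tendsto (fun n => q (U (m n))) atTop (𝓝 (q W)) :=
    (((tendsto_inner_mulOp i₁ b₁ b₂ b₁ b₂ hr₁ hr₁).add
      (tendsto_inner_mulOp i₁₂ b₃ b₄ b₁ b₂ hr₂ hr₁)).add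
      (tendsto_inner_mulOp i₁₂ b₁ b₂ b₃ b₄ hr₁ hr₂)).add
      (tendsto_inner_mulOp i₂ b₃ b₄ b₃ b₄ hr₂ hr₂)
  have hsmall : Tendsto (fun n => 1 / ((m n : ℝ) + 1)) atTop (𝓝 0) :=
    tendsto_one_div_add_atTop_nhds_zero_nat.comp hmt
  have hform (V : HH) : schrodForm h₁ h₁₂ h₂ V V
      = 1 / 2 * (‖der V.1‖ ^ 2 + ‖der V.2‖ ^ 2) + l2NormSq V - q V := schrodForm_self h₁ h₁₂ h₂ V
  -- weak lower semicontinuity of the norms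
  have hlow (u w : L2) : 2 * inner ℝ u w - ‖w‖ ^ 2 ≤ ‖u‖ ^ 2 := by
    have := norm_sub_sq_real u w
    nlinarith [sq_nonneg ‖u - w‖]
  have hW0 : schrodForm h₁ h₁₂ h₂ W W ≤ 0 := by
    have hlim : Tendsto (fun n => 1 / 2 * ((2 * inner ℝ (der (U (m n)).1) (der w₁) - ‖der w₁‖ ^ 2)
        + (2 * inner ℝ (der (U (m n)).2) (der w₂) - ‖der w₂‖ ^ 2))
        + ((2 * inner ℝ (fn (U (m n)).1) (fn w₁) - ‖fn w₁‖ ^ 2)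
        + (2 * inner ℝ (fn (U (m n)).2) (fn w₂) - ‖fn w₂‖ ^ 2)) - q (U (m n))) atTop
        (𝓝 (1 / 2 * ((2 * inner ℝ (der w₁) (der w₁) - ‖der w₁‖ ^ 2)
        + (2 * inner ℝ (der w₂) (der w₂) - ‖der w₂‖ ^ 2))
        + ((2 * inner ℝ (fn w₁) (fn w₁) - ‖fn w₁‖ ^ 2)
        + (2 * inner ℝ (fn w₂) (fn w₂) - ‖fn w₂‖ ^ 2)) - q W)) :=
      (((((((d₁ (der w₁)).const_mul 2).sub_const _).add
        (((d₂ (der w₂)).const_mul 2).sub_const _)).const_mul (1 / 2)).add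
        ((((f₁ (fn w₁)).const_mul 2).sub_const _).add
        (((f₂ (fn w₂)).const_mul 2).sub_const _))).sub hqlim)
    have hle := le_of_tendsto_of_tendsto' hlim hsmall fun n => by
      have h1 := (hU4 (m n)).le
      rw [hform, l2NormSq] at h1
      have e1 := hlow (der (U (m n)).1) (der w₁)
      have e2 := hlow (der (U (m n)).2) (der w₂)
      have e3 := hlow (fn (U (m n)).1) (fn w₁)
      have e4 := hlow (fn (U (m n)).2) (fn w₂)
      linarith
    simp only [real_inner_self_eq_norm_sq] at hle
    rw [hform, l2NormSq]
    change 1 / 2 * (‖der w₁‖ ^ 2 + ‖der w₂‖ ^ 2) + (‖fn w₁‖ ^ 2 + ‖fn w₂‖ ^ 2) - q W ≤ 0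
    linarith
  have hWz : W = 0 := hdef W (hker a b hU1) (hker c d hU2)
    (le_antisymm hW0 (hnn W (hker a b hU1) (hker c d hU2)))
  have hq0 : q W = 0 := by rw [hWz, hq]; simp
  rw [hq0] at hqlim
  have hle := le_of_tendsto_of_tendsto' (hqlim.const_sub (1 / 2)) hsmall fun n => by
    have h1 := (hU4 (m n)).le
    have h2 := hU3 (m n)
    rw [hform] at h1
    rw [hNormSq] at h2
    have h3 : 0 ≤ l2NormSq (U (m n)) := by unfold l2NormSq; positivity
    linarith
  norm_num at hle

end schrodForm

/-! ### The Hessian coefficients along a solution -/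

section
variable {p β : ℝ} {r₁ r₂ : ℝ → ℝ}

/-- Both entries of the Hessian are quadratically small at the origin, hence integrable along a
solution. -/
lemma exists_hess_bound (hp : 1 ≤ p) (hβ : 0 < β) (C : ℝ) : ∃ K, 0 ≤ K ∧ ∀ a b : ℝ, 0 ≤ a → 0 ≤ b →
    a ≤ C → b ≤ C →
    |hess11 p β a b| ≤ K * (a ^ 2 + b ^ 2) ∧ |hess12 p β a b| ≤ K * (a ^ 2 + b ^ 2) := by
  set c := |C| ^ (p - 1) with hc
  have hc0 : 0 ≤ c := by positivity
  have e1 {a : ℝ} (h0 : 0 ≤ a) (h : a ≤ C) : a ^ (p - 1) ≤ c :=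
    Real.rpow_le_rpow h0 (h.trans (le_abs_self C)) (by linarith)
  have e2 {a : ℝ} (h0 : 0 ≤ a) : a ^ p = a ^ (p - 1) * a := by
    rw [← Real.rpow_add_one' h0 (by linarith), sub_add_cancel]
  have e3 {a : ℝ} (h0 : 0 ≤ a) : a ^ (p + 1) = a ^ (p - 1) * a ^ 2 := by
    rw [Real.rpow_add_one' h0 (by linarith), e2 h0]; ring
  have e4 {a : ℝ} (h0 : 0 ≤ a) : a ^ (2 * p) = (a ^ (p - 1) * a ^ (p - 1)) * a ^ 2 := by
    rw [two_mul, Real.rpow_add' h0 (by linarith), e2 h0]; ring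
  refine ⟨(2 * p + 1 + p * β + (p + 1) * β) * (c * c), by positivity, fun a b ha hb hac hbc => ?_⟩
  have ha1 := e1 ha hac
  have hb1 := e1 hb hbc
  have hap : 0 ≤ a ^ (p - 1) := by positivity
  have hbp : 0 ≤ b ^ (p - 1) := by positivity
  have haa : a ^ (p - 1) * a ^ (p - 1) ≤ c * c := mul_le_mul ha1 ha1 hap hc0
  have hab : a ^ (p - 1) * b ^ (p - 1) ≤ c * c := mul_le_mul ha1 hb1 hbp hc0
  have hcc : 0 ≤ c * c := by positivity
  have hpβ : 0 ≤ p * β := by positivity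
  have hpβ' : 0 ≤ (p + 1) * β := by positivity
  have hp2 : 0 ≤ 2 * p + 1 := by positivity
  have q1 : 0 ≤ c * c * a ^ 2 := by positivity
  have q2 : 0 ≤ c * c * b ^ 2 := by positivity
  constructor
  · rw [abs_of_nonneg (by unfold hess11; positivity), hess11, e4 ha, e3 hb]
    have t1 : a ^ (p - 1) * a ^ (p - 1) * a ^ 2 ≤ c * c * a ^ 2 := by gcongr
    have t2 : a ^ (p - 1) * b ^ (p - 1) * b ^ 2 ≤ c * c * b ^ 2 := by gcongr
    calc _ = (2 * p + 1) * (a ^ (p - 1) * a ^ (p - 1) * a ^ 2)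
          + p * β * (a ^ (p - 1) * b ^ (p - 1) * b ^ 2) := by ring
      _ ≤ (2 * p + 1) * (c * c * a ^ 2) + p * β * (c * c * b ^ 2) := by gcongr
      _ ≤ _ := by
        have := mul_nonneg hp2 q2
        have := mul_nonneg hpβ q1
        have := mul_nonneg hpβ' (add_nonneg q1 q2)
        nlinarith
  · rw [abs_of_nonneg (by unfold hess12; positivity), hess12, e2 ha, e2 hb]
    have hm : a * b ≤ a ^ 2 + b ^ 2 := by nlinarith [sq_nonneg (a - b)]
    calc _ = (p + 1) * β * (a ^ (p - 1) * b ^ (p - 1) * (a * b)) := by ring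
      _ ≤ (p + 1) * β * (c * c * (a ^ 2 + b ^ 2)) := by gcongr
      _ ≤ _ := by
        have := mul_nonneg hp2 (add_nonneg q1 q2)
        have := mul_nonneg hpβ (add_nonneg q1 q2)
        nlinarith

/-- The entries of `H_F(R)` as bounded continuous integrable functions on the line. -/
structure IsHessian (p β : ℝ) (r₁ r₂ : ℝ → ℝ) (h₁ h₁₂ h₂ : ℝ →ᵇ ℝ) : Prop where
  eq₁ : ∀ x, h₁ x = hess11 p β (r₁ x) (r₂ x)
  eq₁₂ : ∀ x, h₁₂ x = hess12 p β (r₁ x) (r₂ x)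
  eq₂ : ∀ x, h₂ x = hess22 p β (r₁ x) (r₂ x)
  integrable₁ : Integrable h₁
  integrable₁₂ : Integrable h₁₂
  integrable₂ : Integrable h₂

lemma IsSolution.exists_hess_coeff (h : IsSolution p β r₁ r₂) (hp : 1 ≤ p) (hβ : 0 < β) :
    (∃ H : ℝ →ᵇ ℝ, (∀ x, H x = hess11 p β (r₁ x) (r₂ x)) ∧ Integrable H) ∧
    ∃ H : ℝ →ᵇ ℝ, (∀ x, H x = hess12 p β (r₁ x) (r₂ x)) ∧ Integrable H := by
  obtain ⟨C₁, hC₁⟩ := h.isC1H1₁.exists_bound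
  obtain ⟨C₂, hC₂⟩ := h.isC1H1₂.exists_bound
  obtain ⟨K, hK0, hK⟩ := exists_hess_bound hp hβ (max C₁ C₂)
  have b₁ (x : ℝ) : r₁ x ≤ max C₁ C₂ := (le_abs_self _).trans ((hC₁ x).trans (le_max_left _ _))
  have b₂ (x : ℝ) : r₂ x ≤ max C₁ C₂ := (le_abs_self _).trans ((hC₂ x).trans (le_max_right _ _))
  have hb (x : ℝ) := hK _ _ (h.nonneg₁ x) (h.nonneg₂ x) (b₁ x) (b₂ x)
  have hle (x : ℝ) : K * (r₁ x ^ 2 + r₂ x ^ 2) ≤ K * (max C₁ C₂ ^ 2 + max C₁ C₂ ^ 2) := by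
    have h1 := h.nonneg₁ x
    have h2 := h.nonneg₂ x
    have h3 := b₁ x
    have h4 := b₂ x
    gcongr
  have hint := (integrable_mass h.isC1H1₁ h.isC1H1₂).const_mul K
  have c₁ := h.contDiff₁.continuous
  have c₂ := h.contDiff₂.continuous
  have key {f : ℝ → ℝ} (hf : Continuous f) (hfK : ∀ x, |f x| ≤ K * (r₁ x ^ 2 + r₂ x ^ 2)) :
      ∃ H : ℝ →ᵇ ℝ, (∀ x, H x = f x) ∧ Integrable H :=
    ⟨BoundedContinuousFunction.ofNormedAddCommGroup f hf _ fun x => (hfK x).trans (hle x),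
      fun _ => rfl, hint.mono' hf.aestronglyMeasurable (Eventually.of_forall hfK)⟩
  refine ⟨key ?_ fun x => (hb x).1, key ?_ fun x => (hb x).2⟩
  · unfold hess11
    exact ((c₁.rpow_const fun _ => Or.inr (by linarith)).const_mul _).add
      (((c₁.rpow_const fun _ => Or.inr (by linarith)).const_mul _).mul
        (c₂.rpow_const fun _ => Or.inr (by linarith)))
  · unfold hess12
    exact ((c₁.rpow_const fun _ => Or.inr (by linarith)).const_mul _).mul
      (c₂.rpow_const fun _ => Or.inr (by linarith))

lemma IsSolution.exists_isHessian (h : IsSolution p β r₁ r₂) (hp : 1 ≤ p) (hβ : 0 < β) :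
    ∃ h₁ h₁₂ h₂ : ℝ →ᵇ ℝ, IsHessian p β r₁ r₂ h₁ h₁₂ h₂ := by
  obtain ⟨⟨h₁, e₁, i₁⟩, ⟨h₁₂, e₁₂, i₁₂⟩⟩ := h.exists_hess_coeff hp hβ
  obtain ⟨⟨h₂, e₂, i₂⟩, -⟩ := h.symm.exists_hess_coeff hp hβ
  exact ⟨h₁, h₁₂, h₂, e₁, e₁₂, e₂, i₁, i₁₂, i₂⟩

/-- A solution as an element of `H¹ × H¹`. -/
def IsSolution.toHH (h : IsSolution p β r₁ r₂) : HH := (h.isC1H1₁.toH1, h.isC1H1₂.toH1)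

section Hessian
variable {h₁ h₁₂ h₂ : ℝ →ᵇ ℝ}

lemma IsHessian.symm (H : IsHessian p β r₁ r₂ h₁ h₁₂ h₂) : IsHessian p β r₂ r₁ h₂ h₁₂ h₁ :=
  ⟨H.eq₂, fun x => (H.eq₁₂ x).trans (hess12_comm _ _ _ _), H.eq₁, H.integrable₂, H.integrable₁₂,
    H.integrable₁⟩

lemma IsHessian.Lplus_eq (H : IsHessian p β r₁ r₂ h₁ h₁₂ h₂) (U V : HH) :
    Lplus p β r₁ r₂ U V = schrodForm h₁ h₁₂ h₂ U V := by
  have i (h k : ℝ →ᵇ ℝ) (u v w : L2) : Integrable fun x => h x * u x * w x + k x * v x * w x :=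
    (integrable_mulOp h u w).add (integrable_mulOp k v w)
  rw [Lplus, schrodForm]
  simp only [inner_mulOp]
  rw [L2.inner_eq, L2.inner_eq, L2.inner_eq, L2.inner_eq,
    ← integral_add (L2.integrable_mul _ _) (L2.integrable_mul _ _),
    ← integral_add (L2.integrable_mul _ _) (L2.integrable_mul _ _),
    ← integral_add (integrable_mulOp _ _ _) (integrable_mulOp _ _ _), add_assoc (∫ _, _ + _),
    ← integral_add (integrable_mulOp _ _ _) (integrable_mulOp _ _ _),
    ← integral_add (i h₁ h₁₂ _ _ _) (i h₁₂ h₂ _ _ _)]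
  congr 2
  funext x
  rw [← H.eq₁, ← H.eq₁₂, ← H.eq₂]
  ring

lemma IsSolution.pairing_eq (h : IsSolution p β r₁ r₂) (U : HH) :
    pairing (fn h.toHH.1) (fn h.toHH.2) U = ∫ x, (fn U.1 x * r₁ x + fn U.2 x * r₂ x) := by
  rw [pairing_apply, L2.inner_eq, L2.inner_eq,
    ← integral_add (L2.integrable_mul _ _) (L2.integrable_mul _ _)]
  refine integral_congr_ae ?_
  filter_upwards [h.isC1H1₁.fn_toH1_ae, h.isC1H1₂.fn_toH1_ae] with x e1 e2
  rw [← e1, ← e2]; rfl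

/-- The first component of `H_F(R) ∂ₓR`; the second one arises by exchanging the components. -/
def hessDer (h₁ h₁₂ : ℝ →ᵇ ℝ) (d₁ d₂ : L2) : L2 := mulOp h₁ d₁ + mulOp h₁₂ d₂

lemma IsHessian.mem_V0_iff (H : IsHessian p β r₁ r₂ h₁ h₁₂ h₂) (h : IsSolution p β r₁ r₂) (U : HH) :
    U ∈ V0 p β r₁ r₂ ↔ pairing (fn h.toHH.1) (fn h.toHH.2) U = 0 ∧
      pairing (hessDer h₁ h₁₂ (der h.toHH.1) (der h.toHH.2))
        (hessDer h₂ h₁₂ (der h.toHH.2) (der h.toHH.1)) U = 0 := by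
  rw [h.pairing_eq, pairing_apply, L2.inner_eq, L2.inner_eq,
    ← integral_add (L2.integrable_mul _ _) (L2.integrable_mul _ _)]
  refine and_congr_right' (Eq.congr_left (integral_congr_ae ?_))
  filter_upwards [h.isC1H1₁.der_toH1_ae, h.isC1H1₂.der_toH1_ae,
    Lp.coeFn_add (mulOp h₁ (der h.toHH.1)) (mulOp h₁₂ (der h.toHH.2)),
    Lp.coeFn_add (mulOp h₂ (der h.toHH.2)) (mulOp h₁₂ (der h.toHH.1)),
    mulOp_ae h₁ (der h.toHH.1), mulOp_ae h₁₂ (der h.toHH.2),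
    mulOp_ae h₂ (der h.toHH.2), mulOp_ae h₁₂ (der h.toHH.1)] with x e1 e2 e3 e4 e5 e6 e7 e8
  rw [hessDer, hessDer, e3, e4, Pi.add_apply, Pi.add_apply, e5, e6, e7, e8, ← H.eq₁, ← H.eq₁₂,
    ← H.eq₂, ← e1, ← e2]
  simp only [IsSolution.toHH]
  ring

/-! ### Nonnegativity of `L₊` on the orthogonal complement of `R` -/

lemma IsHessian.schrodForm_toH1 (H : IsHessian p β r₁ r₂ h₁ h₁₂ h₂) (h : IsSolution p β r₁ r₂)
    (hp : 1 ≤ p) {u₁ u₂ : ℝ → ℝ} (hu₁ : IsC1H1 u₁) (hu₂ : IsC1H1 u₂) :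
    schrodForm h₁ h₁₂ h₂ (hu₁.toH1, hu₂.toH1) (hu₁.toH1, hu₂.toH1)
      = 1 / 2 * kin u₁ u₂ + mass u₁ u₂
        - 1 / 2 * ∫ x, hessForm p β (r₁ x) (r₂ x) (u₁ x) (u₂ x) := by
  rw [← H.Lplus_eq, Lplus, kin, mass, ← integral_const_mul (1 / 2) fun x => hessForm p β _ _ _ _]
  congr 1
  · congr 1
    · congr 1
      refine integral_congr_ae ?_
      filter_upwards [hu₁.der_toH1_ae, hu₂.der_toH1_ae] with x e1 e2
      simp only [e1, e2]; ring
    · refine integral_congr_ae ?_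
      filter_upwards [hu₁.fn_toH1_ae, hu₂.fn_toH1_ae] with x e1 e2
      simp only [e1, e2]; ring
  · refine integral_congr_ae ?_
    filter_upwards [hu₁.fn_toH1_ae, hu₂.fn_toH1_ae] with x e1 e2
    simp only [e1, e2]
    rw [hessForm, hessFdiag_of_nonneg (h.nonneg₁ x) (h.nonneg₂ x),
      hessFdiag_of_nonneg (h.nonneg₂ x) (h.nonneg₁ x),
      hessFmixed_of_nonneg hp (h.nonneg₁ x) (h.nonneg₂ x), hess22_eq]
    ring

/-- The Dirichlet form `(∂ₓU, ∂ₓV)`. -/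
def dirichlet (U V : HH) : ℝ := inner ℝ (der U.1) (der V.1) + inner ℝ (der U.2) (der V.2)

@[fun_prop]
lemma continuous_dirichlet_left (V : HH) : Continuous fun U => dirichlet U V := by
  unfold dirichlet; fun_prop

lemma pairing_toHH_self (hR : IsGroundState p β r₁ r₂) :
    0 < pairing (fn hR.isSolution.toHH.1) (fn hR.isSolution.toHH.2) hR.isSolution.toHH := by
  have h := hR.isSolution
  rw [h.pairing_eq]
  refine (mass_pos h.isC1H1₁ h.isC1H1₂ hR.ne_zero).trans_eq (integral_congr_ae ?_)
  filter_upwards [h.isC1H1₁.fn_toH1_ae, h.isC1H1₂.fn_toH1_ae] with x e1 e2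
  simp only [IsSolution.toHH, e1, e2]; ring

/-- On the orthogonal complement of `R` the form of `L₊` is nonnegative, and it controls the
square of `(∂ₓU, ∂ₓR)`. This extends the second variation inequality from classical functions by
density, after projecting along `R`. -/
theorem IsHessian.dirichlet_sq_le (H : IsHessian p β r₁ r₂ h₁ h₁₂ h₂)
    (hR : IsGroundState p β r₁ r₂) (hp : 1 ≤ p) (hβ : 0 < β) {U : HH}
    (hU : pairing (fn hR.isSolution.toHH.1) (fn hR.isSolution.toHH.2) U = 0) :
    (2 - p) * (p + 1) / (2 * p * (1 / 2 * kin r₁ r₂ + mass r₁ r₂))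
      * dirichlet U hR.isSolution.toHH ^ 2 ≤ schrodForm h₁ h₁₂ h₂ U U := by
  have h := hR.isSolution
  set c := (2 - p) * (p + 1) / (2 * p * (1 / 2 * kin r₁ r₂ + mass r₁ r₂)) with hc
  set Z := h.toHH with hZ
  set P := pairing (fn Z.1) (fn Z.2) with hP
  have hPZ : 0 < P Z := pairing_toHH_self hR
  have hclass {u₁ u₂ : ℝ → ℝ} (hu₁ : IsC1H1 u₁) (hu₂ : IsC1H1 u₂)
      (h0 : P (hu₁.toH1, hu₂.toH1) = 0) : c * dirichlet (hu₁.toH1, hu₂.toH1) Z ^ 2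
        ≤ schrodForm h₁ h₁₂ h₂ (hu₁.toH1, hu₂.toH1) (hu₁.toH1, hu₂.toH1) := by
    rw [H.schrodForm_toH1 h hp hu₁ hu₂]
    have horth : ∫ x, (r₁ x * u₁ x + r₂ x * u₂ x) = 0 := by
      rw [← h0, hP, hZ, h.pairing_eq]
      refine integral_congr_ae ?_
      filter_upwards [hu₁.fn_toH1_ae, hu₂.fn_toH1_ae] with x e1 e2
      simp only [e1, e2]; ring
    have hd : dirichlet (hu₁.toH1, hu₂.toH1) Z
        = ∫ x, (deriv r₁ x * deriv u₁ x + deriv r₂ x * deriv u₂ x) := by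
      rw [dirichlet, L2.inner_eq, L2.inner_eq,
        ← integral_add (L2.integrable_mul _ _) (L2.integrable_mul _ _)]
      refine integral_congr_ae ?_
      filter_upwards [hu₁.der_toH1_ae, hu₂.der_toH1_ae, h.isC1H1₁.der_toH1_ae,
        h.isC1H1₂.der_toH1_ae] with x e1 e2 e3 e4
      simp only [hZ, IsSolution.toHH, e1, e2, e3, e4]; ring
    rw [hd]
    exact hR.second_variation hp hβ hu₁ hu₂ horth
  have hcont : Continuous fun V : HH => V - (P V / P Z) • Z := by
    have : Continuous P := continuous_pairing _ _
    fun_prop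
  have hcl : IsClosed {V : HH | c * dirichlet (V - (P V / P Z) • Z) Z ^ 2
      ≤ schrodForm h₁ h₁₂ h₂ (V - (P V / P Z) • Z) (V - (P V / P Z) • Z)} :=
    isClosed_le (((((continuous_dirichlet_left Z).comp hcont).pow 2).const_mul c))
      ((continuous_schrodForm_self h₁ h₁₂ h₂).comp hcont)
  have hsub : {u : H1 | ∃ (v : ℝ → ℝ) (hv : IsC1H1 v), u = hv.toH1} ×ˢ
      {u : H1 | ∃ (v : ℝ → ℝ) (hv : IsC1H1 v), u = hv.toH1} ⊆ {V : HH |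
        c * dirichlet (V - (P V / P Z) • Z) Z ^ 2
          ≤ schrodForm h₁ h₁₂ h₂ (V - (P V / P Z) • Z) (V - (P V / P Z) • Z)} := by
    rintro ⟨-, -⟩ ⟨⟨f, hf, rfl⟩, ⟨g, hg, rfl⟩⟩
    set t := P (hf.toH1, hg.toH1) / P Z with ht
    have e : ((hf.toH1, hg.toH1) : HH) - t • Z
        = ((hf.add (h.isC1H1₁.const_smul (-t))).toH1, (hg.add (h.isC1H1₂.const_smul (-t))).toH1) := by
      have e0 : ((hf.toH1, hg.toH1) : HH) - t • Z = (hf.toH1, hg.toH1) + (-t) • Z :=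
        (sub_eq_add_neg _ _).trans (congrArg _ (neg_smul t Z).symm)
      rw [e0, hf.toH1_add (h.isC1H1₁.const_smul (-t)), hg.toH1_add (h.isC1H1₂.const_smul (-t)),
        IsC1H1.toH1_const_smul _ h.isC1H1₁, IsC1H1.toH1_const_smul _ h.isC1H1₂]
      rfl
    change c * dirichlet (((hf.toH1, hg.toH1) : HH) - t • Z) Z ^ 2 ≤ _
    change _ ≤ schrodForm h₁ h₁₂ h₂ (((hf.toH1, hg.toH1) : HH) - t • Z) (_ - t • Z)
    have h0 : P (((hf.toH1, hg.toH1) : HH) - t • Z) = 0 := by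
      rw [map_sub, map_smul, ht, smul_eq_mul, div_mul_cancel₀ _ hPZ.ne', sub_self]
    rw [e] at h0 ⊢
    exact hclass _ _ h0
  have hall := hcl.closure_subset_iff.2 hsub ((dense_isC1H1.prod dense_isC1H1) U)
  simpa only [Set.mem_ofPred_eq, hU, zero_div, zero_smul, sub_zero] using hall

/-! ### Triviality of the kernel -/

/-- `L₊R = -2p (-½ ∂ₓₓ + 1) R`, tested against `U`. -/
lemma IsHessian.schrodForm_toHH (H : IsHessian p β r₁ r₂ h₁ h₁₂ h₂) (h : IsSolution p β r₁ r₂)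
    (hp : 1 ≤ p) (U : HH) : schrodForm h₁ h₁₂ h₂ U h.toHH
      = -2 * p * (1 / 2 * dirichlet U h.toHH + pairing (fn h.toHH.1) (fn h.toHH.2) U) := by
  have key {r₁ r₂ : ℝ → ℝ} {h₁ h₁₂ h₂ : ℝ →ᵇ ℝ} (H : IsHessian p β r₁ r₂ h₁ h₁₂ h₂)
      (h : IsSolution p β r₁ r₂) (u : H1) :
      inner ℝ (mulOp h₁ (fn u)) (fn h.isC1H1₁.toH1) + inner ℝ (mulOp h₁₂ (fn u)) (fn h.isC1H1₂.toH1)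
        = (2 * p + 1) * (1 / 2 * inner ℝ (der u) (der h.isC1H1₁.toH1)
          + inner ℝ (fn u) (fn h.isC1H1₁.toH1)) := by
    have hibp := inner_der_fn u (h.isC1H1_deriv hp).toH1
    change inner ℝ (der u) (der h.isC1H1₁.toH1) = _ at hibp
    rw [hibp, inner_mulOp, inner_mulOp, ← integral_add (integrable_mulOp _ _ _)
      (integrable_mulOp _ _ _), mul_neg, neg_add_eq_sub, L2.inner_eq, L2.inner_eq,
      ← integral_const_mul, ← integral_sub (L2.integrable_mul _ _)
      ((L2.integrable_mul _ _).const_mul _), ← integral_const_mul]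
    refine integral_congr_ae ?_
    filter_upwards [h.isC1H1₁.fn_toH1_ae, h.isC1H1₂.fn_toH1_ae,
      (h.isC1H1_deriv hp).der_toH1_ae] with x e1 e2 e3
    have hn₁ := h.nonneg₁ x
    have hn₂ := h.nonneg₂ x
    simp only [e1, e2, e3]
    rw [h.deriv_deriv hp, gradF_of_nonneg hp hn₁ hn₂, H.eq₁, H.eq₁₂, hess11, hess12,
      Real.rpow_add_one' hn₁ (by linarith), Real.rpow_add_one' hn₂ (by linarith)]
    have e : r₁ x ^ p = r₁ x ^ (p - 1) * r₁ x := by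
      rw [← Real.rpow_add_one' hn₁ (by linarith), sub_add_cancel]
    rw [e]; ring
  have k1 := key H h U.1
  have k2 := key H.symm h.symm U.2
  have k3 : inner ℝ (mulOp h₁₂ (fn U.2)) (fn h.isC1H1₁.toH1)
    = inner ℝ (mulOp h₁₂ (fn U.2)) (fn h.symm.isC1H1₂.toH1) := rfl
  simp only [schrodForm, dirichlet, pairing_apply, IsSolution.toHH]
  change inner ℝ (mulOp h₂ (fn U.2)) (fn h.isC1H1₂.toH1) + _ = (2 * p + 1) *
    (1 / 2 * inner ℝ (der U.2) (der h.isC1H1₂.toH1) + inner ℝ (fn U.2) (fn h.isC1H1₂.toH1)) at k2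
  linear_combination -k1 - k2 - k3

lemma contDiff_two_of_hasDerivAt {f g k : ℝ → ℝ} (hf : ∀ x, HasDerivAt f (g x) x)
    (hg : ∀ x, HasDerivAt g (k x) x) (hk : Continuous k) : ContDiff ℝ 2 f := by
  have e1 : deriv f = g := funext fun x => (hf x).deriv
  have e2 : deriv g = k := funext fun x => (hg x).deriv
  rw [← one_add_one_eq_two, contDiff_succ_iff_deriv]
  refine ⟨fun x => (hf x).differentiableAt, by simp, ?_⟩
  rw [e1, contDiff_one_iff_deriv, e2]
  exact ⟨fun x => (hg x).differentiableAt, hk⟩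

/-- Weak solutions of the first equation of `L₊U = 0` are classical. -/
lemma exists_deriv_of_weak_solution {U : HH}
    (hU : ∀ v : H1, schrodForm h₁ h₁₂ h₂ U (v, 0) = 0) :
    ContDiff ℝ 2 (rep U.1) ∧ ((fun x => der U.1 x) =ᵐ[volume] deriv (rep U.1)) ∧
      ∀ x, -(1 / 2) * deriv (deriv (rep U.1)) x + rep U.1 x
        = h₁ x * rep U.1 x + h₁₂ x * rep U.2 x := by
  set w : L2 := (2 : ℝ) • (fn U.1 - (mulOp h₁ (fn U.1) + mulOp h₁₂ (fn U.2))) with hw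
  have hweak : IsWeakDeriv (der U.1) w := by
    rw [isWeakDeriv_iff_inner]
    intro φ h hc
    have := hU (IsC1H1.of_test h hc).toH1
    simp only [schrodForm, der_zero, fn_zero, inner_zero_right] at this
    rw [hw, real_inner_smul_left, inner_sub_left, inner_add_left]
    simp only [IsC1H1.fn_toH1, IsC1H1.der_toH1] at this
    linear_combination 2 * this
  set D : H1 := ⟨(der U.1, w), hweak⟩ with hD
  set g : ℝ → ℝ := fun x => 2 * (rep U.1 x - (h₁ x * rep U.1 x + h₁₂ x * rep U.2 x)) with hg
  have c1 := continuous_rep U.1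
  have c2 := continuous_rep U.2
  have hgc : Continuous g := by
    have := h₁.continuous
    have := h₁₂.continuous
    fun_prop
  have hd1 (x : ℝ) : HasDerivAt (rep U.1) (rep D x) x :=
    hasDerivAt_rep (continuous_rep D) (fn_ae_eq_rep D) x
  have hd2 (x : ℝ) : HasDerivAt (rep D) (g x) x := by
    refine hasDerivAt_rep hgc ?_ x
    change (fun x => w x) =ᵐ[volume] g
    filter_upwards [Lp.coeFn_smul (2 : ℝ) (fn U.1 - (mulOp h₁ (fn U.1) + mulOp h₁₂ (fn U.2))),
      Lp.coeFn_sub (fn U.1) (mulOp h₁ (fn U.1) + mulOp h₁₂ (fn U.2)),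
      Lp.coeFn_add (mulOp h₁ (fn U.1)) (mulOp h₁₂ (fn U.2)), mulOp_ae h₁ (fn U.1),
      mulOp_ae h₁₂ (fn U.2), fn_ae_eq_rep U.1, fn_ae_eq_rep U.2] with x e1 e2 e3 e4 e5 e6 e7
    rw [hw, e1, Pi.smul_apply, e2, Pi.sub_apply, e3, Pi.add_apply, e4, e5, e6, e7, smul_eq_mul]
  have e1 : deriv (rep U.1) = rep D := funext fun x => (hd1 x).deriv
  refine ⟨contDiff_two_of_hasDerivAt hd1 hd2 hgc, ?_, fun x => ?_⟩
  · rw [e1]; exact fn_ae_eq_rep D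
  · rw [e1, (hd2 x).deriv, hg]; ring

lemma schrodForm_swap (h₁ h₁₂ h₂ : ℝ →ᵇ ℝ) (U V : HH) :
    schrodForm h₂ h₁₂ h₁ U.swap V.swap = schrodForm h₁ h₁₂ h₂ U V := by
  simp only [schrodForm, Prod.fst_swap, Prod.snd_swap]; ring

lemma IsHessian.isLinearizedSolution_rep (H : IsHessian p β r₁ r₂ h₁ h₁₂ h₂) {U : HH}
    (hU : ∀ V, schrodForm h₁ h₁₂ h₂ U V = 0) :
    IsLinearizedSolution p β r₁ r₂ (rep U.1) (rep U.2) := by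
  obtain ⟨a1, a2, a3⟩ := exists_deriv_of_weak_solution fun v => hU (v, 0)
  obtain ⟨b1, b2, b3⟩ := exists_deriv_of_weak_solution (U := U.swap) (h₁ := h₂) (h₁₂ := h₁₂)
    (h₂ := h₁) fun v => (schrodForm_swap h₁ h₁₂ h₂ U (0, v)).trans (hU (0, v))
  refine ⟨a1, b1, (memLp_congr_ae (fn_ae_eq_rep U.1)).1 (Lp.memLp _),
    (memLp_congr_ae (fn_ae_eq_rep U.2)).1 (Lp.memLp _), (memLp_congr_ae a2).1 (Lp.memLp _),
    (memLp_congr_ae b2).1 (Lp.memLp _), fun x => ?_, fun x => ?_⟩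
  · rw [a3 x, H.eq₁, H.eq₁₂]
  · rw [← H.eq₂, ← H.eq₁₂]; exact b3 x

lemma eq_zero_of_quadratic_nonneg {b c : ℝ} (h : ∀ t : ℝ, 0 ≤ 2 * t * b + t ^ 2 * c) : b = 0 := by
  have h1 : discrim c (2 * b) 0 ≤ 0 := discrim_le_zero fun t => by linarith [h t]
  rw [discrim] at h1
  nlinarith [sq_nonneg b]

/-- The form of `L₊` is definite on `𝒱₀`: this is where non-degeneracy enters. -/
theorem IsHessian.eq_zero_of_schrodForm_eq_zero (H : IsHessian p β r₁ r₂ h₁ h₁₂ h₂)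
    (hR : IsGroundState p β r₁ r₂) (hnd : IsNondegenerate p β r₁ r₂) (hp : 1 ≤ p) (hp2 : p < 2)
    (hβ : 0 < β) {U : HH} (hU : U ∈ V0 p β r₁ r₂) (h0 : schrodForm h₁ h₁₂ h₂ U U = 0) : U = 0 := by
  have h := hR.isSolution
  obtain ⟨hU1, hU2⟩ := (H.mem_V0_iff h U).1 hU
  set Z := h.toHH with hZ
  set P := pairing (fn Z.1) (fn Z.2) with hP
  have hPZ : 0 < P Z := pairing_toHH_self hR
  have hmass := mass_pos h.isC1H1₁ h.isC1H1₂ hR.ne_zero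
  have hkin := kin_nonneg r₁ r₂
  have hc : 0 < (2 - p) * (p + 1) / (2 * p * (1 / 2 * kin r₁ r₂ + mass r₁ r₂)) := by
    have : 0 < 2 - p := by linarith
    positivity
  have hnn {V : HH} (hV : P V = 0) : 0 ≤ schrodForm h₁ h₁₂ h₂ V V :=
    (mul_nonneg hc.le (sq_nonneg _)).trans (H.dirichlet_sq_le hR hp hβ hV)
  have hx : dirichlet U Z = 0 := by
    have h1 := H.dirichlet_sq_le hR hp hβ hU1
    rw [h0] at h1
    exact pow_eq_zero_iff two_ne_zero |>.1
      (le_antisymm (nonpos_of_mul_nonpos_right h1 hc) (sq_nonneg _))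
  have hZ0 : schrodForm h₁ h₁₂ h₂ U Z = 0 := by
    rw [H.schrodForm_toHH h hp U, hx, hU1]; ring
  have horth {V : HH} (hV : P V = 0) : schrodForm h₁ h₁₂ h₂ U V = 0 := by
    refine eq_zero_of_quadratic_nonneg (c := schrodForm h₁ h₁₂ h₂ V V) fun t => ?_
    have h1 := hnn (V := U + t • V) (by rw [map_add, map_smul, hU1, hV, smul_zero, add_zero])
    rwa [schrodForm_add_smul_self, h0, zero_add] at h1
  have hall (V : HH) : schrodForm h₁ h₁₂ h₂ U V = 0 := by
    have h1 : P (V + (-(P V / P Z)) • Z) = 0 := by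
      rw [map_add, map_smul, smul_eq_mul, neg_mul, div_mul_cancel₀ _ hPZ.ne', add_neg_cancel]
    have h2 := horth h1
    rwa [schrodForm_add_right, schrodForm_smul_right, hZ0, mul_zero, add_zero] at h2
  obtain ⟨θ, hθ⟩ := hnd.2 (rep U.1, rep U.2) (H.isLinearizedSolution_rep hall)
  have e1 : fn U.1 = θ • der Z.1 := by
    refine Lp.ext ?_
    filter_upwards [fn_ae_eq_rep U.1, Lp.coeFn_smul θ (der Z.1), h.isC1H1₁.der_toH1_ae]
      with x a1 a2 a3
    rw [a1, a2, Pi.smul_apply, hZ, IsSolution.toHH, a3]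
    exact congrFun (congrArg Prod.fst hθ) x
  have e2 : fn U.2 = θ • der Z.2 := by
    refine Lp.ext ?_
    filter_upwards [fn_ae_eq_rep U.2, Lp.coeFn_smul θ (der Z.2), h.isC1H1₂.der_toH1_ae]
      with x a1 a2 a3
    rw [a1, a2, Pi.smul_apply, hZ, IsSolution.toHH, a3]
    exact congrFun (congrArg Prod.snd hθ) x
  -- since `U = θ ∂ₓR`, the second orthogonality condition says `(H_F(R)U, U) = 0`
  have hHU : inner ℝ (mulOp h₁ (fn U.1)) (fn U.1) + inner ℝ (mulOp h₁₂ (fn U.2)) (fn U.1)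
      + inner ℝ (mulOp h₁₂ (fn U.1)) (fn U.2) + inner ℝ (mulOp h₂ (fn U.2)) (fn U.2) = 0 := by
    have e3 : hessDer h₁ h₁₂ (fn U.1) (fn U.2) = θ • hessDer h₁ h₁₂ (der Z.1) (der Z.2) := by
      rw [hessDer, hessDer, e1, e2, map_smul, map_smul, smul_add]
    have e4 : hessDer h₂ h₁₂ (fn U.2) (fn U.1) = θ • hessDer h₂ h₁₂ (der Z.2) (der Z.1) := by
      rw [hessDer, hessDer, e1, e2, map_smul, map_smul, smul_add]
    have h1 : inner ℝ (fn U.1) (hessDer h₁ h₁₂ (fn U.1) (fn U.2))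
        + inner ℝ (fn U.2) (hessDer h₂ h₁₂ (fn U.2) (fn U.1)) = 0 := by
      rw [e3, e4, real_inner_smul_right, real_inner_smul_right, ← mul_add, ← pairing_apply, hU2,
        mul_zero]
    rw [real_inner_comm, real_inner_comm _ (fn U.2), hessDer, hessDer, inner_add_left,
      inner_add_left] at h1
    linarith
  rw [schrodForm_self, hHU, sub_zero] at h0
  have h3 := sq_nonneg ‖der U.1‖
  have h4 := sq_nonneg ‖der U.2‖
  have h5 : 0 ≤ l2NormSq U := by unfold l2NormSq; positivity
  refine eq_zero_of_hNormSq (le_antisymm ?_ (hNormSq_nonneg U))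
  rw [hNormSq]; linarith

end Hessian

end

/-! ### The space `𝒱₀` and the norm `|||·|||` -/

/-- Evaluation of the continuous representative at a point. -/
def repEval (x : ℝ) : H1 →ₗ[ℝ] ℝ where
  toFun u := rep u x
  map_add' u v := by
    obtain ⟨a, b, -, -, h⟩ := exists_rep_eq_inner x
    simp only [h, fn_add, der_add, inner_add_left]; ring
  map_smul' c u := by
    obtain ⟨a, b, -, -, h⟩ := exists_rep_eq_inner x
    simp only [h, fn_smul, der_smul, real_inner_smul_left, RingHom.id_apply, smul_eq_mul]; ring

/-- Two linear functionals on `H¹ × H¹` have a common nonzero zero: three bumps with disjoint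
supports span a three-dimensional space. -/
lemma exists_ne_zero_of_functionals (P Q : HH →ₗ[ℝ] ℝ) : ∃ U : HH, U ≠ 0 ∧ P U = 0 ∧ Q U = 0 := by
  let f (i : Fin 3) : ContDiffBump (5 * (i : ℝ)) := ⟨1, 2, by norm_num, by norm_num⟩
  let b (i : Fin 3) : H1 := (IsC1H1.of_test (f i).contDiff (f i).hasCompactSupport).toH1
  have hb (i j : Fin 3) : repEval (5 * (i : ℝ)) (b j) = if i = j then 1 else 0 := by
    change rep (b j) _ = _
    rw [rep_toH1]
    split_ifs with h
    · subst h
      exact (f i).one_of_mem_closedBall (by simp [f])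
    · refine (f j).zero_of_le_dist ?_
      change (2 : ℝ) ≤ _
      rw [Real.dist_eq, ← mul_sub, abs_mul]
      have h1 : (1 : ℝ) ≤ |((i : ℕ) : ℝ) - ((j : ℕ) : ℝ)| := by
        have h2 : (1 : ℤ) ≤ |((i : ℕ) : ℤ) - ((j : ℕ) : ℤ)| :=
          Int.one_le_abs (sub_ne_zero.2 fun h3 => h (Fin.ext (by exact_mod_cast h3)))
        exact_mod_cast h2
      norm_num
      linarith
  let S : (Fin 3 → ℝ) →ₗ[ℝ] H1 := Fintype.linearCombination ℝ b
  let T : (Fin 3 → ℝ) →ₗ[ℝ] ℝ × ℝ := (P.prod Q) ∘ₗ (LinearMap.inl ℝ H1 H1) ∘ₗ S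
  have hT : T.ker ≠ ⊥ := LinearMap.ker_ne_bot_of_finrank_lt (by simp)
  obtain ⟨c, hc, hc0⟩ := Submodule.exists_mem_ne_zero_of_ne_bot hT
  have hc' : T c = 0 := hc
  refine ⟨(S c, 0), fun h => hc0 (funext fun i => ?_), congrArg Prod.fst hc',
    congrArg Prod.snd hc'⟩
  have h1 : repEval (5 * (i : ℝ)) (S c) = 0 := by
    rw [show S c = 0 from congrArg Prod.fst h, map_zero]
  simpa [S, Fintype.linearCombination_apply, map_sum, hb] using h1

end NLSSystem

end


open NLSSystem in
theorem proposition2p2 (p β : ℝ) (hp : 1 ≤ p ∧ p < 2) (hβ : 0 < β) (r₁ r₂ : ℝ → ℝ)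
    (hR : IsGroundState p β r₁ r₂) (hnd : IsNondegenerate p β r₁ r₂) :
    -- the infimum of the quotient over the nonzero elements of `𝒱₀` is positive
    0 < sInf {q : ℝ | ∃ U ∈ V0 p β r₁ r₂, U ≠ 0 ∧ q = Lplus p β r₁ r₂ U U / l2NormSq U} ∧
    -- coercivity in the `L²` norm
    (∃ α₀ : ℝ, 0 < α₀ ∧ ∀ U ∈ V0 p β r₁ r₂, α₀ * l2NormSq U ≤ Lplus p β r₁ r₂ U U) ∧
    -- coercivity in the `H¹` norm, and the converse bound
    (∃ α : ℝ, 0 < α ∧ ∀ U ∈ V0 p β r₁ r₂, α * hNormSq U ≤ Lplus p β r₁ r₂ U U) ∧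
    (∃ C : ℝ, ∀ U ∈ V0 p β r₁ r₂, Lplus p β r₁ r₂ U U ≤ C * hNormSq U) ∧
    -- `𝒱₀` is a linear subspace on which `|||·|||` is a norm
    (∃ S : Submodule ℝ HH, (S : Set HH) = V0 p β r₁ r₂) ∧
    (∀ U ∈ V0 p β r₁ r₂, tripleNorm p β r₁ r₂ U = 0 → U = 0) ∧
    (∀ U ∈ V0 p β r₁ r₂, ∀ c : ℝ,
      tripleNorm p β r₁ r₂ (c • U) = |c| * tripleNorm p β r₁ r₂ U) ∧
    (∀ U ∈ V0 p β r₁ r₂, ∀ V ∈ V0 p β r₁ r₂,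
      tripleNorm p β r₁ r₂ (U + V) ≤ tripleNorm p β r₁ r₂ U + tripleNorm p β r₁ r₂ V) ∧
    -- and `𝒱₀` is complete for this norm
    (∀ U : ℕ → HH, (∀ n, U n ∈ V0 p β r₁ r₂) →
      (∀ ε : ℝ, 0 < ε → ∃ N : ℕ, ∀ m ≥ N, ∀ n ≥ N, tripleNorm p β r₁ r₂ (U m - U n) < ε) →
      ∃ W ∈ V0 p β r₁ r₂, Tendsto (fun n => tripleNorm p β r₁ r₂ (U n - W)) atTop (𝓝 0)) := by
  obtain ⟨hp1, hp2⟩ := hp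
  have h := hR.isSolution
  obtain ⟨h₁, h₁₂, h₂, H⟩ := h.exists_isHessian hp1 hβ
  set P := pairing (fn h.toHH.1) (fn h.toHH.2) with hP
  set Q := pairing (hessDer h₁ h₁₂ (der h.toHH.1) (der h.toHH.2))
    (hessDer h₂ h₁₂ (der h.toHH.2) (der h.toHH.1)) with hQ
  have hmem (U : HH) : U ∈ V0 p β r₁ r₂ ↔ P U = 0 ∧ Q U = 0 := H.mem_V0_iff h U
  set S : Submodule ℝ HH := P.ker ⊓ Q.ker with hS
  have hSV : (S : Set HH) = V0 p β r₁ r₂ := Set.ext fun U => (hmem U).symm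
  have hSmem (U : HH) : U ∈ V0 p β r₁ r₂ ↔ U ∈ S := by rw [← hSV]; rfl
  have hScl : IsClosed (S : Set HH) := by
    have h1 : IsClosed {U : HH | P U = 0} := isClosed_eq (continuous_pairing _ _) continuous_const
    have h2 : IsClosed {U : HH | Q U = 0} := isClosed_eq (continuous_pairing _ _) continuous_const
    exact h1.inter h2
  simp only [tripleNorm, H.Lplus_eq]
  set B := schrodForm h₁ h₁₂ h₂ with hB
  have hc0 : 0 ≤ (2 - p) * (p + 1) / (2 * p * (1 / 2 * kin r₁ r₂ + mass r₁ r₂)) := by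
    have h1 : 0 ≤ 2 - p := by linarith
    have h2 := kin_nonneg r₁ r₂
    have h3 := mass_nonneg r₁ r₂
    positivity
  obtain ⟨α, hα, hcoer⟩ := exists_coercive H.integrable₁ H.integrable₁₂ H.integrable₂
    (fn h.toHH.1) (fn h.toHH.2) (hessDer h₁ h₁₂ (der h.toHH.1) (der h.toHH.2))
    (hessDer h₂ h₁₂ (der h.toHH.2) (der h.toHH.1))
    (fun U hU _ => (mul_nonneg hc0 (sq_nonneg _)).trans (H.dirichlet_sq_le hR hp1 hβ hU))
    fun U hU hU' h0 => H.eq_zero_of_schrodForm_eq_zero hR hnd hp1 hp2 hβ ((hmem U).2 ⟨hU, hU'⟩) h0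
  replace hcoer {U : HH} (hU : U ∈ V0 p β r₁ r₂) : α * hNormSq U ≤ B U U :=
    hcoer U ((hmem U).1 hU).1 ((hmem U).1 hU).2
  have hnn {U : HH} (hU : U ∈ V0 p β r₁ r₂) : 0 ≤ B U U :=
    (mul_nonneg hα.le (hNormSq_nonneg U)).trans (hcoer hU)
  have hl2 {U : HH} (hU : U ∈ V0 p β r₁ r₂) : α * l2NormSq U ≤ B U U := by
    refine le_trans (mul_le_mul_of_nonneg_left ?_ hα.le) (hcoer hU)
    rw [hNormSq]
    exact le_add_of_nonneg_left (by positivity)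
  refine ⟨?_, ⟨α, hα, fun U hU => hl2 hU⟩, ⟨α, hα, fun U hU => hcoer hU⟩, ?_, ⟨S, hSV⟩, ?_, ?_, ?_,
    ?_⟩
  · refine hα.trans_le (le_csInf ?_ ?_)
    · obtain ⟨U, hU, h1, h2⟩ := exists_ne_zero_of_functionals P Q
      exact ⟨_, U, (hmem U).2 ⟨h1, h2⟩, hU, rfl⟩
    · rintro q ⟨U, hU, hU0, rfl⟩
      rw [le_div_iff₀ (l2NormSq_pos hU0)]
      exact hl2 hU
  · obtain ⟨C, hC⟩ := schrodForm_self_le h₁ h₁₂ h₂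
    exact ⟨C, fun U _ => hC U⟩
  · intro U hU h0
    rw [Real.sqrt_eq_zero (hnn hU)] at h0
    have h1 := hcoer hU
    rw [h0] at h1
    exact eq_zero_of_hNormSq (le_antisymm (nonpos_of_mul_nonpos_right h1 hα) (hNormSq_nonneg U))
  · intro U _ c
    rw [hB, schrodForm_smul_left, schrodForm_smul_right, ← mul_assoc, ← sq,
      Real.sqrt_mul (sq_nonneg c), Real.sqrt_sq_eq_abs]
  · intro U hU V hV
    have hUV (t : ℝ) : 0 ≤ B V V * (t * t) + 2 * B U V * t + B U U := by
      have h1 : U + t • V ∈ V0 p β r₁ r₂ := by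
        rw [hSmem] at hU hV ⊢
        exact S.add_mem hU (S.smul_mem t hV)
      have h2 := hnn h1
      rw [hB, schrodForm_add_smul_self] at h2
      linarith
    have h1 := discrim_le_zero hUV
    rw [discrim] at h1
    have h2 : B U V ≤ √(B U U) * √(B V V) := by
      rw [← Real.sqrt_mul (hnn hU)]
      exact Real.le_sqrt_of_sq_le (by linarith)
    have h3 := schrodForm_add_smul_self h₁ h₁₂ h₂ U V 1
    rw [one_smul] at h3
    refine Real.sqrt_le_iff.2 ⟨by positivity, ?_⟩
    rw [add_sq, Real.sq_sqrt (hnn hU), Real.sq_sqrt (hnn hV), hB, h3]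
    linarith
  · intro U hU hcauchy
    have hsub {V W : HH} (hV : V ∈ V0 p β r₁ r₂) (hW : W ∈ V0 p β r₁ r₂) :
        V - W ∈ V0 p β r₁ r₂ := by
      rw [hSmem] at hV hW ⊢
      exact S.sub_mem hV hW
    have hC : CauchySeq U := by
      refine Metric.cauchySeq_iff.2 fun ε hε => ?_
      obtain ⟨N, hN⟩ := hcauchy (√α * ε) (by positivity)
      refine ⟨N, fun m hm n hn => ?_⟩
      have h1 := hN m hm n hn
      have h2 := hcoer (hsub (hU m) (hU n))
      have h3 := norm_sq_le_hNormSq (U m - U n)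
      have h4 : √α * ‖U m - U n‖ ≤ √(B (U m - U n) (U m - U n)) := by
        refine Real.le_sqrt_of_sq_le ?_
        rw [mul_pow, Real.sq_sqrt hα.le]
        exact (mul_le_mul_of_nonneg_left h3 hα.le).trans h2
      rw [dist_eq_norm]
      exact lt_of_mul_lt_mul_left (h4.trans_lt h1) (Real.sqrt_nonneg α)
    obtain ⟨W, hW⟩ := cauchySeq_tendsto_of_complete hC
    refine ⟨W, hSV ▸ hScl.mem_of_tendsto hW (Eventually.of_forall fun n => (hSmem _).1 (hU n)), ?_⟩
    have hcont : Continuous fun V : HH => √(B (V - W) (V - W)) :=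
      ((continuous_schrodForm_self h₁ h₁₂ h₂).comp (continuous_id.sub continuous_const)).sqrt
    have h1 := (hcont.tendsto W).comp hW
    have h2 : B (W - W) (W - W) = 0 := by
      rw [sub_self, hB, schrodForm_self]; simp [l2NormSq]
    rwa [h2, Real.sqrt_zero] at h1
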